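/- **Model.** Let $G$ be a finite connected graph (parallel edges and loops allowed) in which every edge $e$ has a length $w_e>0$, and let $L=\sum_e w_e$. A *passage* is an end of an edge; it carries a marker, initially $\emptyset$. Two agents, Ariadne (A) and Theseus (T), move in $G$. A *navigation table* is a list of lines $(p_u,\ p_u',\ p_v,\ p_v')$ in order of priority. An agent that leaves a node $u$ selects the first line whose marker $p_u$ is present at a passage of $u$, picks a passage of $u$ with that marker, rewrites its marker to $p_u'$ and enters the edge; when it attains the other end $v$ of the edge, it takes the first line with the same $p_u$ whose third column agrees with what it reads (the marker of the passage by which it arrives, or whether $v$ was discovered before; "-" means anything) and rewrites the marker of the passage by which it arrives to $p_v'$. If no line applies, the agent stays at its node. The tables are: * Exploration (both agents): (B, D, -, D); ($\emptyset$, E, E, D); ($\emptyset$, E, $v$ discovered, B); ($\emptyset$, E, $v$ undiscovered, F); (F, D, -, D); (E, D, -, D). * Rendezvous, Ariadne: ($B_A$, D, -, D); ($E_T$, $E_{AT}$, -, $F_{AT}$); ($F_{AT}$, D', -, D'); ($\emptyset$, $E_A$, $v$ discovered by A, $B_A$); ($\emptyset$, $E_A$, $v$ undiscovered by A, $F_A$);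 ($F_A$, D, -, D). * Rendezvous, Theseus: ($B_T$, D, -, D); ($E_A$, $E_{AT}$, -, $F_{AT}$); ($E_{AT}$, $E_{ATT}$, -, $F_{ATT}$); ($\emptyset$, $E_T$, $v$ discovered by T, $B_T$); ($\emptyset$, $E_T$, $v$ undiscovered by T, $F_T$); ($F_T$, D, -, D). If several passages of $u$ carry the selected marker, the choice among them is arbitrary, except that in rendezvous an agent uses the passage through which it arrived at $u$ if that is one of them. **Continuous moves.** The adversary controls the speeds of both agents at all times: it chooses continuous nondecreasing functions $e_A,e_T:[0,\infty)\to[0,\infty)$ with $e_A(0)=e_T(0)=0$, where $e_i(t)$ is the energy given to agent $i$ up to time $t$, and an agent uses one unit of energy to move by one unit of length along its edge. An agent leaves its node at the instant when it starts to receive energy; energy given to an agent at a node where no line applies is lost. The cost at time $t$ is $e_A(t)+e_T(t)$. Simultaneous events are processed in an arbitrary order. Agents may pass each other inside an edge; if an agent overtakes there the other agent, which entered the edge before it through the same passage, when that passage was unmarked, then the two agents exchange the lines that they have selected. The exploration algorithm *stops* when an agent is at a node where no line applies, or when the agents meet inside an edge both of whose passages are marked D. *Explored* means that every point of every edge has been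 visited by some agent. **Proposition.** 1. (Exploration.) Let both agents start from the same node and use the exploration table. In every run on a time interval $[0,T]$: (a) if $e_A(T)+e_T(T)\ge 2L$, then there is a time $t\le T$ at which the graph is explored and the cost is at most $2L$; (b) if the algorithm stops at some time $t\le T$, then the graph is explored at time $t$; (c) if the algorithm does not stop during $[0,T]$, then the cost at time $T$ is at most $2L$. 2. (Rendezvous.) Let the agents start from arbitrary nodes and use the rendezvous tables. In every run on $[0,T]$ with $e_A(T)+e_T(T)\ge 3L$, there is a time $t\le T$ at which the two agents are at the same point of the graph (a node or an interior point of an edge) and the cost is at most $3L$. -/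

import Mathlib

namespace MobileAgents

/-- The two agents. -/
inductive Agent
  | ariadne
  | theseus

/-- The other agent. -/
def Agent.other : Agent → Agent
  | .ariadne => .theseus
  | .theseus => .ariadne

/-- A connected weighted graph with node set `V`, described by its set `P` of passages (ports).
A passage is an end of an edge: `node p` is the node at which the passage `p` is, `rev p` is the
passage at the other end of the same edge, and `len p` is the length of that edge.  The edges are
the pairs `{p, rev p}`.  Parallel edges and loops are allowed; a simple graph is the case in which
`P` is its set of darts. -/
structure WeightedGraph (V P : Type*) where
  node : P → V
  rev : P → P
  rev_rev : ∀ p, rev (rev p) = p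
  rev_ne : ∀ p, rev p ≠ p
  len : P → ℝ
  len_pos : ∀ p, 0 < len p
  len_rev : ∀ p, len (rev p) = len p
  connected : ∀ u v : V,
    Relation.ReflTransGen (fun x y => ∃ p, node p = x ∧ node (rev p) = y) u v

/-- The sum `L` of all edge lengths (every edge has two passages). -/
noncomputable def WeightedGraph.totalLength {V P : Type*} [Fintype P] (G : WeightedGraph V P) : ℝ :=
  (∑ p, G.len p) / 2

/-! ### Navigation tables -/

/-- An entry of the third column of a navigation table: what the agent reads on arrival. -/
inductive Reading (M : Type)
  | any
  | marker (m : M)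
  | discoveredBy (S : Set Agent)
  | undiscoveredBy (S : Set Agent)

/-- A line of a navigation table, with its four columns: a marker at the passage `p_u` by which the
agent leaves, the new marker of `p_u`, what is read on arrival through `p_v`, and the new marker of
`p_v`. -/
structure Line (M : Type) where
  out : M
  newOut : M
  reading : Reading M
  newIn : M

/-- A navigation algorithm: the default marker, a table for each agent with lines in order of
priority, and a tie-breaking convention.  The agent may use any passage carrying the marker of its
line; if `retrace` holds then, among these, it uses the passage through which it arrived, if that
is one of them. -/
structure Algorithm (M : Type) where
  blank : M
  table : Agent → List (Line M)
  retrace : Prop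

/-- Markers of the exploration algorithm. -/
inductive EMark
  | blank | B | E | F | D

/-- Exploration by two agents, who use the same table. -/
def exploration : Algorithm EMark where
  blank := .blank
  table := fun _ =>
    [⟨.B, .D, .any, .D⟩,
     ⟨.blank, .E, .marker .E, .D⟩,
     ⟨.blank, .E, .discoveredBy Set.univ, .B⟩,
     ⟨.blank, .E, .undiscoveredBy Set.univ, .F⟩,
     ⟨.F, .D, .any, .D⟩,
     ⟨.E, .D, .any, .D⟩]
  retrace := False

/-- Markers of the rendezvous algorithm; `D2` is the second kind of discarding marker. -/
inductive RMark
  | blank | BA | EA | FA | BT | ET | FT | EAT | FAT | EATT | FATT | D | D2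

/-- Rendezvous: the table of Ariadne. -/
def ariadneTable : List (Line RMark) :=
  [⟨.BA, .D, .any, .D⟩,
   ⟨.ET, .EAT, .any, .FAT⟩,
   ⟨.FAT, .D2, .any, .D2⟩,
   ⟨.blank, .EA, .discoveredBy {.ariadne}, .BA⟩,
   ⟨.blank, .EA, .undiscoveredBy {.ariadne}, .FA⟩,
   ⟨.FA, .D, .any, .D⟩]

/-- Rendezvous: the table of Theseus. -/
def theseusTable : List (Line RMark) :=
  [⟨.BT, .D, .any, .D⟩,
   ⟨.EA, .EAT, .any, .FAT⟩,
   ⟨.EAT, .EATT, .any, .FATT⟩,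
   ⟨.blank, .ET, .discoveredBy {.theseus}, .BT⟩,
   ⟨.blank, .ET, .undiscoveredBy {.theseus}, .FT⟩,
   ⟨.FT, .D, .any, .D⟩]

/-- Rendezvous of Ariadne and Theseus. -/
def rendezvous : Algorithm RMark where
  blank := .blank
  table
    | .ariadne => ariadneTable
    | .theseus => theseusTable
  retrace := True

/-! ### Configurations and the geometry of positions -/

/-- Where an agent is, with the information that it carries.
`node v q`: at node `v`, having arrived through the passage `q` (`none` at its starting node).
`edge p s m`: inside the edge entered by the passage `p`, at distance `s` from the end `p`, moving
away from that end; `m` is the marker that selected its line, i.e. the one read at `p`. -/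
inductive Loc (V P M : Type*)
  | node (v : V) (q : Option P)
  | edge (p : P) (s : ℝ) (m : M)

/-- Markers on all passages, the nodes visited by each agent, and the locations of the agents. -/
structure Config (V P M : Type*) where
  mark : P → M
  visited : Agent → Set V
  loc : Agent → Loc V P M

section Model

variable {V P : Type*} {M : Type}

/-- The position `x` is (geometrically) the node `v`. -/
def AtNode (G : WeightedGraph V P) (x : Loc V P M) (v : V) : Prop :=
  match x with
  | .node u _ => u = v
  | .edge p s _ => (s = 0 ∧ G.node p = v) ∨ (s = G.len p ∧ G.node (G.rev p) = v)

/-- The position `x` is within the edge of `p`, at distance `s` from the end `p`. -/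
def OnEdge (G : WeightedGraph V P) (x : Loc V P M) (p : P) (s : ℝ) : Prop :=
  match x with
  | .node _ _ => False
  | .edge q r _ => (q = p ∧ r = s) ∨ (q = G.rev p ∧ r = G.len p - s)

/-- Two positions are the same point of the (metric) graph: a node or a point of an edge. -/
def SamePlace (G : WeightedGraph V P) (x y : Loc V P M) : Prop :=
  (∃ v, AtNode G x v ∧ AtNode G y v) ∨ ∃ p s, OnEdge G x p s ∧ OnEdge G y p s

/-- The position `x` is the point of the closed edge of `p` at distance `s` from the end `p`. -/
def Occupies (G : WeightedGraph V P) (x : Loc V P M) (p : P) (s : ℝ) : Prop :=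
  OnEdge G x p s ∨ (s = 0 ∧ AtNode G x (G.node p)) ∨
    (s = G.len p ∧ AtNode G x (G.node (G.rev p)))

/-- Initially all passages carry the default marker and each agent is at its starting node. -/
def initial (A : Algorithm M) (start : Agent → V) : Config V P M where
  mark := fun _ => A.blank
  visited := fun i => {start i}
  loc := fun i => .node (start i) none

/-! ### Moves -/

open Classical in
/-- The first line of the table of agent `i` whose marker is present at a passage of `u`, if any. -/
noncomputable def chosenLine (G : WeightedGraph V P) (A : Algorithm M) (c : Config V P M)
    (i : Agent) (u : V) : Option (Line M) :=
  (A.table i).find? fun l => decide (∃ p, G.node p = u ∧ c.mark p = l.out)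

/-- What is read when arriving through passage `q` agrees with a third-column entry. -/
def Reading.Holds (G : WeightedGraph V P) (c : Config V P M) (q : P) : Reading M → Prop
  | .any => True
  | .marker m => c.mark q = m
  | .discoveredBy S => ∃ j ∈ S, G.node q ∈ c.visited j
  | .undiscoveredBy S => ∀ j ∈ S, G.node q ∉ c.visited j

open Classical in
/-- The marker written by agent `i` at the passage `q` by which it arrives, if it had selected the
marker `m` when leaving: it is given by the first line of its table that fits. -/
noncomputable def arrivalMark (G : WeightedGraph V P) (A : Algorithm M) (c : Config V P M)
    (i : Agent) (m : M) (q : P) : M :=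
  match (A.table i).find? fun l => decide (l.out = m ∧ l.reading.Holds G c q) with
  | some l => l.newIn
  | none => c.mark q

open Classical in
/-- The configuration after agent `i` leaves its node through passage `p` using the line `l`. -/
noncomputable def Config.depart (c : Config V P M) (i : Agent) (p : P) (l : Line M) :
    Config V P M where
  mark := Function.update c.mark p l.newOut
  visited := c.visited
  loc := Function.update c.loc i (.edge p 0 l.out)

open Classical in
/-- The configuration after agent `i`, having entered an edge by `p` and holding the marker `m`,
attains the other end of the edge. -/
noncomputable def Config.arrive (G : WeightedGraph V P) (A : Algorithm M) (c : Config V P M)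
    (i : Agent) (p : P) (m : M) : Config V P M where
  mark := Function.update c.mark (G.rev p) (arrivalMark G A c i m (G.rev p))
  visited := Function.update c.visited i (insert (G.node (G.rev p)) (c.visited i))
  loc := Function.update c.loc i (.node (G.node (G.rev p)) (some (G.rev p)))

open Classical in
/-- The events at time `t`, when the agents are driven by the energies `e`.
* `depart`: agent `i` leaves its node; this happens at the instant when it starts to move.
* `arrive`: agent `i` attains a node.
* `overtake`: agent `i` attains a node and has passed, inside the edge, the other agent, which had
  entered the edge before it in the same direction (as is seen from the fact that the other agent
  found the passage unmarked, and agent `i` did not).  The agents communicated when they met, and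
  exchanged the markers that they hold: `i` applies the line of the agent that entered first, and
  the agent left behind will apply the line of the one that entered second. -/
inductive Event (G : WeightedGraph V P) (A : Algorithm M) (e : Agent → ℝ → ℝ) (t : ℝ) (i : Agent)
    (c : Config V P M) : Config V P M → Prop
  | depart (u : V) (q : Option P) (l : Line M) (p : P)
      (hloc : c.loc i = .node u q)
      (hmove : ∀ t' > t, e i t < e i t')
      (hline : chosenLine G A c i u = some l)
      (hp : G.node p = u ∧ c.mark p = l.out)
      (htie : A.retrace → ∀ q', q = some q' → c.mark q' = l.out → p = q') :
      Event G A e t i c (c.depart i p l)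
  | arrive (p : P) (m : M)
      (hloc : c.loc i = .edge p (G.len p) m)
      (hfirst : ∀ s, c.loc i.other = .edge p s A.blank → m = A.blank) :
      Event G A e t i c (c.arrive G A i p m)
  | overtake (p : P) (m : M) (s : ℝ)
      (hloc : c.loc i = .edge p (G.len p) m)
      (hother : c.loc i.other = .edge p s A.blank)
      (hm : m ≠ A.blank) :
      Event G A e t i c
        (Config.arrive G A
          { c with loc := Function.update c.loc i.other (.edge p s m) } i p A.blank)

/-! ### Continuous motion -/

/-- The adversary controls the speeds of the agents at all times: `e i t` is the energy given to
agent `i` up to time `t`, i.e. the integral of its speed.  A unit of energy moves an agent by a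
unit distance. -/
structure IsAdversary (e : Agent → ℝ → ℝ) : Prop where
  continuous : ∀ i, Continuous (e i)
  monotone : ∀ i, Monotone (e i)
  zero : ∀ i, e i 0 = 0

/-- The cost at time `t`: total energy afforded to the agents up to time `t`. -/
def cost (e : Agent → ℝ → ℝ) (t : ℝ) : ℝ := e .ariadne t + e .theseus t

/-- Motion from time `a` to time `b` without events: an agent that is inside an edge advances by
the energy it receives. -/
def Config.advance (e : Agent → ℝ → ℝ) (c : Config V P M) (a b : ℝ) : Config V P M where
  mark := c.mark
  visited := c.visited
  loc := fun i =>
    match c.loc i with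
    | .node v q => .node v q
    | .edge p s m => .edge p (s + (e i b - e i a)) m

/-- Motion without events between times `a` and `b` is possible from `c`: an agent at a node gets
no energy (it would leave the node), unless no line of its table applies, in which case it stays
there and the energy is lost; an agent inside an edge does not attain its end before time `b`. -/
def CanAdvance (G : WeightedGraph V P) (A : Algorithm M) (e : Agent → ℝ → ℝ) (c : Config V P M)
    (a b : ℝ) : Prop :=
  a ≤ b ∧ ∀ i,
    match c.loc i with
    | .node u _ => chosenLine G A c i u = none ∨ e i b = e i a
    | .edge p s _ => s + (e i b - e i a) ≤ G.len p ∧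
        ∀ t ∈ Set.Ico a b, s + (e i t - e i a) < G.len p

/-- A run during the time interval `[0, T]`, with `n` events at the times `time 1 ≤ … ≤ time n`;
`config k` is the configuration just after the `k`-th event.  Simultaneous events are processed one
after the other, in an arbitrary order. -/
structure Run (G : WeightedGraph V P) (A : Algorithm M) (e : Agent → ℝ → ℝ) (start : Agent → V)
    (T : ℝ) where
  n : ℕ
  time : ℕ → ℝ
  config : ℕ → Config V P M
  time_zero : time 0 = 0
  time_last : time (n + 1) = T
  config_zero : config 0 = initial A start
  flow : ∀ k ≤ n, CanAdvance G A e (config k) (time k) (time (k + 1))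
  event : ∀ k < n, ∃ i,
    Event G A e (time (k + 1)) i ((config k).advance e (time k) (time (k + 1))) (config (k + 1))

variable {G : WeightedGraph V P} {A : Algorithm M} {e : Agent → ℝ → ℝ} {start : Agent → V} {T : ℝ}

/-- `c` is a configuration of the run at time `t` (there are several of them, with the same
positions of the agents, when events occur at time `t`). -/
def Run.IsAt (x : Run G A e start T) (t : ℝ) (c : Config V P M) : Prop :=
  ∃ k ≤ x.n, x.time k ≤ t ∧ t ≤ x.time (k + 1) ∧ c = (x.config k).advance e (x.time k) t

/-- The agents meet at time `t`, at a node or inside an edge. -/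
def Run.MeetAt (x : Run G A e start T) (t : ℝ) : Prop :=
  ∃ c, x.IsAt t c ∧ SamePlace G (c.loc .ariadne) (c.loc .theseus)

/-- All edges have been traversed by time `t`: every point of every edge has been visited. -/
def Run.ExploredBy (x : Run G A e start T) (t : ℝ) : Prop :=
  ∀ p, ∀ s ∈ Set.Icc 0 (G.len p), ∃ r ∈ Set.Icc 0 t, ∃ c, x.IsAt r c ∧
    ∃ i, Occupies G (c.loc i) p s

/-- The exploration algorithm stops at time `t`: an agent is at a node where no line of the table
applies (all passages are marked `D`), or the agents meet inside an edge both of whose passages are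
marked `D`. -/
def Run.StopsAt {G : WeightedGraph V P} {e : Agent → ℝ → ℝ} {start : Agent → V} {T : ℝ}
    (x : Run G exploration e start T) (t : ℝ) : Prop :=
  ∃ c, x.IsAt t c ∧
    ((∃ i u q, c.loc i = .node u q ∧ chosenLine G exploration c i u = none) ∨
      ∃ p s, OnEdge G (c.loc .ariadne) p s ∧ OnEdge G (c.loc .theseus) p s ∧
        c.mark p = .D ∧ c.mark (G.rev p) = .D)

end Model

end MobileAgents

namespace MobileAgents

/-! ### Agents -/

/-! Both claims are amortised accounts. The markers of an edge bound how often it will still be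
entered; a departure pays the length of the edge out of this fund, and the motion inside the edge is
then already paid for. So cost, plus remaining fund, plus the distances left inside the edges never
exceed the initial fund, `3L` or `2L`, as long as no energy is lost at a node. The invariants on
markers speak of flat configurations, in which distances are forgotten, so that only events matter
to them. The order of the agents inside an edge is controlled by continuity: it can change only
through a meeting (`Apart`).

Rendezvous. Each agent makes a depth-first search of its own, whose stack is its trail. In `energy`
an edge counts 3 when it is blank, 2 when it has been entered by one searching agent ($E$ with
$\emptyset$, $B$ or $F$), 1 when the other agent has followed it ($E_{AT}$, $F_{AT}$), and 0 when it
is dead. While both agents search, a node visited by both is one where an agent has just found the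
other's $E$; from there it follows that trail. `Regular` records this. A searching agent cannot run
out of work, for it would have visited the whole graph and with it the other agent's trail
(`Regular.chosen_ne_none`). If the agents follow each other's trails, the third lines of the tables
break the symmetry: at the end of the trail of Theseus, Ariadne walks back along it, while Theseus,
at the end of hers, goes after her along his own old trail. From then on (`Doomed`) she is confined
between him and the end of a finite path that no longer grows.

Two agents in one edge need separate care. The one behind cannot arrive first, so its departure is
examined after the arrival of the one ahead (`Tailing`); an agent that must come back through the
edge just entered by the other is `Cornered`; agents moving against each other are `Facing`, and
meet before they have covered the edge twice. `Pending` joins these cases to the account. When `3L`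
has been spent without a meeting the account is empty, yet some agent at a node could depart, which
requires a positive amount in the account: `Pending.false`.

Exploration. The edges marked $E$, $F$ that are still to be traversed back form a forest in which
exactly the ends belonging to the two agents have odd degree, both degrees being even if these ends
coincide (`Core`). If the ends coincide, the forest is empty (`Core.tree_empty`); if moreover no
passage there is blank, all edges but those the agents are dealing with are discarded
(`Core.finish`). The fund is `effort`: 2 for a blank edge, 1 for one that has to be entered once
more. The one kind of departure that it does not pay for leads into a discarded edge in which the
other agent is approaching (`Closing`). By then the graph is explored, and until they meet the
agents together cover only the rest of the way of the first one. When `2L` has been spent, either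
the algorithm has stopped on an explored graph, or the agents are approaching or returning on an
explored graph, or nothing remains to be entered or finished and every edge is covered
(`Stage.cov_of_effort`). -/

instance : DecidableEq Agent := fun a b =>
  match a, b with
  | .ariadne, .ariadne => isTrue rfl
  | .theseus, .theseus => isTrue rfl
  | .ariadne, .theseus => isFalse nofun
  | .theseus, .ariadne => isFalse nofun

instance : Fintype Agent := ⟨{.ariadne, .theseus}, fun a => by cases a <;> simp⟩

theorem Agent.other_eq {i j : Agent} (h : i ≠ j) : i.other = j := by
  cases i <;> cases j <;> simp_all [Agent.other]

theorem Agent.other_ne (i : Agent) : i ≠ i.other := by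
  cases i <;> simp [Agent.other]

theorem Agent.eq_or_eq {i j : Agent} (h : i ≠ j) (k : Agent) : k = i ∨ k = j := by
  cases i <;> cases j <;> cases k <;> simp_all

theorem Agent.sum_eq {i j : Agent} (h : i ≠ j) (f : Agent → ℝ) : ∑ k, f k = f i + f j := by
  have : (Finset.univ : Finset Agent) = {i, j} := by
    ext k; simpa using Agent.eq_or_eq h k
  rw [this, Finset.sum_pair h]

theorem cost_eq_sum (e : Agent → ℝ → ℝ) (t : ℝ) : cost e t = ∑ i, e i t := by
  rw [Agent.sum_eq (i := .ariadne) (j := .theseus) (by simp)]; rfl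

section

variable {V P : Type*} {M : Type} {G : WeightedGraph V P} {A : Algorithm M}
  {e : Agent → ℝ → ℝ} {start : Agent → V} {T : ℝ} {c : Config V P M} {i j : Agent}

theorem WeightedGraph.rev_injective (G : WeightedGraph V P) : Function.Injective G.rev :=
  fun p q h => by rw [← G.rev_rev p, h, G.rev_rev]

theorem WeightedGraph.eq_rev_iff (G : WeightedGraph V P) {p q : P} :
    p = G.rev q ↔ G.rev p = q :=
  ⟨fun h => by rw [h, G.rev_rev], fun h => by rw [← h, G.rev_rev]⟩

/-- A set of nodes that is closed under passing along edges is everything. -/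
theorem WeightedGraph.mem_of_closed (G : WeightedGraph V P) {S : Set V} {u : V} (hu : u ∈ S)
    (h : ∀ p, G.node p ∈ S → G.node (G.rev p) ∈ S) (v : V) : v ∈ S := by
  have := G.connected u v
  induction this with
  | refl => exact hu
  | tail _ h' ih =>
    obtain ⟨p, rfl, rfl⟩ := h'
    exact h p ih

/-! ### Motion without events -/

theorem Config.advance_self (e : Agent → ℝ → ℝ) (c : Config V P M) (a : ℝ) :
    c.advance e a a = c := by
  cases c
  simp only [Config.advance, Config.mk.injEq, true_and]
  funext i
  split <;> simp_all

theorem Config.advance_loc_node {a b : ℝ} {v : V} {q : Option P} :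
    (c.advance e a b).loc i = .node v q ↔ c.loc i = .node v q := by
  simp only [Config.advance]
  split <;> simp_all

theorem Config.advance_loc_edge {a b s : ℝ} {p : P} {m : M} :
    (c.advance e a b).loc i = .edge p s m ↔ c.loc i = .edge p (s - (e i b - e i a)) m := by
  simp only [Config.advance]
  split
  · simp_all
  · rename_i h
    rw [h]
    simp only [Loc.edge.injEq]
    constructor
    · rintro ⟨rfl, rfl, rfl⟩; simp
    · rintro ⟨rfl, h, rfl⟩; simp [h]

/-- The location in which the distance covered inside the edge is forgotten. -/
def Loc.flat : Loc V P M → Loc V P M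
  | .node v q => .node v q
  | .edge p _ m => .edge p 0 m

/-- The configuration with flat locations. -/
def Config.flat (c : Config V P M) : Config V P M where
  mark := c.mark
  visited := c.visited
  loc := fun i => (c.loc i).flat

/-- Motion between events changes only distances inside edges, so an invariant of flat
configurations has to be checked at events alone. This is why the lemmas on markers place an agent
inside an edge at distance `0`. -/
theorem Config.flat_advance (e : Agent → ℝ → ℝ) (c : Config V P M) (a b : ℝ) :
    (c.advance e a b).flat = c.flat := by
  simp only [Config.advance, Config.flat, Config.mk.injEq, true_and]
  funext i
  rcases c.loc i with ⟨v, q⟩ | ⟨p, s, m⟩ <;> rfl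

theorem Config.flat_depart (c : Config V P M) (i : Agent) (p : P) (l : Line M) :
    (c.depart i p l).flat = c.flat.depart i p l := by
  simp only [Config.depart, Config.flat, Config.mk.injEq, true_and]
  funext k
  by_cases h : k = i
  · subst h; simp [Loc.flat]
  · simp [h]

theorem Config.flat_arrive (c : Config V P M) (i : Agent) (p : P) (m : M) :
    (c.arrive G A i p m).flat = c.flat.arrive G A i p m := by
  simp only [Config.arrive, Config.flat, Config.mk.injEq]
  refine ⟨rfl, trivial, ?_⟩
  funext k
  by_cases h : k = i
  · subst h; simp [Loc.flat]
  · simp [h]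

theorem Config.flat_loc_node {v : V} {q : Option P} :
    c.flat.loc i = .node v q ↔ c.loc i = .node v q := by
  simp only [Config.flat]
  rcases c.loc i with ⟨v', q'⟩ | ⟨p, s, m⟩ <;> simp [Loc.flat]

theorem Config.flat_loc_edge {p : P} {m : M} {s : ℝ} (h : c.loc i = .edge p s m) :
    c.flat.loc i = .edge p 0 m := by
  simp [Config.flat, h, Loc.flat]

theorem Config.exists_of_flat_loc_edge {p : P} {m : M} {s : ℝ}
    (h : c.flat.loc i = .edge p s m) : ∃ s', c.loc i = .edge p s' m := by
  simp only [Config.flat] at h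
  rcases hl : c.loc i with ⟨v', q'⟩ | ⟨p, s', m⟩ <;> simp_all [Loc.flat]

theorem CanAdvance.mono (he : IsAdversary e) {a b t : ℝ} (h : CanAdvance G A e c a b)
    (hat : a ≤ t) (htb : t ≤ b) : CanAdvance G A e c a t := by
  refine ⟨hat, fun i => ?_⟩
  have := h.2 i
  have h1 := he.monotone i hat
  have h2 := he.monotone i htb
  split at this
  · rcases this with h | h
    · exact Or.inl h
    · exact Or.inr (by linarith)
  · exact ⟨by linarith [this.1], fun r hr => this.2 r ⟨hr.1, hr.2.trans_le htb⟩⟩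

theorem CanAdvance.le_len {a b s : ℝ} {p : P} {m : M} (h : CanAdvance G A e c a b)
    (hi : c.loc i = .edge p s m) : s + (e i b - e i a) ≤ G.len p := by
  have := h.2 i
  rw [hi] at this
  exact this.1

/-- The total energy that the agents still need in order to leave the edges they are in. -/
noncomputable def Loc.transit (G : WeightedGraph V P) : Loc V P M → ℝ
  | .node _ _ => 0
  | .edge p s _ => G.len p - s

/-- If no energy is lost, then the energy spent is gained in the edges. -/
theorem transit_advance {a b : ℝ} (h : CanAdvance G A e c a b)
    (hn : ∀ u q, c.loc i = .node u q → chosenLine G A c i u ≠ none) :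
    ((c.advance e a b).loc i).transit G = (c.loc i).transit G - (e i b - e i a) := by
  have := h.2 i
  rcases hl : c.loc i with ⟨v, q⟩ | ⟨p, s, m⟩
  · rw [hl] at this
    rw [Config.advance_loc_node.2 hl]
    have := this.resolve_left (hn v q hl)
    simp [Loc.transit, this]
  · have : (c.advance e a b).loc i = .edge p (s + (e i b - e i a)) m := by
      rw [Config.advance_loc_edge, hl]; simp
    rw [this]
    simp only [Loc.transit]; ring

/-! ### Runs -/

theorem Run.time_mono (x : Run G A e start T) {k l : ℕ} (hkl : k ≤ l) (hl : l ≤ x.n + 1) :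
    x.time k ≤ x.time l := by
  induction hkl with
  | refl => exact le_rfl
  | @step m hm ih => exact (ih (by omega)).trans (x.flow m (by omega)).1

theorem Run.time_nonneg (x : Run G A e start T) {k : ℕ} (hk : k ≤ x.n + 1) : 0 ≤ x.time k := by
  have := x.time_mono (Nat.zero_le k) hk
  rwa [x.time_zero] at this

theorem Run.exists_index (x : Run G A e start T) {t : ℝ} (ht : t ∈ Set.Icc 0 T) :
    ∃ k ≤ x.n, x.time k ≤ t ∧ t ≤ x.time (k + 1) := by
  have h : ∃ k, k ≤ x.n ∧ t ≤ x.time (k + 1) := ⟨x.n, le_rfl, by rw [x.time_last]; exact ht.2⟩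
  classical
  refine ⟨Nat.find h, (Nat.find_spec h).1, ?_, (Nat.find_spec h).2⟩
  by_contra hlt
  push Not at hlt
  rcases hk : Nat.find h with _ | m
  · rw [hk, x.time_zero] at hlt
    exact absurd ht.1 (not_le.2 hlt)
  · rw [hk] at hlt
    have h1 := (Nat.find_spec h).1
    rw [hk] at h1
    exact Nat.find_min h (m := m) (by omega) ⟨by omega, hlt.le⟩

/-- An invariant `I` is carried along a run, until some event `H` has occurred. -/
theorem Run.sweep (x : Run G A e start T) (he : IsAdversary e) (I : ℝ → Config V P M → Prop)
    (H : ℝ → Prop) (hmono : ∀ t t', t ≤ t' → H t → H t') (h0 : H 0 ∨ I 0 (initial A start))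
    (hadv : ∀ k ≤ x.n, ∀ t, x.time k ≤ t → t ≤ x.time (k + 1) →
      CanAdvance G A e (x.config k) (x.time k) t → I (x.time k) (x.config k) →
      H t ∨ I t ((x.config k).advance e (x.time k) t))
    (hev : ∀ k < x.n, ∀ i,
      Event G A e (x.time (k + 1)) i ((x.config k).advance e (x.time k) (x.time (k + 1)))
        (x.config (k + 1)) →
      I (x.time (k + 1)) ((x.config k).advance e (x.time k) (x.time (k + 1))) →
      H (x.time (k + 1)) ∨ I (x.time (k + 1)) (x.config (k + 1)))
    {k : ℕ} (hk : k ≤ x.n) {t : ℝ} (h1 : x.time k ≤ t) (h2 : t ≤ x.time (k + 1)) :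
    H t ∨ I t ((x.config k).advance e (x.time k) t) := by
  have key : ∀ k ≤ x.n, H (x.time k) ∨ I (x.time k) (x.config k) := by
    intro k
    induction k with
    | zero => intro _; rw [x.time_zero, x.config_zero]; exact h0
    | succ k ih =>
      intro hk
      have hf := x.flow k (by omega)
      rcases ih (by omega) with h | h
      · exact Or.inl (hmono _ _ hf.1 h)
      · rcases hadv k (by omega) _ hf.1 le_rfl hf h with h | h
        · exact Or.inl h
        · obtain ⟨i, hi⟩ := x.event k (by omega)
          exact hev k (by omega) i hi h
  rcases key k hk with h | h
  · exact Or.inl (hmono _ _ h1 h)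
  · exact hadv k hk t h1 h2 ((x.flow k hk).mono he h1 h2) h

theorem Run.isAt (x : Run G A e start T) {k : ℕ} (hk : k ≤ x.n) {t : ℝ} (h1 : x.time k ≤ t)
    (h2 : t ≤ x.time (k + 1)) : x.IsAt t ((x.config k).advance e (x.time k) t) :=
  ⟨k, hk, h1, h2, rfl⟩

theorem Run.isAt_config (x : Run G A e start T) {k : ℕ} (hk : k ≤ x.n) :
    x.IsAt (x.time k) (x.config k) :=
  ⟨k, hk, le_rfl, (x.flow k hk).1, (Config.advance_self _ _ _).symm⟩

theorem cost_mono (he : IsAdversary e) {a b : ℝ} (h : a ≤ b) : cost e a ≤ cost e b :=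
  add_le_add (he.monotone _ h) (he.monotone _ h)

/-- By continuity the budget is met exactly at some instant. The invariants are examined at that
instant, when the account is exhausted. -/
theorem exists_cost_eq (he : IsAdversary e) {T B : ℝ} (hT : 0 ≤ T) (hB : 0 ≤ B)
    (h : B ≤ cost e T) : ∃ t ∈ Set.Icc 0 T, cost e t = B := by
  have hc : ContinuousOn (cost e) (Set.Icc 0 T) :=
    ((he.continuous _).add (he.continuous _)).continuousOn
  exact intermediate_value_Icc hT hc ⟨by simp [cost, he.zero, hB], h⟩

theorem Run.nonneg (x : Run G A e start T) : 0 ≤ T := by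
  rw [← x.time_last]; exact x.time_nonneg le_rfl

theorem WeightedGraph.totalLength_nonneg [Fintype P] (G : WeightedGraph V P) :
    0 ≤ G.totalLength :=
  div_nonneg (Finset.sum_nonneg fun p _ => (G.len_pos p).le) (by norm_num)

/-- A continuous function without zeros on an interval keeps its sign. -/
theorem neg_of_forall_ne_zero {f : ℝ → ℝ} (hf : Continuous f) {a b : ℝ} (hab : a ≤ b)
    (ha : f a < 0) (h : ∀ t ∈ Set.Icc a b, f t ≠ 0) : f b < 0 := by
  by_contra hb
  push Not at hb
  obtain ⟨t, ht, h0⟩ := intermediate_value_Icc hab hf.continuousOn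
    (show (0 : ℝ) ∈ Set.Icc (f a) (f b) from ⟨ha.le, hb⟩)
  exact h t ht h0

/-! ### Relative positions inside an edge -/

theorem SamePlace.symm {x y : Loc V P M} (h : SamePlace G x y) : SamePlace G y x := by
  rcases h with ⟨v, h1, h2⟩ | ⟨p, s, h1, h2⟩
  · exact Or.inl ⟨v, h2, h1⟩
  · exact Or.inr ⟨p, s, h2, h1⟩

theorem samePlace_of_opposite {p : P} {s s' : ℝ} {m m' : M} (h : s + s' = G.len p) :
    SamePlace G (.edge p s m : Loc V P M) (.edge (G.rev p) s' m') :=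
  Or.inr ⟨p, s, Or.inl ⟨rfl, rfl⟩, Or.inr ⟨rfl, by linarith⟩⟩

/-- No agent is outside of its edge, the agents have not met, and they are in an edge in the order
in which they entered it: `front m m'` says that an agent holding `m` was first. -/
structure Apart (G : WeightedGraph V P) (front : M → M → Prop) (c : Config V P M) : Prop where
  bounds : ∀ i p s m, c.loc i = .edge p s m → 0 ≤ s ∧ s ≤ G.len p
  opposite : ∀ i j, i ≠ j → ∀ p s m s' m', c.loc i = .edge p s m →
    c.loc j = .edge (G.rev p) s' m' → s + s' < G.len p
  behind : ∀ i j, i ≠ j → ∀ p s m s' m', c.loc i = .edge p s m →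
    c.loc j = .edge p s' m' → front m m' → s' < s
  apart : ∀ i j, i ≠ j → ¬ SamePlace G (c.loc i) (c.loc j)

theorem apart_of_ariadne (h : ¬ SamePlace G (c.loc .ariadne) (c.loc .theseus)) :
    ∀ i j, i ≠ j → ¬ SamePlace G (c.loc i) (c.loc j) := by
  intro i j hij
  cases i <;> cases j <;> simp at hij
  · exact h
  · exact fun h' => h h'.symm

/-- Each order relation says that a continuous function of time is negative, and a zero of this
function is a meeting. Agents that do not meet therefore keep their order. -/
theorem Apart.advance {front : M → M → Prop} (he : IsAdversary e) {a b : ℝ}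
    (hc : Apart G front c) (h : CanAdvance G A e c a b)
    (hm : ∀ t ∈ Set.Icc a b, ¬ SamePlace G ((c.advance e a t).loc .ariadne)
      ((c.advance e a t).loc .theseus)) : Apart G front (c.advance e a b) := by
  have hm' : ∀ t ∈ Set.Icc a b, ∀ i j, i ≠ j →
      ¬ SamePlace G ((c.advance e a t).loc i) ((c.advance e a t).loc j) :=
    fun t ht => apart_of_ariadne (hm t ht)
  have hab := h.1
  have adv : ∀ i p s m t, c.loc i = .edge p s m →
      (c.advance e a t).loc i = .edge p (s + (e i t - e i a)) m := by
    intro i p s m t hi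
    rw [Config.advance_loc_edge, hi]; simp
  constructor
  · intro i p s m hi
    rw [Config.advance_loc_edge] at hi
    have h1 := hc.bounds i p _ m hi
    have h2 := h.le_len hi
    have h3 := he.monotone i hab
    constructor <;> linarith
  · intro i j hij p s m s' m' hi hj
    rw [Config.advance_loc_edge] at hi hj
    have h1 := hc.opposite i j hij _ _ _ _ _ hi hj
    have := neg_of_forall_ne_zero
      (f := fun t => (s - (e i b - e i a)) + (e i t - e i a) + ((s' - (e j b - e j a)) +
        (e j t - e j a)) - G.len p)
      (by have := he.continuous i; have := he.continuous j; fun_prop) hab (by simp; linarith)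
      (fun t ht h0 => hm' t ht i j hij (by
        rw [adv i _ _ _ t hi, adv j _ _ _ t hj]
        exact samePlace_of_opposite (by linarith)))
    simp at this
    linarith
  · intro i j hij p s m s' m' hi hj hf
    rw [Config.advance_loc_edge] at hi hj
    have h1 := hc.behind i j hij _ _ _ _ _ hi hj hf
    have := neg_of_forall_ne_zero
      (f := fun t => ((s' - (e j b - e j a)) + (e j t - e j a)) -
        ((s - (e i b - e i a)) + (e i t - e i a)))
      (by have := he.continuous i; have := he.continuous j; fun_prop) hab (by simp; linarith)
      (fun t ht h0 => hm' t ht i j hij (by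
        rw [adv i _ _ _ t hi, adv j _ _ _ t hj]
        exact Or.inr ⟨p, _, Or.inl ⟨rfl, rfl⟩, Or.inl ⟨rfl, by linarith⟩⟩))
    simp at this
    linarith
  · exact hm' b ⟨hab, le_rfl⟩

/-- Departures keep the agents apart. -/
theorem Apart.depart {front : M → M → Prop} (hc : Apart G front c) (hij : i ≠ j) {u : V}
    {q : Option P} {p : P} {l : Line M} (hloc : c.loc i = .node u q) (hp : G.node p = u)
    (hfr : ∀ s' m', c.loc j = .edge p s' m' → ¬ front l.out m') :
    Apart G front (c.depart i p l) := by
  have hli : (c.depart i p l).loc i = .edge p 0 l.out := by simp [Config.depart]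
  have hlj : (c.depart i p l).loc j = c.loc j := by simp [Config.depart, hij.symm]
  have hat : AtNode G (c.loc i) u := by rw [hloc]; rfl
  -- Entering an edge does not change the point of the graph: a coincidence at distance `0` is one
  -- at the node `u` that the agent leaves.
  have key : ¬ SamePlace G ((c.depart i p l).loc i) ((c.depart i p l).loc j) := by
    rw [hli, hlj]
    intro h
    refine hc.apart i j hij ?_
    rcases h with ⟨v, h1, h2⟩ | ⟨r, s, h1, h2⟩
    · rcases h1 with ⟨_, h1⟩ | ⟨h1, _⟩
      · exact Or.inl ⟨u, hat, by rwa [← hp, h1]⟩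
      · exact absurd h1 (G.len_pos p).ne
    · refine Or.inl ⟨u, hat, ?_⟩
      rcases hj : c.loc j with ⟨v, q⟩ | ⟨p', s', m'⟩
      · rw [hj] at h2; exact h2.elim
      · rw [hj] at h2
        rcases h1 with ⟨rfl, rfl⟩ | ⟨h1, h1'⟩
        · rcases h2 with ⟨rfl, rfl⟩ | ⟨rfl, rfl⟩
          · exact Or.inl ⟨rfl, hp⟩
          · refine Or.inr ⟨?_, by rw [G.rev_rev, hp]⟩
            rw [G.len_rev]; ring
        · have hl : G.len r = G.len p := by rw [h1, G.len_rev]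
          have hr : r = G.rev p := by rw [h1, G.rev_rev]
          rcases h2 with ⟨rfl, rfl⟩ | ⟨rfl, rfl⟩
          · exact Or.inr ⟨by linarith, by rw [← h1, hp]⟩
          · exact Or.inl ⟨by linarith, by rw [← h1, hp]⟩
  constructor
  · intro k p' s m hk
    rcases Agent.eq_or_eq hij k with rfl | rfl
    · rw [hli] at hk; cases hk; exact ⟨le_rfl, (G.len_pos _).le⟩
    · rw [hlj] at hk; exact hc.bounds _ _ _ _ hk
  -- An agent that comes the other way and has attained the end of the edge would be at `u` together
  -- with `i`.
  · have h1 : ∀ s' m', c.loc j = .edge (G.rev p) s' m' → s' < G.len p := by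
      intro s' m' hj
      have h1 := (hc.bounds _ _ _ _ hj).2
      rw [G.len_rev] at h1
      refine lt_of_le_of_ne h1 fun h2 => hc.apart i j hij (Or.inl ⟨u, hat, ?_⟩)
      rw [hj]
      exact Or.inr ⟨by rw [h2, G.len_rev], by rw [G.rev_rev, hp]⟩
    intro k k' hk p' s m s' m' hks hks'
    rcases Agent.eq_or_eq hij k with rfl | rfl
    · obtain rfl := (Agent.eq_or_eq hij k').resolve_left hk.symm
      rw [hli] at hks; rw [hlj] at hks'; cases hks
      linarith [h1 _ _ hks']
    · obtain rfl := (Agent.eq_or_eq hij k').resolve_right hk.symm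
      rw [hlj] at hks; rw [hli] at hks'
      injection hks' with h2 h3 h4
      subst h3
      have : p' = G.rev p := by rw [h2, G.rev_rev]
      subst this
      have := h1 _ _ hks
      rw [G.len_rev]; linarith
  · have h1 : ∀ s' m', c.loc j = .edge p s' m' → 0 < s' := by
      intro s' m' hj
      refine lt_of_le_of_ne (hc.bounds _ _ _ _ hj).1 fun h2 =>
        hc.apart i j hij (Or.inl ⟨u, hat, ?_⟩)
      rw [hj]
      exact Or.inl ⟨h2.symm, hp⟩
    intro k k' hk p' s m s' m' hks hks' hf
    rcases Agent.eq_or_eq hij k with rfl | rfl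
    · obtain rfl := (Agent.eq_or_eq hij k').resolve_left hk.symm
      rw [hli] at hks; rw [hlj] at hks'; cases hks
      exact absurd hf (hfr _ _ hks')
    · obtain rfl := (Agent.eq_or_eq hij k').resolve_right hk.symm
      rw [hlj] at hks; rw [hli] at hks'; cases hks'
      exact h1 _ _ hks
  · intro k k' hk
    rcases Agent.eq_or_eq hij k with rfl | rfl
    · obtain rfl := (Agent.eq_or_eq hij k').resolve_left hk.symm
      exact key
    · obtain rfl := (Agent.eq_or_eq hij k').resolve_right hk.symm
      exact fun h => key h.symm

/-- Arrivals keep the agents apart. -/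
theorem Apart.arrive {front : M → M → Prop} (hc : Apart G front c) (hij : i ≠ j) {p : P} {m m' : M}
    (hloc : c.loc i = .edge p (G.len p) m) :
    Apart G front (c.arrive G A i p m') := by
  have hli : (c.arrive G A i p m').loc i = .node (G.node (G.rev p)) (some (G.rev p)) := by
    simp [Config.arrive]
  have hlj : (c.arrive G A i p m').loc j = c.loc j := by simp [Config.arrive, hij.symm]
  have key : ¬ SamePlace G ((c.arrive G A i p m').loc i) ((c.arrive G A i p m').loc j) := by
    rw [hli, hlj]
    intro h
    refine hc.apart i j hij ?_
    rcases h with ⟨v, h1, h2⟩ | ⟨r, s, h1, h2⟩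
    · refine Or.inl ⟨v, ?_, h2⟩
      rw [hloc]; exact Or.inr ⟨rfl, h1⟩
    · exact h1.elim
  constructor
  · intro k p' s m hk
    rcases Agent.eq_or_eq hij k with rfl | rfl
    · rw [hli] at hk; cases hk
    · rw [hlj] at hk; exact hc.bounds _ _ _ _ hk
  · intro k k' hk p' s m s' m' hks hks'
    rcases Agent.eq_or_eq hij k with rfl | rfl
    · rw [hli] at hks; cases hks
    · obtain rfl := (Agent.eq_or_eq hij k').resolve_right hk.symm
      rw [hli] at hks'; cases hks'
  · intro k k' hk p' s m s' m' hks hks' hf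
    rcases Agent.eq_or_eq hij k with rfl | rfl
    · rw [hli] at hks; cases hks
    · obtain rfl := (Agent.eq_or_eq hij k').resolve_right hk.symm
      rw [hli] at hks'; cases hks'
  · intro k k' hk
    rcases Agent.eq_or_eq hij k with rfl | rfl
    · obtain rfl := (Agent.eq_or_eq hij k').resolve_left hk.symm
      exact key
    · obtain rfl := (Agent.eq_or_eq hij k').resolve_right hk.symm
      exact fun h => key h.symm

end

/-! ### Markers and tables of the rendezvous algorithm -/

def Agent.markB : Agent → RMark
  | .ariadne => .BA
  | .theseus => .BT

def Agent.markE : Agent → RMark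
  | .ariadne => .EA
  | .theseus => .ET

def Agent.markF : Agent → RMark
  | .ariadne => .FA
  | .theseus => .FT

section

variable (i j : Agent)

@[simp] theorem Agent.markB_inj : i.markB = j.markB ↔ i = j := by
  cases i <;> cases j <;> simp [Agent.markB]

@[simp] theorem Agent.markE_inj : i.markE = j.markE ↔ i = j := by
  cases i <;> cases j <;> simp [Agent.markE]

@[simp] theorem Agent.markF_inj : i.markF = j.markF ↔ i = j := by
  cases i <;> cases j <;> simp [Agent.markF]

@[simp] theorem Agent.mark_ne_mark : i.markB ≠ j.markE ∧ i.markB ≠ j.markF ∧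
    i.markE ≠ j.markB ∧ i.markE ≠ j.markF ∧ i.markF ≠ j.markB ∧ i.markF ≠ j.markE := by
  cases i <;> cases j <;> simp [Agent.markB, Agent.markE, Agent.markF]

@[simp] theorem Agent.mark_ne : i.markB ≠ .blank ∧ i.markE ≠ .blank ∧ i.markF ≠ .blank ∧
    i.markB ≠ .EAT ∧ i.markE ≠ .EAT ∧ i.markF ≠ .EAT ∧
    i.markB ≠ .FAT ∧ i.markE ≠ .FAT ∧ i.markF ≠ .FAT ∧
    i.markB ≠ .EATT ∧ i.markE ≠ .EATT ∧ i.markF ≠ .EATT ∧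
    i.markB ≠ .FATT ∧ i.markE ≠ .FATT ∧ i.markF ≠ .FATT ∧
    i.markB ≠ .D ∧ i.markE ≠ .D ∧ i.markF ≠ .D ∧
    i.markB ≠ .D2 ∧ i.markE ≠ .D2 ∧ i.markF ≠ .D2 := by
  cases i <;> simp [Agent.markB, Agent.markE, Agent.markF]

@[simp] theorem Agent.ne_mark : RMark.blank ≠ i.markB ∧ .blank ≠ i.markE ∧ .blank ≠ i.markF ∧
    .EAT ≠ i.markB ∧ .EAT ≠ i.markE ∧ .EAT ≠ i.markF ∧
    .FAT ≠ i.markB ∧ .FAT ≠ i.markE ∧ .FAT ≠ i.markF ∧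
    .EATT ≠ i.markB ∧ .EATT ≠ i.markE ∧ .EATT ≠ i.markF ∧
    .FATT ≠ i.markB ∧ .FATT ≠ i.markE ∧ .FATT ≠ i.markF ∧
    .D ≠ i.markB ∧ .D ≠ i.markE ∧ .D ≠ i.markF ∧
    .D2 ≠ i.markB ∧ .D2 ≠ i.markE ∧ .D2 ≠ i.markF := by
  cases i <;> simp [Agent.markB, Agent.markE, Agent.markF]

end

/-- The third line of the tables of the rendezvous algorithm. -/
def Agent.thirdLine : Agent → Line RMark
  | .ariadne => ⟨.FAT, .D2, .any, .D2⟩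
  | .theseus => ⟨.EAT, .EATT, .any, .FATT⟩

/-- Markers at which no agent leaves any more. -/
def RMark.Dead (m : RMark) : Prop := m = .D ∨ m = .D2 ∨ m = .EATT ∨ m = .FATT

/-- The share of a passage in the number of traversals of its edge that are still to come. -/
noncomputable def RMark.weight : RMark → ℝ
  | .blank | .BA | .BT | .FA | .FT => 3 / 2
  | .EA | .ET | .EAT | .FAT => 1 / 2
  | .D | .D2 | .EATT | .FATT => 0

theorem RMark.weight_nonneg (m : RMark) : 0 ≤ m.weight := by
  cases m <;> simp [RMark.weight] <;> norm_num

@[simp] theorem RMark.weight_eq : RMark.blank.weight = 3 / 2 ∧ RMark.EAT.weight = 1 / 2 ∧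
    RMark.FAT.weight = 1 / 2 ∧ RMark.D.weight = 0 ∧ RMark.D2.weight = 0 ∧ RMark.EATT.weight = 0 ∧
    RMark.FATT.weight = 0 :=
  ⟨rfl, rfl, rfl, rfl, rfl, rfl, rfl⟩

@[simp] theorem Agent.weight_markB (i : Agent) : i.markB.weight = 3 / 2 := by cases i <;> rfl
@[simp] theorem Agent.weight_markE (i : Agent) : i.markE.weight = 1 / 2 := by cases i <;> rfl
@[simp] theorem Agent.weight_markF (i : Agent) : i.markF.weight = 3 / 2 := by cases i <;> rfl

/-- The order in which agents that hold certain markers entered an edge. -/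
def RMark.entry : RMark → ℕ
  | .blank => 0
  | .EAT => 2
  | _ => 1

/-- Two agents use an edge in the same direction only if the second follows the first: an explorer
(blank) is followed by an agent that read its $E$, and Ariadne, who read $E_T$, by Theseus, who read
$E_{AT}$. The markers held thus determine who entered first. -/
def RMark.front (m m' : RMark) : Prop := m.entry < m'.entry


section

variable {V P : Type*} {G : WeightedGraph V P} {c : Config V P RMark} {i j : Agent}

/-- The marker `m` is present at the node `u`. -/
def Present {M : Type} (G : WeightedGraph V P) (c : Config V P M) (u : V) (m : M) : Prop :=
  ∃ p, G.node p = u ∧ c.mark p = m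

/-- The two tables agree up to the names of the agents, except for the third line. The nesting keeps
the information given by priority: a line is used only if the markers of the lines above it are
absent. The two blank lines are not distinguished, since the departure does not depend on the third
column. -/
theorem rendezvous_chosen (hij : i ≠ j) {u : V} {l : Line RMark}
    (h : chosenLine G rendezvous c i u = some l) :
    l = ⟨i.markB, .D, .any, .D⟩ ∨
    (¬ Present G c u i.markB ∧
      (l = ⟨j.markE, .EAT, .any, .FAT⟩ ∨
      (¬ Present G c u j.markE ∧
        (l = i.thirdLine ∨
        (¬ Present G c u i.thirdLine.out ∧ ((l.out = .blank ∧ l.newOut = i.markE) ∨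
        (¬ Present G c u .blank ∧ l = ⟨i.markF, .D, .any, .D⟩))))))) := by
  unfold Present
  cases i <;> cases j <;> simp only [ne_eq, not_true_eq_false] at hij <;>
  · simp only [chosenLine, rendezvous, ariadneTable, theseusTable, List.find?] at h
    simp only [Agent.markB, Agent.markE, Agent.markF, Agent.thirdLine]
    repeat' split at h
    all_goals simp_all
    all_goals subst h; simp

theorem rendezvous_not_chosen (hij : i ≠ j) {u : V}
    (h : chosenLine G rendezvous c i u = none) :
    ¬ Present G c u i.markB ∧ ¬ Present G c u j.markE ∧ ¬ Present G c u i.thirdLine.out ∧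
      ¬ Present G c u .blank ∧ ¬ Present G c u i.markF := by
  unfold Present
  cases i <;> cases j <;> simp only [ne_eq, not_true_eq_false] at hij <;>
  · simp only [chosenLine, rendezvous, ariadneTable, theseusTable, List.find?] at h
    simp only [Agent.markB, Agent.markE, Agent.markF, Agent.thirdLine]
    repeat' split at h
    all_goals simp_all

theorem arrivalMark_markB (i : Agent) (q : P) :
    arrivalMark G rendezvous c i i.markB q = .D := by
  cases i <;>
  simp [arrivalMark, rendezvous, ariadneTable, theseusTable, Agent.markB, Reading.Holds]

theorem arrivalMark_markF (i : Agent) (q : P) :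
    arrivalMark G rendezvous c i i.markF q = .D := by
  cases i <;>
  simp [arrivalMark, rendezvous, ariadneTable, theseusTable, Agent.markF, List.find?, Reading.Holds]

theorem arrivalMark_markE (hij : i ≠ j) (q : P) :
    arrivalMark G rendezvous c i j.markE q = .FAT := by
  cases i <;> cases j <;> simp only [ne_eq, not_true_eq_false] at hij <;>
  simp [arrivalMark, rendezvous, ariadneTable, theseusTable, Agent.markE, List.find?, Reading.Holds]

theorem arrivalMark_third (i : Agent) (q : P) :
    arrivalMark G rendezvous c i i.thirdLine.out q = i.thirdLine.newIn := by
  cases i <;>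
  simp [arrivalMark, rendezvous, ariadneTable, theseusTable, Agent.thirdLine, List.find?,
    Reading.Holds]

theorem arrivalMark_blank_of_mem {q : P} (h : G.node q ∈ c.visited i) :
    arrivalMark G rendezvous c i .blank q = i.markB := by
  cases i <;>
  simp [arrivalMark, rendezvous, ariadneTable, theseusTable, Agent.markB, List.find?,
    Reading.Holds, h]

theorem arrivalMark_blank_of_notMem {q : P} (h : G.node q ∉ c.visited i) :
    arrivalMark G rendezvous c i .blank q = i.markF := by
  cases i <;>
  simp [arrivalMark, rendezvous, ariadneTable, theseusTable, Agent.markF, List.find?,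
    Reading.Holds, h]

end

/-! ### Trails of the rendezvous algorithm -/

/-- What an agent does: it is at the end of its trail (`home`), explores an edge from there (`out`),
has found the other end of this edge to be known (`turn`), or follows the trail of the other agent,
on which it has used the edges number `lo, …, hi - 1` (`chase`). -/
inductive Mode (P : Type*)
  | home
  | out (p : P)
  | turn (p : P)
  | chase (lo hi : ℕ)

/-- The passage by which the exploration of an edge started. -/
def Mode.Exc {P : Type*} : Mode P → P → Prop
  | .out p, q => p = q
  | .turn p, q => p = q
  | _, _ => False

/-- The edge number `n` of the other agent's trail has been used. -/
def Mode.Chased {P : Type*} : Mode P → ℕ → Prop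
  | .chase lo hi, n => lo ≤ n ∧ n < hi
  | _, _ => False

@[simp] theorem Mode.exc_home {P : Type*} {q : P} : Mode.home.Exc q ↔ False := Iff.rfl
@[simp] theorem Mode.exc_chase {P : Type*} {a b : ℕ} {q : P} :
    (Mode.chase a b).Exc q ↔ False := Iff.rfl
@[simp] theorem Mode.chased_home {P : Type*} {n : ℕ} :
    (Mode.home : Mode P).Chased n ↔ False := Iff.rfl
@[simp] theorem Mode.chased_out {P : Type*} {p : P} {n : ℕ} :
    (Mode.out p).Chased n ↔ False := Iff.rfl
@[simp] theorem Mode.chased_turn {P : Type*} {p : P} {n : ℕ} :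
    (Mode.turn p).Chased n ↔ False := Iff.rfl
@[simp] theorem Mode.chased_chase {P : Type*} {a b n : ℕ} :
    (Mode.chase a b : Mode P).Chased n ↔ a ≤ n ∧ n < b := Iff.rfl

/-- The stack of the depth-first search of an agent: passages `x n` and nodes `xn n`, and what the
agent does at present. -/
structure Trail (V P : Type*) where
  M : ℕ
  x : ℕ → P
  xn : ℕ → V
  mode : Mode P

/-- The passages by which the agent has left a node without coming back. -/
def Trail.Edge {V P : Type*} (S : Trail V P) (p : P) : Prop :=
  (∃ n < S.M, p = S.x n) ∨ S.mode.Exc p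

def Trail.Leaves {V P : Type*} (S : Trail V P) (n : ℕ) : Prop :=
  n < S.M ∨ (n = S.M ∧ ∃ q, S.mode.Exc q)

section

variable {V P : Type*} {G : WeightedGraph V P} {c c' : Config V P RMark} {i j : Agent}
  {σ σ' : P → RMark} {S S' S'' : Trail V P}

/-- Properties of the trail `S` of agent `i`; `S'` is the trail of agent `j`.  The function `σ`
anticipates the markers that agents inside an edge will write on arrival. -/
structure Half (G : WeightedGraph V P) (c : Config V P RMark) (σ : P → RMark) (i : Agent)
    (S : Trail V P) (j : Agent) (S' : Trail V P) : Prop where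
  path : ∀ n < S.M, G.node (S.x n) = S.xn n ∧ G.node (G.rev (S.x n)) = S.xn (n + 1)
  inj : ∀ n ≤ S.M, ∀ m ≤ S.M, S.xn n = S.xn m → n = m
  vis : ∀ n ≤ S.M, S.xn n ∈ c.visited i
  marks : ∀ n < S.M, (S'.mode.Chased n → σ (S.x n) = .EAT ∧ σ (G.rev (S.x n)) = .FAT) ∧
    (¬ S'.mode.Chased n → σ (S.x n) = i.markE ∧ σ (G.rev (S.x n)) = i.markF)
  exc : ∀ q, S.mode.Exc q → G.node q = S.xn S.M ∧ σ q = i.markE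
  out : ∀ q, S.mode = .out q → σ (G.rev q) = .blank ∧ c.loc i = .edge q 0 .blank
  turn : ∀ q, S.mode = .turn q → σ (G.rev q) = i.markB ∧
    c.loc i = .node (G.node (G.rev q)) (some (G.rev q))
  home : S.mode = .home → (∃ q, c.loc i = .node (S.xn S.M) q) ∨
    ∃ r m, c.loc i = .edge r 0 m ∧ G.node (G.rev r) = S.xn S.M ∧
      (((m = i.markB ∨ m = i.markF) ∧ c.mark (G.rev r) = i.markE ∧ σ (G.rev r) = .D) ∨
      (i = .ariadne ∧ m = .FAT ∧ c.mark (G.rev r) = .EAT ∧ σ (G.rev r) = .D2 ∧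
        ∃ lo hi, S'.mode = .chase lo hi))
  chase : ∀ lo hi, S.mode = .chase lo hi →
    (lo < hi ∧ hi ≤ S'.M ∧ (i = .ariadne → S.xn S.M = S'.xn lo)) ∧
    ((∃ q, c.loc i = .node (S'.xn hi) q ∧
        (q = some (G.rev (S'.x (hi - 1))) ∨ ∀ n ≤ S.M, S.xn n ≠ S'.xn hi)) ∨
      (c.loc i = .edge (S'.x (hi - 1)) 0 j.markE ∧
        c.mark (G.rev (S'.x (hi - 1))) = j.markF) ∨
      (i = .ariadne ∧ hi = S'.M ∧ (∀ n ≤ S.M, S.xn n ≠ S'.xn hi) ∧ (∃ a b, S'.mode = .chase a b) ∧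
        ∃ r, c.loc i = .edge r 0 .FAT ∧ G.node (G.rev r) = S'.xn hi ∧
          c.mark (G.rev r) = .EAT ∧ σ (G.rev r) = .D2))

/-- Agent `i` is at node `w` at the end of its trail, and has found there that the other agent is
ahead. -/
def Lone (G : WeightedGraph V P) (c : Config V P RMark) (i j : Agent) (S : Trail V P) (w : V) :
    Prop :=
  S.mode = .home ∧ (∃ q, c.loc i = .node w q) ∧ Present G c w j.markE

/-- Both agents are searching, and none has found the trail of the other one. -/
def Searching (S S' : Trail V P) : Prop :=
  (∀ a b, S.mode ≠ .chase a b) ∧ ∀ a b, S'.mode ≠ .chase a b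

/-- An edge is unused, done with, or on one of the trails. -/
def Classified (G : WeightedGraph V P) (σ : P → RMark) (S S' : Trail V P) (p : P) : Prop :=
  (σ p = .blank ∧ σ (G.rev p) = .blank) ∨ ((σ p).Dead ∧ (σ (G.rev p)).Dead) ∨
    (S.Edge p ∨ S.Edge (G.rev p)) ∨ (S'.Edge p ∨ S'.Edge (G.rev p))

theorem Classified.rev {p : P} (h : Classified G σ S S' p) : Classified G σ S S' (G.rev p) := by
  unfold Classified at *
  rw [G.rev_rev]
  tauto

/-- The regular configurations of the rendezvous algorithm. -/
structure Regular (G : WeightedGraph V P) (c : Config V P RMark) (σ : P → RMark) (i : Agent)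
    (S : Trail V P) (j : Agent) (S' : Trail V P) : Prop where
  left : Half G c σ i S j S'
  right : Half G c σ j S' i S
  disj : ∀ n m, S.Leaves n → S'.Leaves m → S.xn n ≠ S'.xn m
  cls : ∀ p, Classified G σ S S' p
  agree : ∀ p, c.mark p = σ p ∨ ∃ k r m, c.loc k = .edge r 0 m ∧ m ≠ .blank ∧ p = G.rev r
  blankL : Searching S S' → ∀ p, σ p = .blank → G.node p ∈ c.visited i →
    ∃ n ≤ S.M, S.xn n = G.node p
  blankR : Searching S S' → ∀ p, σ p = .blank → G.node p ∈ c.visited j →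
    ∃ n ≤ S'.M, S'.xn n = G.node p
  touched : Searching S S' → ∀ p, σ p ≠ .blank →
    (G.node p ∈ c.visited i ∧ (G.node (G.rev p) ∈ c.visited i ∨ S.mode = .out p)) ∨
    (G.node p ∈ c.visited j ∧ (G.node (G.rev p) ∈ c.visited j ∨ S'.mode = .out p))
  shared : Searching S S' → ∀ w, w ∈ c.visited i → w ∈ c.visited j →
    Lone G c i j S w ∨ Lone G c j i S' w

theorem Searching.symm (h : Searching S S') : Searching S' S := ⟨h.2, h.1⟩

theorem Regular.symm (h : Regular G c σ i S j S') : Regular G c σ j S' i S where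
  left := h.right
  right := h.left
  disj n m hn hm := (h.disj m n hm hn).symm
  cls p := by have := h.cls p; unfold Classified at *; tauto
  agree := h.agree
  blankL hs := h.blankR hs.symm
  blankR hs := h.blankL hs.symm
  touched hs p hp := (h.touched hs.symm p hp).symm
  shared hs w h1 h2 := (h.shared hs.symm w h2 h1).symm

/-! #### Changing the two markers of an edge -/

open Classical in
/-- Rewrite the markers of both passages of the edge of `p`. -/
noncomputable def remark (G : WeightedGraph V P) (σ : P → RMark) (p : P) (a b : RMark) :
    P → RMark :=
  Function.update (Function.update σ p a) (G.rev p) b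

@[simp] theorem remark_self {p : P} {a b : RMark} : remark G σ p a b p = a := by
  simp [remark, (G.rev_ne p).symm]

@[simp] theorem remark_rev {p : P} {a b : RMark} : remark G σ p a b (G.rev p) = b := by
  simp [remark]

theorem remark_of_ne {p q : P} {a b : RMark} (h1 : q ≠ p) (h2 : q ≠ G.rev p) :
    remark G σ p a b q = σ q := by
  simp [remark, h1, h2]

/-- An upper bound for the energy still to be spent, apart from the edges the agents are in. -/
noncomputable def energy [Fintype P] (G : WeightedGraph V P) (σ : P → RMark) : ℝ :=
  ∑ p, (σ p).weight * G.len p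

theorem remark_pair {p q : P} {a b : RMark} (h1 : q ≠ p) (h2 : q ≠ G.rev p) :
    remark G σ p a b q = σ q ∧ remark G σ p a b (G.rev q) = σ (G.rev q) :=
  ⟨remark_of_ne h1 h2, remark_of_ne (fun h => h2 (by rw [← h, G.rev_rev]))
    fun h => h1 (G.rev_injective h)⟩

/-- Away from the edge of `p` the markers are unchanged and the passages on the trails remain there,
so only that edge has to be classified anew. -/
theorem Classified.remark {p r : P} {a b : RMark} (hr : Classified G σ S S' r) {T T' : Trail V P}
    (hp : Classified G (remark G σ p a b) T T' p)
    (hS : ∀ q, q ≠ p → q ≠ G.rev p → S.Edge q → T.Edge q)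
    (hS' : ∀ q, q ≠ p → q ≠ G.rev p → S'.Edge q → T'.Edge q) :
    Classified G (remark G σ p a b) T T' r := by
  by_cases h1 : r = p
  · rw [h1]; exact hp
  by_cases h2 : r = G.rev p
  · rw [h2]; exact hp.rev
  have h3 : G.rev r ≠ p := fun h => h2 (by rw [← h, G.rev_rev])
  have h4 : G.rev r ≠ G.rev p := fun h => h1 (G.rev_injective h)
  unfold Classified
  rw [remark_of_ne h1 h2, remark_of_ne h3 h4]
  exact hr.imp id (Or.imp id (Or.imp (Or.imp (hS _ h1 h2) (hS _ h3 h4))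
    (Or.imp (hS' _ h1 h2) (hS' _ h3 h4))))

theorem energy_nonneg [Fintype P] : 0 ≤ energy G σ :=
  Finset.sum_nonneg fun p _ => mul_nonneg (RMark.weight_nonneg _) (G.len_pos p).le

theorem energy_remark_sub [Fintype P] {p : P} {a b : RMark} {d : ℝ}
    (h : a.weight + b.weight + d ≤ (σ p).weight + (σ (G.rev p)).weight) :
    energy G (remark G σ p a b) ≤ energy G σ - d * G.len p := by
  classical
  have h1 : ∀ f : P → ℝ, ∑ q, f q = (∑ q ∈ Finset.univ \ {p, G.rev p}, f q) +
      (f p + f (G.rev p)) := by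
    intro f
    rw [← Finset.sum_pair (G.rev_ne p).symm]
    exact (Finset.sum_sdiff (Finset.subset_univ _)).symm
  unfold energy
  rw [h1, h1 (fun q => (σ q).weight * G.len q)]
  have h2 : ∑ q ∈ Finset.univ \ {p, G.rev p}, (remark G σ p a b q).weight * G.len q =
      ∑ q ∈ Finset.univ \ {p, G.rev p}, (σ q).weight * G.len q := by
    refine Finset.sum_congr rfl fun q hq => ?_
    simp only [Finset.mem_sdiff, Finset.mem_univ, Finset.mem_insert, Finset.mem_singleton,
      true_and, not_or] at hq
    rw [remark_of_ne hq.1 hq.2]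
  rw [h2]
  simp only [remark_self, remark_rev, G.len_rev]
  have := mul_le_mul_of_nonneg_right h (G.len_pos p).le
  linarith

theorem energy_remark_le [Fintype P] {p : P} {a b : RMark}
    (h : a.weight + b.weight ≤ (σ p).weight + (σ (G.rev p)).weight) :
    energy G (remark G σ p a b) ≤ energy G σ := by
  have := energy_remark_sub (G := G) (d := 0) (by simpa using h)
  simpa using this

theorem energy_remark [Fintype P] {p : P} {a b : RMark}
    (h : a.weight + b.weight + 1 ≤ (σ p).weight + (σ (G.rev p)).weight) :
    energy G (remark G σ p a b) ≤ energy G σ - G.len p := by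
  have := energy_remark_sub (G := G) h
  simpa using this

/-! #### Consequences of regularity -/

theorem Half.edge_markers (h : Half G c σ i S j S') {p : P} (hp : S.Edge p) :
    (σ p = i.markE ∨ σ p = .EAT) ∧ (σ (G.rev p) = i.markF ∨ σ (G.rev p) = .FAT ∨
      σ (G.rev p) = .blank ∨ σ (G.rev p) = i.markB) := by
  rcases hp with ⟨n, hn, rfl⟩ | hp
  · have := h.marks n hn
    tauto
  · have h1 := h.exc p hp
    rcases hm : S.mode with _ | q | q | ⟨a, b⟩ <;> rw [hm] at hp
    · exact hp.elim
    · obtain rfl : q = p := hp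
      have := h.out _ hm; tauto
    · obtain rfl : q = p := hp
      have := h.turn _ hm; tauto
    · exact hp.elim

/-- Being dead is a property of edges: no passage of a blank edge or of an edge on a trail carries a
dead marker, even when the other agent has followed that edge. -/
theorem Regular.dead (h : Regular G c σ i S j S') {p : P} (hp : (σ (G.rev p)).Dead) :
    (σ p).Dead := by
  have hl := h.left
  have hr := h.right
  rcases h.cls p with h1 | h1 | (h1 | h1) | (h1 | h1)
  · simp [h1.2, RMark.Dead] at hp
  · exact h1.1
  · have := hl.edge_markers h1
    rcases this.2 with h2 | h2 | h2 | h2 <;> simp [h2, RMark.Dead] at hp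
  · have := hl.edge_markers h1
    rcases this.1 with h2 | h2 <;> simp [h2, RMark.Dead] at hp
  · have := hr.edge_markers h1
    rcases this.2 with h2 | h2 | h2 | h2 <;> simp [h2, RMark.Dead] at hp
  · have := hr.edge_markers h1
    rcases this.1 with h2 | h2 <;> simp [h2, RMark.Dead] at hp

/-- Where an agent inside an edge comes from. -/
theorem Regular.in_edge (h : Regular G c σ i S j S') {r : P} {m : RMark}
    (hr : c.loc i = .edge r 0 m) :
    (S.mode = .out r ∧ m = .blank) ∨
    (m ≠ .blank ∧ (σ (G.rev r) = .D ∨ σ (G.rev r) = .D2) ∧ (σ r).Dead ∧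
      ((c.mark (G.rev r) = i.markE ∧ S.mode = .home) ∨
        i = .ariadne ∧ c.mark (G.rev r) = .EAT ∧ ∃ a b, S'.mode = .chase a b)) ∨
    (∃ lo hi, S.mode = .chase lo (hi + 1) ∧ lo ≤ hi ∧ hi < S'.M ∧ r = S'.x hi ∧ m = j.markE ∧
      σ r = .EAT ∧ σ (G.rev r) = .FAT ∧ c.mark (G.rev r) = j.markF) := by
  rcases hm : S.mode with _ | q | q | ⟨lo, hi⟩
  · rcases h.left.home hm with ⟨q, h1⟩ | ⟨r', m', h1, h2, h3⟩
    · rw [hr] at h1; cases h1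
    · rw [hr] at h1; cases h1
      rcases h3 with ⟨h3, h4, h5⟩ | ⟨h0, h3, h4, h5, h6⟩
      · refine Or.inr (Or.inl ⟨?_, Or.inl h5, h.dead (by simp [RMark.Dead, h5]),
          Or.inl ⟨h4, rfl⟩⟩)
        rcases h3 with rfl | rfl <;> simp
      · exact Or.inr (Or.inl ⟨by simp [h3], Or.inr h5, h.dead (by simp [RMark.Dead, h5]),
          Or.inr ⟨h0, h4, h6⟩⟩)
  · have := (h.left.out q hm).2
    rw [hr] at this; cases this
    exact Or.inl ⟨rfl, rfl⟩
  · have := (h.left.turn q hm).2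
    rw [hr] at this; cases this
  · obtain ⟨⟨h1, h2, -⟩, h3⟩ := h.left.chase lo hi hm
    rcases h3 with ⟨q, h3, -⟩ | ⟨h3, h4⟩ | ⟨h0, -, -, h6, r', h3, -, h4, h5⟩
    · rw [hr] at h3; cases h3
    · rw [hr] at h3; cases h3
      obtain ⟨k, rfl⟩ : ∃ k, hi = k + 1 := ⟨hi - 1, by omega⟩
      simp only [Nat.add_sub_cancel] at h4
      have := (h.right.marks k (by omega)).1 (by rw [hm]; exact ⟨by omega, by omega⟩)
      exact Or.inr (Or.inr ⟨lo, k, rfl, by omega, by omega, rfl, rfl, this.1, this.2, h4⟩)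
    · rw [hr] at h3; cases h3
      exact Or.inr (Or.inl ⟨by simp, Or.inr h5, h.dead (by simp [RMark.Dead, h5]),
        Or.inr ⟨h0, h4, h6⟩⟩)

/-- The anticipated markers at the passages by which the agents will arrive. -/
theorem Regular.target (h : Regular G c σ i S j S') (hij : i ≠ j) {k : Agent} {r : P} {m : RMark}
    (hr : c.loc k = .edge r 0 m) (hm : m ≠ .blank) :
    σ (G.rev r) = .D ∨ σ (G.rev r) = .D2 ∨ σ (G.rev r) = .FAT := by
  rcases Agent.eq_or_eq hij k with rfl | rfl
  · rcases h.in_edge hr with h1 | h1 | ⟨_, _, h1⟩ <;> tauto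
  · rcases h.symm.in_edge hr with h1 | h1 | ⟨_, _, h1⟩ <;> tauto

/-- Actual and anticipated markers differ only where an agent is about to write, and what it will
write there is $D$, $D'$ or $F_{AT}$. All other anticipated markers can be read off the graph. -/
theorem Regular.mark_eq (h : Regular G c σ i S j S') (hij : i ≠ j) {p : P}
    (h1 : σ p ≠ .D) (h2 : σ p ≠ .D2) (h3 : σ p ≠ .FAT) : c.mark p = σ p := by
  rcases h.agree p with h4 | ⟨k, r, m, h4, h5, rfl⟩
  · exact h4
  · rcases h.target hij h4 h5 with h6 | h6 | h6 <;> contradiction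

/-- An agent at a node sees the anticipated markers, except where the other agent comes from. -/
theorem Regular.mark_eq_of_node (h : Regular G c σ i S j S') (hij : i ≠ j) {u : V} {q : Option P}
    (hi : c.loc i = .node u q) {p : P} (hp : ∀ m, c.loc j ≠ .edge (G.rev p) 0 m) :
    c.mark p = σ p := by
  rcases h.agree p with h4 | ⟨k, r, m, h4, h5, rfl⟩
  · exact h4
  · rcases Agent.eq_or_eq hij k with rfl | rfl
    · rw [hi] at h4; cases h4
    · rw [G.rev_rev] at hp; exact absurd h4 (hp m)

/-- Nodes that `j` has left carry its marker, if it is not followed. -/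
theorem Regular.present_of_leaves (h : Regular G c σ i S j S') (hij : i ≠ j)
    {n : ℕ} (hn : S'.Leaves n) (hc : ¬ S.mode.Chased n) : Present G c (S'.xn n) j.markE := by
  have key : ∃ p, G.node p = S'.xn n ∧ σ p = j.markE := by
    rcases hn with hn | ⟨rfl, q, hq⟩
    · exact ⟨S'.x n, (h.right.path n hn).1, ((h.right.marks n hn).2 hc).1⟩
    · exact ⟨q, h.right.exc q hq⟩
  obtain ⟨p, h1, h2⟩ := key
  exact ⟨p, h1, by rw [h.mark_eq hij] <;> simp [h2]⟩

/-! #### Preservation of one half -/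

/-- For the half of the agent that does not move. Its own edges and the passage by which it will
arrive are untouched; the other trail may change only beyond the part that it has followed. -/
theorem Half.frame (h : Half G c σ i S j S') (hloc : c'.loc i = c.loc i)
    (hvis : c.visited i ⊆ c'.visited i)
    (hmark : ∀ r m, c.loc i = .edge r 0 m → m ≠ .blank →
      c'.mark (G.rev r) = c.mark (G.rev r) ∧ σ' (G.rev r) = σ (G.rev r))
    (hedge : ∀ p, S.Edge p → σ' p = σ p ∧ σ' (G.rev p) = σ (G.rev p))
    (hch : ∀ n < S.M, (S''.mode.Chased n ↔ S'.mode.Chased n))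
    (hpath : ∀ lo hi, S.mode = .chase lo hi → hi ≤ S''.M ∧ (∀ n ≤ hi, S''.xn n = S'.xn n) ∧
      (∀ n < hi, S''.x n = S'.x n))
    (hmode : ∀ a b, S'.mode = .chase a b → S''.M = S'.M ∧ ∃ a b, S''.mode = .chase a b) :
    Half G c' σ' i S j S'' where
  path := h.path
  inj := h.inj
  vis n hn := hvis (h.vis n hn)
  marks n hn := by
    obtain ⟨h1, h2⟩ := hedge (S.x n) (Or.inl ⟨n, hn, rfl⟩)
    rw [h1, h2, hch n hn]
    exact h.marks n hn
  exc q hq := by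
    rw [(hedge q (Or.inr hq)).1]; exact h.exc q hq
  out q hq := by
    rw [(hedge q (Or.inr (by rw [hq]; rfl))).2, hloc]; exact h.out q hq
  turn q hq := by
    rw [(hedge q (Or.inr (by rw [hq]; rfl))).2, hloc]; exact h.turn q hq
  home hm := by
    rw [hloc]
    refine (h.home hm).imp id ?_
    rintro ⟨r, m, h1, h2, h3⟩
    refine ⟨r, m, h1, h2, ?_⟩
    rcases h3 with h3 | h3
    · have := hmark r m h1 (by rcases h3.1 with rfl | rfl <;> simp)
      rw [this.1, this.2]; exact Or.inl h3
    · have := hmark r m h1 (by simp [h3.2.1])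
      rw [this.1, this.2]
      obtain ⟨h4, h5, h6, h7, a, b, h8⟩ := h3
      exact Or.inr ⟨h4, h5, h6, h7, (hmode a b h8).2⟩
  chase lo hi hm := by
    obtain ⟨⟨h1, h2, h3⟩, h4⟩ := h.chase lo hi hm
    obtain ⟨h5, h6, h7⟩ := hpath lo hi hm
    rw [hloc, h6 hi le_rfl, h6 lo h1.le, h7 (hi - 1) (by omega)]
    refine ⟨⟨h1, h5, h3⟩, ?_⟩
    rcases h4 with h4 | ⟨h4, h8⟩ | ⟨h8, h9, h10, ⟨a, b, h11⟩, r, h12, h13, h14, h15⟩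
    · exact Or.inl h4
    · refine Or.inr (Or.inl ⟨h4, ?_⟩)
      rw [(hmark _ _ h4 (by simp)).1, h8]
    · have := hmark r _ h12 (by simp)
      refine Or.inr (Or.inr ⟨h8, ?_, h10, (hmode a b h11).2, r, h12, h13, ?_, ?_⟩)
      · rw [h9, (hmode a b h11).1]
      · rw [this.1, h14]
      · rw [this.2, h15]

end

/-! ### Disjointness of the trails, and departures of a searching agent -/

section

variable {V P : Type*} {G : WeightedGraph V P} {c c' : Config V P RMark} {i j : Agent}
  {σ σ' : P → RMark} {S S' S'' : Trail V P}

/-- Equal passages would start at a node that both agents have left, against `disj`. Opposite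
passages are excluded by their markers, since one end of a trail edge carries $E$ or $E_{AT}$ and
the other end never does. -/
theorem Regular.edge_ne (h : Regular G c σ i S j S') {p q : P} (hp : S.Edge p)
    (hq : S'.Edge q) : p ≠ q ∧ p ≠ G.rev q := by
  constructor
  · rintro rfl
    have h1 : ∃ n, S.Leaves n ∧ S.xn n = G.node p := by
      rcases hp with ⟨n, hn, rfl⟩ | hp
      · exact ⟨n, Or.inl hn, (h.left.path n hn).1.symm⟩
      · exact ⟨S.M, Or.inr ⟨rfl, p, hp⟩, (h.left.exc p hp).1.symm⟩
    have h2 : ∃ n, S'.Leaves n ∧ S'.xn n = G.node p := by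
      rcases hq with ⟨n, hn, rfl⟩ | hp
      · exact ⟨n, Or.inl hn, (h.right.path n hn).1.symm⟩
      · exact ⟨S'.M, Or.inr ⟨rfl, p, hp⟩, (h.right.exc p hp).1.symm⟩
    obtain ⟨n, h1, h3⟩ := h1
    obtain ⟨m, h2, h4⟩ := h2
    exact h.disj n m h1 h2 (h3.trans h4.symm)
  · rintro rfl
    rcases (h.left.edge_markers hp).1 with h1 | h1 <;>
    rcases (h.right.edge_markers hq).2 with h2 | h2 | h2 | h2 <;> rw [h1] at h2 <;> simp at h2

/-- The passages of the stack of an agent are not those of its excursion. -/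
theorem Half.stack_ne (h : Half G c σ i S j S') {n : ℕ} (hn : n < S.M) {q : P}
    (hq : S.mode.Exc q) : S.x n ≠ q ∧ S.x n ≠ G.rev q := by
  have h0 := h.marks n hn
  have h1 : σ (S.x n) = i.markE ∨ σ (S.x n) = .EAT := by tauto
  have h2 : σ (G.rev (S.x n)) = i.markF ∨ σ (G.rev (S.x n)) = .FAT := by tauto
  have h3 : σ (G.rev q) = .blank ∨ σ (G.rev q) = i.markB := by
    rcases hm : S.mode with _ | q | q | ⟨a, b⟩ <;> rw [hm] at hq
    · exact hq.elim
    · cases hq; exact Or.inl (h.out _ hm).1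
    · cases hq; exact Or.inr (h.turn _ hm).1
    · exact hq.elim
  constructor
  · intro h4
    rw [h4] at h2
    rcases h3 with h3 | h3 <;> rcases h2 with h2 | h2 <;> rw [h3] at h2 <;> simp at h2
  · intro h4
    rw [h4] at h1
    rcases h3 with h3 | h3 <;> rcases h1 with h2 | h2 <;> rw [h3] at h2 <;> simp at h2

theorem Half.stack_inj (h : Half G c σ i S j S') {n m : ℕ} (hn : n < S.M) (hm : m < S.M) :
    (S.x n = S.x m → n = m) ∧ S.x n ≠ G.rev (S.x m) := by
  constructor
  · intro h1
    refine h.inj n hn.le m hm.le ?_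
    rw [← (h.path n hn).1, h1, (h.path m hm).1]
  · intro h1
    have h2 : σ (S.x n) = i.markE ∨ σ (S.x n) = .EAT := by have := h.marks n hn; tauto
    have h3 : σ (G.rev (S.x m)) = i.markF ∨ σ (G.rev (S.x m)) = .FAT := by
      have := h.marks m hm; tauto
    rw [h1] at h2
    rcases h3 with h3 | h3 <;> rcases h2 with h2 | h2 <;> rw [h3] at h2 <;> simp at h2

theorem depart_loc_self {M : Type} {c : Config V P M} {p : P} {l : Line M} :
    (c.depart i p l).loc i = .edge p 0 l.out := by
  simp [Config.depart]

theorem depart_loc_other {M : Type} {c : Config V P M} (hij : i ≠ j) {p : P} {l : Line M} :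
    (c.depart i p l).loc j = c.loc j := by
  simp [Config.depart, hij.symm]

theorem depart_mark_self {M : Type} {c : Config V P M} {p : P} {l : Line M} :
    (c.depart i p l).mark p = l.newOut := by
  simp [Config.depart]

theorem depart_mark_of_ne {M : Type} {c : Config V P M} {p q : P} {l : Line M} (h : q ≠ p) :
    (c.depart i p l).mark q = c.mark q := by
  simp [Config.depart, h]

/-- A departure with a nonblank marker already fixes what will be written on arrival, so `σ` may run
ahead of the actual marker at the far end. For an explorer this depends on whether the node is known
when it arrives, and `σ` does not anticipate it. -/
theorem agree_depart (h : ∀ p, c.mark p = σ p ∨ ∃ k r m, c.loc k = .edge r 0 m ∧ m ≠ .blank ∧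
    p = G.rev r) (hij : i ≠ j) {u : V} {q : Option P} (hi : c.loc i = .node u q) {p : P} {l : Line RMark} {a b : RMark} (hl : l.newOut = a)
    (hb : l.out ≠ .blank ∨ b = σ (G.rev p)) (r : P) :
    (c.depart i p l).mark r = remark G σ p a b r ∨ ∃ k r' m,
      (c.depart i p l).loc k = .edge r' 0 m ∧ m ≠ .blank ∧ r = G.rev r' := by
  by_cases h1 : r = p
  · subst h1; left; rw [depart_mark_self, remark_self, hl]
  by_cases h2 : r = G.rev p ∧ l.out ≠ .blank
  · exact Or.inr ⟨i, p, l.out, depart_loc_self, h2.2, h2.1⟩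
  have h3 : remark G σ p a b r = σ r := by
    by_cases h3 : r = G.rev p
    · subst h3; rw [remark_rev]; tauto
    · exact remark_of_ne h1 h3
  rw [depart_mark_of_ne h1, h3]
  rcases h r with h4 | ⟨k, r', m, h4, h5, h6⟩
  · exact Or.inl h4
  · refine Or.inr ⟨k, r', m, ?_, h5, h6⟩
    rcases Agent.eq_or_eq hij k with rfl | rfl
    · rw [hi] at h4; cases h4
    · rw [depart_loc_other hij, h4]

/-- The passage by which `j` will arrive belongs to the edge that `j` is in. That is not the edge
which `i` enters, in either direction, so the data about the arrival of `j` survive. -/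
theorem remark_target {p r : P} {a b : RMark} {l : Line RMark}
    (ho : ∀ m, c.loc j ≠ .edge (G.rev p) 0 m) (hs : ∀ m, c.loc j ≠ .edge p 0 m) {m : RMark}
    (hr : c.loc j = .edge r 0 m) :
    (c.depart i p l).mark (G.rev r) = c.mark (G.rev r) ∧
      remark G σ p a b (G.rev r) = σ (G.rev r) := by
  have h1 : G.rev r ≠ p := by
    rintro rfl; rw [G.rev_rev] at ho; exact ho m hr
  refine ⟨depart_mark_of_ne h1, remark_of_ne h1 fun h => ?_⟩
  cases G.rev_injective h
  exact hs m hr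

theorem Half.home_loc (h : Half G c σ i S j S') (hm : S.mode = .home) {u : V} {q : Option P}
    (hi : c.loc i = .node u q) : u = S.xn S.M := by
  rcases h.home hm with ⟨q, h1⟩ | ⟨r, m, h1, -⟩
  · rw [hi] at h1; cases h1; rfl
  · rw [hi] at h1; cases h1

/-- The presence of a marker is not affected by departures that use another marker. -/
theorem present_depart {p : P} {l : Line RMark} {w : V} {m : RMark} (h : Present G c w m)
    (hm : c.mark p ≠ m) : Present G (c.depart i p l) w m := by
  obtain ⟨r, h1, h2⟩ := h
  refine ⟨r, h1, ?_⟩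
  rw [depart_mark_of_ne, h2]
  rintro rfl; exact hm h2

/-- An agent starts exploring an edge. -/
theorem Regular.explore (h : Regular G c σ i S j S') (hij : i ≠ j) {u : V} {q : Option P}
    (hi : c.loc i = .node u q) {p : P} (hp : G.node p = u)
    (ho : ∀ m, c.loc j ≠ .edge (G.rev p) 0 m) (hs : ∀ m, c.loc j ≠ .edge p 0 m)
    (hm : S.mode = .home) (hb : σ p = .blank) (hb' : σ (G.rev p) = .blank)
    (hE : ¬ Present G c u j.markE) {l : Line RMark} (hl : l.out = .blank)
    (hl' : l.newOut = i.markE) :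
    Regular G (c.depart i p l) (remark G σ p i.markE .blank) i { S with mode := .out p } j S' := by
  have hu := h.left.home_loc hm hi
  have hpS : ¬ S.Edge p := fun h1 => by
    rcases (h.left.edge_markers h1).1 with h2 | h2 <;> rw [hb] at h2 <;> simp at h2
  have hpS2 : ¬ S.Edge (G.rev p) := fun h1 => by
    rcases (h.left.edge_markers h1).1 with h2 | h2 <;> rw [hb'] at h2 <;> simp at h2
  have hpT : ¬ S'.Edge p := fun h1 => by
    rcases (h.right.edge_markers h1).1 with h2 | h2 <;> rw [hb] at h2 <;> simp at h2
  have hpT2 : ¬ S'.Edge (G.rev p) := fun h1 => by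
    rcases (h.right.edge_markers h1).1 with h2 | h2 <;> rw [hb'] at h2 <;> simp at h2
  have hblank : ∀ r, remark G σ p i.markE .blank r = .blank → σ r = .blank := by
    intro r hr
    by_cases h1 : r = p
    · subst h1; simp at hr
    by_cases h2 : r = G.rev p
    · subst h2; exact hb'
    rwa [remark_of_ne h1 h2] at hr
  have hcp : c.mark p = .blank := by rw [h.mark_eq hij] <;> simp [hb]
  have hsea : Searching { S with mode := .out p } S' → Searching S S' := by
    rintro ⟨-, h2⟩; exact ⟨by simp [hm], h2⟩
  constructor
  · constructor
    · exact h.left.path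
    · exact h.left.inj
    · exact h.left.vis
    · intro n hn
      obtain ⟨h1, h2⟩ := remark_pair (G := G) (σ := σ) (a := i.markE) (b := .blank)
        (q := S.x n) (p := p) (fun h1 => hpS (Or.inl ⟨n, hn, h1.symm⟩))
        (fun h1 => hpS2 (Or.inl ⟨n, hn, h1.symm⟩))
      rw [h1, h2]
      exact h.left.marks n hn
    · rintro r rfl
      exact ⟨hp.trans hu, remark_self⟩
    · rintro r hr
      cases hr
      exact ⟨remark_rev, by rw [depart_loc_self, hl]⟩
    · simp
    · simp
    · simp
  · refine h.right.frame (depart_loc_other hij) subset_rfl (fun r m hr _ => remark_target ho hs hr)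
      (fun r hr => remark_pair (fun h1 => hpT (h1 ▸ hr)) fun h1 => hpT2 (h1 ▸ hr)) ?_ ?_ ?_
    · simp [hm]
    · intro lo hi h1
      exact ⟨(h.right.chase lo hi h1).1.2.1, by simp, by simp⟩
    · simp [hm]
  · intro n m hn hm'
    by_cases h1 : n < S.M
    · exact h.disj n m (Or.inl h1) hm'
    · obtain rfl : n = S.M := by
        rcases hn with hn | hn
        · exact absurd hn h1
        · exact hn.1
      intro h2
      -- If `j` had left this node too, its $E$ would be present, and the table would have preferred
      -- following it to exploring.
      have := h.present_of_leaves hij hm' (by simp [hm])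
      rw [← h2] at this
      exact hE (hu ▸ this)
  · refine fun r => (h.cls r).remark (Or.inr (Or.inr (Or.inl (Or.inl (Or.inr rfl)))))
      (fun q _ _ hq => ?_) fun q _ _ hq => hq
    rcases hq with hq | hq
    · exact Or.inl hq
    · rw [hm] at hq; exact hq.elim
  · exact agree_depart h.agree hij hi hl' (Or.inr hb'.symm)
  · exact fun hsr r hr => h.blankL (hsea hsr) r (hblank r hr)
  · exact fun hsr r hr => h.blankR (hsea hsr) r (hblank r hr)
  · intro hsr r hr
    by_cases h1 : r = p
    · subst h1
      refine Or.inl ⟨?_, Or.inr rfl⟩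
      rw [hp, hu]; exact h.left.vis _ le_rfl
    by_cases h2 : r = G.rev p
    · subst h2; simp at hr
    rw [remark_of_ne h1 h2] at hr
    refine (h.touched (hsea hsr) r hr).imp ?_ id
    simp [hm, Config.depart]
    tauto
  · intro hsr w h1 h2
    rcases h.shared (hsea hsr) w h1 h2 with ⟨h3, ⟨q', h4⟩, h5⟩ | ⟨h3, h4, h5⟩
    · rw [hi] at h4; cases h4
      exact absurd h5 hE
    · refine Or.inr ⟨h3, ?_, present_depart h5 (by simp [hcp])⟩
      rwa [depart_loc_other hij]

/-- An agent leaves the other end of the edge that it has explored. -/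
theorem Regular.turnBack (h : Regular G c σ i S j S') (hij : i ≠ j) {p : P}
    (ho : ∀ m, c.loc j ≠ .edge p 0 m) (hs : ∀ m, c.loc j ≠ .edge (G.rev p) 0 m)
    (hm : S.mode = .turn p) :
    Regular G (c.depart i (G.rev p) ⟨i.markB, .D, .any, .D⟩) (remark G σ (G.rev p) .D .D) i
      { S with mode := .home } j S' := by
  obtain ⟨hB, hi⟩ := h.left.turn p hm
  have hexc : S.mode.Exc p := by rw [hm]; rfl
  obtain ⟨hnode, hE⟩ := h.left.exc p hexc
  have hpT : ∀ r, S'.Edge r → r ≠ G.rev p ∧ r ≠ G.rev (G.rev p) := by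
    intro r hr
    rw [G.rev_rev]
    have := h.symm.edge_ne hr (Or.inr hexc)
    exact ⟨this.2, this.1⟩
  have hblank : ∀ r, remark G σ (G.rev p) .D .D r = .blank → σ r = .blank := by
    intro r hr
    by_cases h1 : r = G.rev p
    · subst h1; simp at hr
    by_cases h2 : r = G.rev (G.rev p)
    · subst h2; simp at hr
    rwa [remark_of_ne h1 h2] at hr
  have hsea : Searching { S with mode := .home } S' → Searching S S' := by
    rintro ⟨-, h2⟩; exact ⟨by simp [hm], h2⟩
  have hcB : c.mark (G.rev p) = i.markB := by rw [h.mark_eq hij] <;> simp [hB]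
  have hcE : c.mark p = i.markE := by rw [h.mark_eq hij] <;> simp [hE]
  constructor
  · constructor
    · exact h.left.path
    · exact h.left.inj
    · exact h.left.vis
    · intro n hn
      have hne := h.left.stack_ne hn hexc
      obtain ⟨h1, h2⟩ := remark_pair (G := G) (σ := σ) (a := .D) (b := .D)
        (q := S.x n) (p := G.rev p) hne.2 (by rw [G.rev_rev]; exact hne.1)
      rw [h1, h2]
      exact h.left.marks n hn
    · simp
    · simp
    · simp
    · intro _
      refine Or.inr ⟨G.rev p, i.markB, depart_loc_self, by rw [G.rev_rev]; exact hnode, Or.inl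
        ⟨Or.inl rfl, ?_, remark_rev⟩⟩
      rw [G.rev_rev, depart_mark_of_ne (G.rev_ne p).symm, hcE]
    · simp
  · refine h.right.frame (depart_loc_other hij) subset_rfl
      (fun r m hr _ => remark_target (by rw [G.rev_rev]; exact ho) hs hr)
      (fun r hr => remark_pair (hpT r hr).1 (hpT r hr).2) ?_ ?_ ?_
    · simp [hm]
    · intro lo hi h1
      exact ⟨(h.right.chase lo hi h1).1.2.1, by simp, by simp⟩
    · simp [hm]
  · intro n m hn hm'
    refine h.disj n m ?_ hm'
    rcases hn with hn | ⟨-, _, hn⟩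
    · exact Or.inl hn
    · exact hn.elim
  · refine fun r => (h.cls r).remark (Or.inr (Or.inl (by simp [RMark.Dead])))
      (fun q h1 h2 hq => ?_) fun q _ _ hq => hq
    rcases hq with hq | hq
    · exact Or.inl hq
    · rw [hm] at hq; cases hq
      exact absurd (G.rev_rev _).symm h2
  · exact agree_depart h.agree hij hi rfl (Or.inl (by simp))
  · exact fun hsr r hr => h.blankL (hsea hsr) r (hblank r hr)
  · exact fun hsr r hr => h.blankR (hsea hsr) r (hblank r hr)
  · intro hsr r hr
    have hvis : G.node p ∈ c.visited i ∧ G.node (G.rev p) ∈ c.visited i ∨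
        G.node p ∈ c.visited j ∧ G.node (G.rev p) ∈ c.visited j := by
      rcases h.touched (hsea hsr) (G.rev p) (by simp [hB]) with ⟨h1, h2⟩ | ⟨h1, h2⟩
      · rw [hm, G.rev_rev] at h2
        simp at h2
        exact Or.inl ⟨h2, h1⟩
      · rw [G.rev_rev] at h2
        rcases h2 with h2 | h2
        · exact Or.inr ⟨h2, h1⟩
        · have := h.right.exc (G.rev p) (by rw [h2]; rfl)
          rw [hB] at this; simp at this
    by_cases h1 : r = G.rev p
    · subst h1; rw [G.rev_rev]
      show (_ ∈ c.visited i ∧ (_ ∈ c.visited i ∨ _)) ∨ (_ ∈ c.visited j ∧ (_ ∈ c.visited j ∨ _))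
      tauto
    by_cases h2 : r = p
    · subst h2
      show (_ ∈ c.visited i ∧ (_ ∈ c.visited i ∨ _)) ∨ (_ ∈ c.visited j ∧ (_ ∈ c.visited j ∨ _))
      tauto
    rw [remark_of_ne h1 (by rwa [G.rev_rev])] at hr
    refine (h.touched (hsea hsr) r hr).imp ?_ id
    rw [hm]
    simp [Config.depart]
  · intro hsr w h1 h2
    rcases h.shared (hsea hsr) w h1 h2 with ⟨h3, -⟩ | ⟨h3, h4, h5⟩
    · rw [hm] at h3; cases h3
    · refine Or.inr ⟨h3, ?_, present_depart h5 (by simp [hcB])⟩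
      rwa [depart_loc_other hij]

end

/-! ### Departures along a trail: following, stepping back, retreating -/

section

variable {V P : Type*} {G : WeightedGraph V P} {c c' : Config V P RMark} {i j : Agent}
  {σ σ' : P → RMark} {S S' S'' : Trail V P}

/-- An agent follows the other one along an edge of its trail. -/
theorem Regular.follow (h : Regular G c σ i S j S') (hij : i ≠ j) {lo n : ℕ} (hn : n < S'.M)
    {q : Option P} (hi : c.loc i = .node (S'.xn n) q)
    (hlo : (S.mode = .home ∧ lo = n) ∨ S.mode = .chase lo n)
    (ho : ∀ m, c.loc j ≠ .edge (G.rev (S'.x n)) 0 m) (hs : ∀ m, c.loc j ≠ .edge (S'.x n) 0 m) :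
    Regular G (c.depart i (S'.x n) ⟨j.markE, .EAT, .any, .FAT⟩)
      (remark G σ (S'.x n) .EAT .FAT) i { S with mode := .chase lo (n + 1) } j S' := by
  have hlo' : lo ≤ n := by
    rcases hlo with h1 | h1
    · exact h1.2.le
    · exact (h.left.chase _ _ h1).1.1.le
  have hch : ∀ m, m ≠ n →
      ((Mode.chase lo (n + 1) : Mode P).Chased m ↔ S.mode.Chased m) := by
    intro m hm
    rcases hlo with h1 | h1
    · rw [h1.1]; simp; omega
    · rw [h1]; simp; omega
  have hnc : ¬ S.mode.Chased n := by
    rcases hlo with h1 | h1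
    · rw [h1.1]; simp
    · rw [h1]; simp
  have hexc : ∀ r, ¬ S.mode.Exc r := by
    rcases hlo with h1 | h1
    · rw [h1.1]; simp
    · rw [h1]; simp
  have hmk := (h.right.marks n hn).2 hnc
  have hpe : S'.Edge (S'.x n) := Or.inl ⟨n, hn, rfl⟩
  have hSM : i = .ariadne → S.xn S.M = S'.xn lo := by
    intro h0
    rcases hlo with ⟨h1, rfl⟩ | h1
    · exact (h.left.home_loc h1 hi).symm
    · exact (h.left.chase _ _ h1).1.2.2 h0
  constructor
  · constructor
    · exact h.left.path
    · exact h.left.inj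
    · exact h.left.vis
    · intro m hm
      have hne := h.edge_ne (Or.inl ⟨m, hm, rfl⟩) hpe
      obtain ⟨h1, h2⟩ := remark_pair (G := G) (σ := σ) (a := .EAT) (b := .FAT) hne.1 hne.2
      rw [h1, h2]
      exact h.left.marks m hm
    · simp
    · simp
    · simp
    · simp
    · intro a b hab
      cases hab
      refine ⟨⟨by omega, hn, hSM⟩, Or.inr (Or.inl ⟨depart_loc_self, ?_⟩)⟩
      simp only [Nat.add_sub_cancel]
      rw [depart_mark_of_ne (G.rev_ne _), h.mark_eq hij] <;> simp [hmk.2]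
  · have hex : ∀ r, S'.mode.Exc r → remark G σ (S'.x n) .EAT .FAT r = σ r ∧
        remark G σ (S'.x n) .EAT .FAT (G.rev r) = σ (G.rev r) := by
      intro r hr
      have := h.right.stack_ne hn hr
      exact remark_pair this.1.symm fun h1 => this.2 (by rw [h1, G.rev_rev])
    have hl := depart_loc_other (c := c) hij (p := S'.x n) (l := ⟨j.markE, .EAT, .any, .FAT⟩)
    constructor
    · exact h.right.path
    · exact h.right.inj
    · exact h.right.vis
    · intro m hm
      by_cases hmn : m = n
      · subst hmn
        simp [hlo']
      · have hne := h.right.stack_inj hm hn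
        obtain ⟨h1, h2⟩ := remark_pair (G := G) (σ := σ) (a := .EAT) (b := .FAT)
          (fun h1 => hmn (hne.1 h1)) hne.2
        rw [h1, h2, hch m hmn]
        exact h.right.marks m hm
    · intro r hr
      rw [(hex r hr).1]
      exact h.right.exc r hr
    · intro r hr
      rw [(hex r (by rw [hr]; rfl)).2, hl]
      exact h.right.out r hr
    · intro r hr
      rw [(hex r (by rw [hr]; rfl)).2, hl]
      exact h.right.turn r hr
    · intro hm
      rw [hl]
      refine (h.right.home hm).imp id ?_
      rintro ⟨r, m, h1, h2, h3⟩
      refine ⟨r, m, h1, h2, ?_⟩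
      have := remark_target (a := .EAT) (b := .FAT) (σ := σ)
        (l := ⟨j.markE, .EAT, .any, .FAT⟩) ho hs h1 (i := i)
      rw [this.1, this.2]
      refine h3.imp id ?_
      rintro ⟨h3, h4, h5, h6, -⟩
      exact ⟨h3, h4, h5, h6, lo, n + 1, rfl⟩
    · intro a b hab
      obtain ⟨h1, h2⟩ := h.right.chase a b hab
      rw [hl]
      refine ⟨h1, ?_⟩
      rcases h2 with h2 | ⟨h2, h3⟩ | ⟨h2, h3, h4, h5, r, h6, h7, h8, h9⟩
      · exact Or.inl h2
      · refine Or.inr (Or.inl ⟨h2, ?_⟩)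
        rw [(remark_target (a := .EAT) (b := .FAT) (σ := σ) ho hs h2).1, h3]
      · refine Or.inr (Or.inr ⟨h2, h3, h4, ⟨_, _, rfl⟩, r, h6, h7, ?_, ?_⟩)
        · rw [(remark_target (a := .EAT) (b := .FAT) (σ := σ) ho hs h6).1, h8]
        · rw [(remark_target (i := i) (l := ⟨j.markE, .EAT, .any, .FAT⟩) (σ := σ) ho hs h6).2, h9]
  · intro a b ha hb
    refine h.disj a b ?_ hb
    rcases ha with ha | ⟨-, _, ha⟩
    · exact Or.inl ha
    · exact ha.elim
  · refine fun r => (h.cls r).remark (Or.inr (Or.inr (Or.inr (Or.inl hpe))))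
      (fun q _ _ hq => ?_) fun q _ _ hq => hq
    rcases hq with hq | hq
    · exact Or.inl hq
    · exact absurd hq (hexc q)
  · exact agree_depart h.agree hij hi rfl (Or.inl (by simp))
  -- The remaining clauses are required only while both agents search, and `i` now follows.
  all_goals exact fun hsr => absurd rfl (hsr.1 lo (n + 1))

/-- An agent steps back along its own trail. -/
theorem Regular.pop (h : Regular G c σ i S j S') (hij : i ≠ j) {n : ℕ} (hn : S.M = n + 1)
    {u : V} {q : Option P} (hi : c.loc i = .node u q) (hm : S.mode = .home)
    (hch : ¬ S'.mode.Chased n) (hb : ¬ Present G c u .blank) (hE : ¬ Present G c u j.markE)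
    (ho : ∀ m, c.loc j ≠ .edge (S.x n) 0 m) (hs : ∀ m, c.loc j ≠ .edge (G.rev (S.x n)) 0 m) :
    Regular G (c.depart i (G.rev (S.x n)) ⟨i.markF, .D, .any, .D⟩)
      (remark G σ (G.rev (S.x n)) .D .D) i { S with M := n } j S' := by
  have hu := h.left.home_loc hm hi
  have hpe : S.Edge (S.x n) := Or.inl ⟨n, by omega, rfl⟩
  have hmk := (h.left.marks n (by omega)).2 hch
  have hpath := h.left.path n (by omega)
  have hcF : c.mark (G.rev (S.x n)) = i.markF := by rw [h.mark_eq hij] <;> simp [hmk.2]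
  have hblank : ∀ r, remark G σ (G.rev (S.x n)) .D .D r = .blank → σ r = .blank := by
    intro r hr
    by_cases h1 : r = G.rev (S.x n)
    · subst h1; simp at hr
    by_cases h2 : r = G.rev (G.rev (S.x n))
    · subst h2; simp at hr
    rwa [remark_of_ne h1 h2] at hr
  constructor
  · constructor
    · exact fun m hm => h.left.path m (by simp at hm; omega)
    · exact fun a ha b hb => h.left.inj a (by simp at ha; omega) b (by simp at hb; omega)
    · exact fun m hm => h.left.vis m (by simp at hm; omega)
    · intro m hm
      simp only at hm
      have hne := h.left.stack_inj (n := m) (m := n) (by omega) (by omega)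
      obtain ⟨h1, h2⟩ := remark_pair (G := G) (σ := σ) (a := .D) (b := .D)
        (p := G.rev (S.x n)) hne.2 (fun h1 => by
          rw [G.rev_rev] at h1; have := hne.1 h1; omega)
      rw [h1, h2]
      exact h.left.marks m (by omega)
    · intro r hr; rw [hm] at hr; exact hr.elim
    · intro r hr; rw [hm] at hr; cases hr
    · intro r hr; rw [hm] at hr; cases hr
    · intro _
      refine Or.inr ⟨_, i.markF, depart_loc_self, by rw [G.rev_rev]; exact hpath.1, Or.inl
        ⟨Or.inr rfl, ?_, remark_rev⟩⟩
      rw [G.rev_rev, depart_mark_of_ne (G.rev_ne _).symm, h.mark_eq hij] <;> simp [hmk.1]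
    · intro a b hab; rw [hm] at hab; cases hab
  · refine h.right.frame (depart_loc_other hij) subset_rfl
      (fun r m hr _ => remark_target (by rw [G.rev_rev]; exact ho) hs hr)
      (fun r hr => ?_) (fun _ _ => Iff.rfl) ?_ ?_
    · have := h.symm.edge_ne hr hpe
      exact remark_pair this.2 (by rw [G.rev_rev]; exact this.1)
    · intro lo hi h1
      have := (h.right.chase lo hi h1).1
      rw [h1] at hch
      simp at hch
      exact ⟨show hi ≤ n by omega, by simp, by simp⟩
    · simp [hm]
  · intro a b ha hb
    refine h.disj a b ?_ hb
    rcases ha with ha | ⟨-, _, ha⟩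
    · exact Or.inl (by simp at ha; omega)
    · rw [hm] at ha; exact ha.elim
  · refine fun r => (h.cls r).remark (Or.inr (Or.inl (by simp [RMark.Dead])))
      (fun q h1 h2 hq => ?_) fun q _ _ hq => hq
    rcases hq with ⟨m, hq, rfl⟩ | hq
    · refine Or.inl ⟨m, ?_, rfl⟩
      have : m ≠ n := by rintro rfl; rw [G.rev_rev] at h2; exact h2 rfl
      show m < n
      omega
    · rw [hm] at hq; exact hq.elim
  · exact agree_depart h.agree hij hi rfl (Or.inl (by simp))
  · intro hsr r hr hv
    obtain ⟨m, hm1, hm2⟩ := h.blankL hsr r (hblank r hr) hv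
    refine ⟨m, ?_, hm2⟩
    show m ≤ n
    -- The only node removed from the trail is its last one. No blank passage is left there, since
    -- the table prefers $\emptyset$ to $F$.
    by_contra hlt
    obtain rfl : m = S.M := by omega
    refine hb ⟨r, by rw [← hm2, hu], ?_⟩
    rw [h.mark_eq hij] <;> simp [hblank r hr]
  · exact fun hsr r hr => h.blankR hsr r (hblank r hr)
  · intro hsr r hr
    have hv : G.node (S.x n) ∈ c.visited i ∧ G.node (G.rev (S.x n)) ∈ c.visited i := by
      rw [hpath.1, hpath.2]
      exact ⟨h.left.vis _ (by omega), h.left.vis _ (by omega)⟩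
    by_cases h1 : r = G.rev (S.x n)
    · subst h1; rw [G.rev_rev]; exact Or.inl ⟨hv.2, Or.inl hv.1⟩
    by_cases h2 : r = S.x n
    · subst h2; exact Or.inl ⟨hv.1, Or.inl hv.2⟩
    rw [remark_of_ne h1 (by rwa [G.rev_rev])] at hr
    exact h.touched hsr r hr
  · intro hsr w h1 h2
    rcases h.shared hsr w h1 h2 with ⟨h3, ⟨q', h4⟩, h5⟩ | ⟨h3, h4, h5⟩
    · rw [hi] at h4; cases h4
      exact absurd h5 hE
    · refine Or.inr ⟨h3, ?_, present_depart h5 (by simp [hcF])⟩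
      rwa [depart_loc_other hij]

/-- Ariadne steps back along the trail of Theseus, whose last edge is thereby done with. -/
theorem Regular.retreat (h : Regular G c σ i S j S') (hij : i ≠ j) (h0 : i = .ariadne)
    {lo k : ℕ} (hmode : S.mode = .chase lo (k + 1)) (hk : S'.M = k + 1)
    {a b : ℕ} (hmode' : S'.mode = .chase a b)
    {u : V} {q : Option P} (hi : c.loc i = .node u q)
    (ho : ∀ m, c.loc j ≠ .edge (S'.x k) 0 m) (hs : ∀ m, c.loc j ≠ .edge (G.rev (S'.x k)) 0 m)
    {nm : Mode P} (hnm : (lo < k ∧ nm = .chase lo k) ∨ (lo = k ∧ nm = .home)) :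
    Regular G (c.depart i (G.rev (S'.x k)) ⟨.FAT, .D2, .any, .D2⟩)
      (remark G σ (G.rev (S'.x k)) .D2 .D2) i { S with mode := nm } j { S' with M := k } := by
  have hlo := (h.left.chase _ _ hmode).1
  have hpe : S'.Edge (S'.x k) := Or.inl ⟨k, by omega, rfl⟩
  have hmk := (h.right.marks k (by omega)).1 (by rw [hmode]; simp; omega)
  have hpath := h.right.path k (by omega)
  have hSM := hlo.2.2 h0
  have hj : j ≠ .ariadne := h0 ▸ hij.symm
  have hcE : (c.depart i (G.rev (S'.x k)) ⟨.FAT, .D2, .any, .D2⟩).mark (S'.x k) = .EAT := by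
    rw [depart_mark_of_ne (G.rev_ne _).symm, h.mark_eq hij] <;> simp [hmk.1]
  constructor
  · constructor
    · exact h.left.path
    · exact h.left.inj
    · exact h.left.vis
    · intro m hm
      have hne := h.edge_ne (Or.inl ⟨m, hm, rfl⟩) hpe
      obtain ⟨h1, h2⟩ := remark_pair (G := G) (σ := σ) (a := .D2) (b := .D2)
        (p := G.rev (S'.x k)) hne.2 (by rw [G.rev_rev]; exact hne.1)
      rw [h1, h2]
      exact h.left.marks m hm
    · rcases hnm with ⟨-, rfl⟩ | ⟨-, rfl⟩ <;> simp
    · rcases hnm with ⟨-, rfl⟩ | ⟨-, rfl⟩ <;> simp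
    · rcases hnm with ⟨-, rfl⟩ | ⟨-, rfl⟩ <;> simp
    · intro hnm'
      rcases hnm with ⟨-, rfl⟩ | ⟨rfl, rfl⟩
      · cases hnm'
      · refine Or.inr ⟨_, _, depart_loc_self, ?_, Or.inr ⟨h0, rfl, ?_, remark_rev, a, b, hmode'⟩⟩
        · rw [G.rev_rev, hpath.1, ← hSM]
        · rw [G.rev_rev]; exact hcE
    · intro a' b' hab
      rcases hnm with ⟨hlt, rfl⟩ | ⟨-, rfl⟩
      · cases hab
        refine ⟨⟨hlt, le_rfl, hlo.2.2⟩, Or.inr (Or.inr ⟨h0, rfl, ?_, ⟨a, b, hmode'⟩, _,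
          depart_loc_self, ?_, ?_, remark_rev⟩)⟩
        -- The node being attained is off the trail of Ariadne: before the end of her trail by
        -- `disj`, and at its end because that is node number `lo` of the other trail, with `lo <
        -- k`.
        · intro n hn
          rcases lt_or_eq_of_le hn with hn | rfl
          · exact h.disj n k (Or.inl hn) (Or.inl (by omega))
          · show S.xn S.M ≠ _
            rw [hSM]
            intro h1
            have := h.right.inj lo (by omega) k (by omega) h1
            omega
        · rw [G.rev_rev, hpath.1]
        · rw [G.rev_rev]; exact hcE
      · cases hab
  · have hl := depart_loc_other (c := c) hij (p := G.rev (S'.x k)) (l := ⟨.FAT, .D2, .any, .D2⟩)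
    constructor
    · exact fun m hm => h.right.path m (by simp at hm; omega)
    · exact fun a ha b hb => h.right.inj a (by simp at ha; omega) b (by simp at hb; omega)
    · exact fun m hm => h.right.vis m (by simp at hm; omega)
    · intro m hm
      simp only at hm
      have hne := h.right.stack_inj (n := m) (m := k) (by omega) (by omega)
      obtain ⟨h1, h2⟩ := remark_pair (G := G) (σ := σ) (a := .D2) (b := .D2)
        (p := G.rev (S'.x k)) hne.2 (fun h1 => by
          rw [G.rev_rev] at h1; have := hne.1 h1; omega)
      rw [h1, h2]
      have h3 := h.right.marks m (by omega)
      have h4 : nm.Chased m ↔ S.mode.Chased m := by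
        rw [hmode]
        rcases hnm with ⟨-, rfl⟩ | ⟨rfl, rfl⟩ <;> simp <;> omega
      simpa only [h4] using h3
    · intro r hr; rw [hmode'] at hr; exact hr.elim
    · intro r hr; rw [hmode'] at hr; cases hr
    · intro r hr; rw [hmode'] at hr; cases hr
    · intro hm; rw [hmode'] at hm; cases hm
    · intro a' b' hab
      obtain ⟨⟨h1, h2, -⟩, h4⟩ := h.right.chase a' b' hab
      -- Shortening the trail of Theseus may cut off the node where he began to follow Ariadne. This
      -- is why the clause linking the end of the own trail to `lo` is demanded of Ariadne only.
      refine ⟨⟨h1, h2, fun h5 => absurd h5 hj⟩, ?_⟩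
      rw [hl]
      rcases h4 with ⟨q', h4, h5⟩ | ⟨h4, h5⟩ | ⟨h4, -⟩
      · exact Or.inl ⟨q', h4, h5.imp id fun h5 n hn => h5 n (by simp at hn; omega)⟩
      · refine Or.inr (Or.inl ⟨h4, ?_⟩)
        rw [(remark_target (σ := σ) (a := .D2) (b := .D2) (by rw [G.rev_rev]; exact ho) hs h4).1]
        exact h5
      · exact absurd h4 hj
  · intro n m hn hm
    refine h.disj n m ?_ ?_
    · rcases hn with hn | ⟨-, _, hn⟩
      · exact Or.inl hn
      · rcases hnm with ⟨-, rfl⟩ | ⟨rfl, rfl⟩ <;> exact hn.elim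
    · rcases hm with hm | ⟨-, _, hm⟩
      · exact Or.inl (by simp at hm; omega)
      · rw [hmode'] at hm; exact hm.elim
  · refine fun r => (h.cls r).remark (Or.inr (Or.inl (by simp [RMark.Dead])))
      (fun q h1 h2 hq => ?_) fun q h1 h2 hq => ?_
    · rcases hq with hq | hq
      · exact Or.inl hq
      · rw [hmode] at hq; exact hq.elim
    · rcases hq with ⟨m, hq, rfl⟩ | hq
      · refine Or.inl ⟨m, ?_, rfl⟩
        have : m ≠ k := by rintro rfl; rw [G.rev_rev] at h2; exact h2 rfl
        show m < k
        omega
      · rw [hmode'] at hq; exact hq.elim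
  · exact agree_depart h.agree hij hi rfl (Or.inl (by simp))
  all_goals exact fun hsr => absurd hmode' (hsr.2 a b)

end

/-! ### Arrivals in regular configurations -/

section

variable {V P : Type*} {G : WeightedGraph V P} {c c' : Config V P RMark} {i j : Agent}
  {σ σ' : P → RMark} {S S' S'' : Trail V P}

section

variable {M : Type} {A : Algorithm M} {c : Config V P M} {p : P} {m : M}

theorem arrive_loc_self :
    (c.arrive G A i p m).loc i = .node (G.node (G.rev p)) (some (G.rev p)) := by
  simp [Config.arrive]

theorem arrive_loc_other (hij : i ≠ j) : (c.arrive G A i p m).loc j = c.loc j := by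
  simp [Config.arrive, hij.symm]

theorem arrive_mark_rev :
    (c.arrive G A i p m).mark (G.rev p) = arrivalMark G A c i m (G.rev p) := by
  simp [Config.arrive]

theorem arrive_mark_of_ne {q : P} (h : q ≠ G.rev p) :
    (c.arrive G A i p m).mark q = c.mark q := by
  simp [Config.arrive, h]

theorem arrive_visited_self :
    (c.arrive G A i p m).visited i = insert (G.node (G.rev p)) (c.visited i) := by
  simp [Config.arrive]

theorem arrive_visited_other (hij : i ≠ j) : (c.arrive G A i p m).visited j = c.visited j := by
  simp [Config.arrive, hij.symm]

theorem subset_arrive_visited (k : Agent) : c.visited k ⊆ (c.arrive G A i p m).visited k := by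
  by_cases h : k = i
  · subst h; rw [arrive_visited_self]; exact Set.subset_insert _ _
  · rw [arrive_visited_other fun h' => h h'.symm]

end

theorem agree_arrive (h : ∀ p, c.mark p = σ p ∨ ∃ k r m, c.loc k = .edge r 0 m ∧ m ≠ .blank ∧
    p = G.rev r) (hij : i ≠ j) {p : P} {m : RMark} (hi : c.loc i = .edge p 0 m) (hσ : ∀ r, r ≠ G.rev p → σ' r = σ r)
    (hmk : arrivalMark G rendezvous c i m (G.rev p) = σ' (G.rev p)) (r : P) :
    (c.arrive G rendezvous i p m).mark r = σ' r ∨ ∃ k r' m',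
      (c.arrive G rendezvous i p m).loc k = .edge r' 0 m' ∧ m' ≠ .blank ∧ r = G.rev r' := by
  by_cases h1 : r = G.rev p
  · subst h1; left; rw [arrive_mark_rev, hmk]
  rw [arrive_mark_of_ne h1, hσ r h1]
  rcases h r with h4 | ⟨k, r', m', h4, h5, h6⟩
  · exact Or.inl h4
  · rcases Agent.eq_or_eq hij k with rfl | rfl
    · rw [hi] at h4; cases h4; exact absurd h6 h1
    · exact Or.inr ⟨k, r', m', by rw [arrive_loc_other hij, h4], h5, h6⟩

/-- The agents are not in the same edge, having entered it by the same passage. -/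
theorem Regular.not_both_in (h : Regular G c σ i S j S') (hij : i ≠ j) {p : P} {m m' : RMark}
    (hi : c.loc i = .edge p 0 m) : c.loc j ≠ .edge p 0 m' := by
  intro hj
  have hij' := hij.symm
  rcases h.in_edge hi with ⟨h1, -⟩ | ⟨-, -, h1, h2⟩ | ⟨lo, hi, h1, -, h2, h3, -, h4, h5, h6⟩ <;>
  rcases h.symm.in_edge hj with ⟨g1, -⟩ | ⟨-, -, g1, g2⟩ |
    ⟨lo', hi', g1, -, g2, g3, -, g4, g5, g6⟩
  · exact (h.edge_ne (Or.inr (by rw [h1]; rfl : S.mode.Exc p)) (Or.inr (by rw [g1]; rfl))).1 rfl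
  · have := (h.left.exc p (by rw [h1]; rfl)).2
    rw [this] at g1; simp [RMark.Dead] at g1
  · have := (h.left.exc p (by rw [h1]; rfl)).2
    rw [this] at g4; simp at g4
  · have := (h.right.exc p (by rw [g1]; rfl)).2
    rw [this] at h1; simp [RMark.Dead] at h1
  · rcases h2 with ⟨h2, -⟩ | ⟨h0, h2, -⟩ <;> rcases g2 with ⟨g2, -⟩ | ⟨g0, g2, -⟩
    · rw [h2] at g2; simp at g2; exact hij g2
    · rw [h2] at g2; simp at g2
    · rw [h2] at g2; simp at g2
    · exact hij (h0.trans g0.symm)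
  · rw [g4] at h1; simp [RMark.Dead] at h1
  · have := (h.right.exc p (by rw [g1]; rfl)).2
    rw [this] at h4; simp at h4
  · rw [h4] at g1; simp [RMark.Dead] at g1
  · exact (h.edge_ne (Or.inl ⟨hi', g2, g3⟩) (Or.inl ⟨hi, h2, h3⟩)).1 rfl

theorem remark_same {p : P} {b : RMark} {r : P} (h : r ≠ G.rev p) :
    remark G σ p (σ p) b r = σ r := by
  by_cases h1 : r = p
  · subst h1; simp
  · exact remark_of_ne h1 h

theorem present_arrive {p : P} {m m' : RMark} {w : V} (h : Present G c w m')
    (hne : w = G.node (G.rev p) → c.mark (G.rev p) ≠ m') :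
    Present G (c.arrive G rendezvous i p m) w m' := by
  obtain ⟨r, h1, h2⟩ := h
  refine ⟨r, h1, ?_⟩
  rw [arrive_mark_of_ne, h2]
  rintro rfl; exact hne h1.symm h2

theorem Regular.right_arrive (h : Regular G c σ i S j S') (hij : i ≠ j) {p : P} {m : RMark}
    (hs : ∀ m', c.loc j ≠ .edge p 0 m') :
    Half G (c.arrive G rendezvous i p m) σ j S' i S := by
  refine h.right.frame (arrive_loc_other hij) (subset_arrive_visited _) (fun r m' hr _ => ?_)
    (fun _ _ => ⟨rfl, rfl⟩) (fun _ _ => Iff.rfl)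
    (fun lo hi hm => ⟨(h.right.chase lo hi hm).1.2.1, fun _ _ => rfl, fun _ _ => rfl⟩)
    fun a b hab => ⟨rfl, a, b, hab⟩
  refine ⟨arrive_mark_of_ne fun h1 => ?_, rfl⟩
  cases G.rev_injective h1
  exact hs m' hr

/-- An agent returns to the end of its trail. -/
theorem Regular.arrive_home (h : Regular G c σ i S j S') (hij : i ≠ j) {p : P} {m : RMark}
    (hi : c.loc i = .edge p 0 m) (hm : S.mode = .home)
    (hs : ∀ m', c.loc j ≠ .edge p 0 m') (hap : ∀ q, c.loc j ≠ .node (G.node (G.rev p)) q) :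
    Regular G (c.arrive G rendezvous i p m) σ i S j S' := by
  obtain ⟨hnode, hmk⟩ : G.node (G.rev p) = S.xn S.M ∧
      arrivalMark G rendezvous c i m (G.rev p) = σ (G.rev p) := by
    rcases h.left.home hm with ⟨q, h1⟩ | ⟨r, m, h1, h2, h3⟩
    · rw [hi] at h1; cases h1
    · rw [hi] at h1; cases h1
      refine ⟨h2, ?_⟩
      rcases h3 with ⟨rfl | rfl, -, h3⟩ | ⟨rfl, rfl, -, h3, -⟩
      · rw [h3, arrivalMark_markB]
      · rw [h3, arrivalMark_markF]
      · rw [h3]; exact arrivalMark_third .ariadne _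
  have hv : G.node (G.rev p) ∈ c.visited i := by rw [hnode]; exact h.left.vis _ le_rfl
  have hvis : ∀ k, (c.arrive G rendezvous i p m).visited k = c.visited k := by
    intro k
    rcases Agent.eq_or_eq hij k with rfl | rfl
    · rw [arrive_visited_self, Set.insert_eq_of_mem hv]
    · exact arrive_visited_other hij
  constructor
  · constructor
    · exact h.left.path
    · exact h.left.inj
    · rw [hvis]; exact h.left.vis
    · exact h.left.marks
    · exact h.left.exc
    · intro q hq; rw [hm] at hq; cases hq
    · intro q hq; rw [hm] at hq; cases hq
    · intro _; exact Or.inl ⟨some (G.rev p), by rw [arrive_loc_self, hnode]⟩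
    · intro a b hq; rw [hm] at hq; cases hq
  · exact h.right_arrive hij hs
  · exact h.disj
  · exact h.cls
  · exact agree_arrive h.agree hij hi (fun _ _ => rfl) hmk
  · simp only [hvis]; exact h.blankL
  · simp only [hvis]; exact h.blankR
  · simp only [hvis]; exact h.touched
  · simp only [hvis]
    intro hsr w h1 h2
    rcases h.shared hsr w h1 h2 with ⟨h3, ⟨q', h4⟩, h5⟩ | ⟨h3, ⟨q', h4⟩, h5⟩
    · rw [hi] at h4; cases h4
    · refine Or.inr ⟨h3, ⟨q', by rw [arrive_loc_other hij, h4]⟩, present_arrive h5 ?_⟩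
      rintro rfl; exact absurd h4 (hap q')

/-- An agent that follows the other one, or steps back, attains a node. -/
theorem Regular.arrive_chase (h : Regular G c σ i S j S') (hij : i ≠ j) {p : P} {m : RMark}
    (hi : c.loc i = .edge p 0 m) {lo hi' : ℕ} (hm : S.mode = .chase lo hi')
    (hs : ∀ m', c.loc j ≠ .edge p 0 m') :
    Regular G (c.arrive G rendezvous i p m) σ i S j S' := by
  obtain ⟨hbd, hloc⟩ := h.left.chase lo hi' hm
  obtain ⟨hnode, hmk, hor⟩ : G.node (G.rev p) = S'.xn hi' ∧
      arrivalMark G rendezvous c i m (G.rev p) = σ (G.rev p) ∧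
      (some (G.rev p) = some (G.rev (S'.x (hi' - 1))) ∨ ∀ n ≤ S.M, S.xn n ≠ S'.xn hi') := by
    rcases hloc with ⟨q, h1, -⟩ | ⟨h1, h2⟩ | ⟨rfl, -, h1, -, r, h2, h3, h4, h5⟩
    · rw [hi] at h1; cases h1
    · rw [hi] at h1; cases h1
      have h3 := h.right.path (hi' - 1) (by omega)
      have h4 := (h.right.marks (hi' - 1) (by omega)).1 (by rw [hm]; simp; omega)
      refine ⟨?_, ?_, Or.inl rfl⟩
      · rw [h3.2]; congr 1; omega
      · rw [h4.2, arrivalMark_markE hij]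
    · rw [hi] at h2; cases h2
      exact ⟨h3, by rw [h5]; exact arrivalMark_third .ariadne _, Or.inr h1⟩
  constructor
  · constructor
    · exact h.left.path
    · exact h.left.inj
    · exact fun n hn => subset_arrive_visited _ (h.left.vis n hn)
    · exact h.left.marks
    · exact h.left.exc
    · intro q hq; rw [hm] at hq; cases hq
    · intro q hq; rw [hm] at hq; cases hq
    · intro hq; rw [hm] at hq; cases hq
    · intro a b hq
      rw [hm] at hq; cases hq
      exact ⟨hbd, Or.inl ⟨_, by rw [arrive_loc_self, hnode], hor⟩⟩
  · exact h.right_arrive hij hs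
  · exact h.disj
  · exact h.cls
  · exact agree_arrive h.agree hij hi (fun _ _ => rfl) hmk
  all_goals exact fun hsr => absurd hm (hsr.1 lo hi')

/-- An agent that explores an edge attains a node that it knows. -/
theorem Regular.arrive_known (h : Regular G c σ i S j S') (hij : i ≠ j) {p : P}
    (hi : c.loc i = .edge p 0 .blank) (hm : S.mode = .out p)
    (hs : ∀ m', c.loc j ≠ .edge p 0 m') (hv : G.node (G.rev p) ∈ c.visited i) :
    Regular G (c.arrive G rendezvous i p .blank) (remark G σ p (σ p) i.markB) i
      { S with mode := .turn p } j S' := by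
  have hexc : S.mode.Exc p := by rw [hm]; rfl
  obtain ⟨hnode, hE⟩ := h.left.exc p hexc
  have hb := (h.left.out p hm).1
  have hcb : c.mark (G.rev p) = .blank := by rw [h.mark_eq hij] <;> simp [hb]
  have hvis : ∀ k, (c.arrive G rendezvous i p .blank).visited k = c.visited k := by
    intro k
    rcases Agent.eq_or_eq hij k with rfl | rfl
    · rw [arrive_visited_self, Set.insert_eq_of_mem hv]
    · exact arrive_visited_other hij
  have hsea : Searching { S with mode := .turn p } S' → Searching S S' := by
    rintro ⟨-, h2⟩; exact ⟨by simp [hm], h2⟩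
  have hblank : ∀ r, remark G σ p (σ p) i.markB r = .blank → σ r = .blank := by
    intro r hr
    by_cases h2 : r = G.rev p
    · rw [h2]; exact hb
    rwa [remark_same h2] at hr
  have hmk : arrivalMark G rendezvous c i .blank (G.rev p) = i.markB :=
    arrivalMark_blank_of_mem hv
  constructor
  · constructor
    · exact h.left.path
    · exact h.left.inj
    · rw [hvis]; exact h.left.vis
    · intro n hn
      have hne := h.left.stack_ne hn hexc
      obtain ⟨h1, h2⟩ := remark_pair (G := G) (σ := σ) (a := σ p) (b := i.markB) hne.1 hne.2
      rw [h1, h2]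
      exact h.left.marks n hn
    · rintro q rfl
      rw [remark_self]; exact ⟨hnode, hE⟩
    · simp
    · intro q hq; cases hq
      exact ⟨remark_rev, arrive_loc_self⟩
    · simp
    · simp
  · refine h.right.frame (arrive_loc_other hij) (subset_arrive_visited _) (fun r m' hr _ => ?_)
      (fun r hr => ?_) ?_ ?_ ?_
    · have : G.rev r ≠ G.rev p := fun h1 => by
        cases G.rev_injective h1; exact hs m' hr
      exact ⟨arrive_mark_of_ne this, remark_same this⟩
    · have := h.symm.edge_ne hr (Or.inr hexc)
      exact remark_pair this.1 this.2
    · simp [hm]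
    · intro lo hi h1
      exact ⟨(h.right.chase lo hi h1).1.2.1, by simp, by simp⟩
    · simp [hm]
  · intro n m hn hm'
    refine h.disj n m ?_ hm'
    rcases hn with hn | ⟨hn, -⟩
    · exact Or.inl hn
    · exact Or.inr ⟨hn, p, hexc⟩
  · refine fun r => (h.cls r).remark (Or.inr (Or.inr (Or.inl (Or.inl (Or.inr rfl)))))
      (fun q h1 _ hq => ?_) fun q _ _ hq => hq
    rcases hq with hq | hq
    · exact Or.inl hq
    · rw [hm] at hq; exact absurd hq.symm h1
  · exact agree_arrive h.agree hij hi (fun r hr => remark_same hr) (by rw [hmk, remark_rev])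
  · simp only [hvis]; exact fun hsr r hr => h.blankL (hsea hsr) r (hblank r hr)
  · simp only [hvis]; exact fun hsr r hr => h.blankR (hsea hsr) r (hblank r hr)
  · simp only [hvis]
    intro hsr r hr
    have hvp : G.node p ∈ c.visited i := by rw [hnode]; exact h.left.vis _ le_rfl
    by_cases h1 : r = p
    · subst h1; exact Or.inl ⟨hvp, Or.inl hv⟩
    by_cases h2 : r = G.rev p
    · subst h2; rw [G.rev_rev]; exact Or.inl ⟨hv, Or.inl hvp⟩
    rw [remark_same h2] at hr
    refine (h.touched (hsea hsr) r hr).imp (And.imp id (Or.imp id ?_)) id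
    rw [hm]; simp only [Mode.out.injEq]; exact fun h3 => absurd h3.symm h1
  · simp only [hvis]
    intro hsr w h1 h2
    rcases h.shared (hsea hsr) w h1 h2 with ⟨h3, -⟩ | ⟨h3, ⟨q', h4⟩, h5⟩
    · rw [hm] at h3; cases h3
    · exact Or.inr ⟨h3, ⟨q', by rw [arrive_loc_other hij, h4]⟩,
        present_arrive h5 (by simp [hcb])⟩

/-- The trail of an agent that has found a new node at the end of the edge of `p`. -/
noncomputable def Trail.push (G : WeightedGraph V P) (S : Trail V P) (p : P) : Trail V P where
  M := S.M + 1
  x n := if n = S.M then p else S.x n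
  xn n := if n = S.M + 1 then G.node (G.rev p) else S.xn n
  mode := .home

theorem Trail.push_x {n : ℕ} {p : P} (hn : n < S.M) : (S.push G p).x n = S.x n := by
  simp [Trail.push]; omega

theorem Trail.push_x_last {p : P} : (S.push G p).x S.M = p := by
  simp [Trail.push]

theorem Trail.push_xn {n : ℕ} {p : P} (hn : n ≤ S.M) : (S.push G p).xn n = S.xn n := by
  simp [Trail.push]; omega

theorem Trail.push_xn_last {p : P} : (S.push G p).xn (S.M + 1) = G.node (G.rev p) := by
  simp [Trail.push]

/-- An agent that explores an edge attains a node that is new to it. -/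
theorem Regular.arrive_new (h : Regular G c σ i S j S') (hij : i ≠ j) {p : P}
    (hi : c.loc i = .edge p 0 .blank) (hm : S.mode = .out p)
    (hs : ∀ m', c.loc j ≠ .edge p 0 m') (hap : ∀ q, c.loc j ≠ .node (G.node (G.rev p)) q)
    (hv : G.node (G.rev p) ∉ c.visited i) :
    Regular G (c.arrive G rendezvous i p .blank) (remark G σ p (σ p) i.markF) i
      (S.push G p) j S' := by
  have hexc : S.mode.Exc p := by rw [hm]; rfl
  obtain ⟨hnode, hE⟩ := h.left.exc p hexc
  have hb := (h.left.out p hm).1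
  have hcb : c.mark (G.rev p) = .blank := by rw [h.mark_eq hij] <;> simp [hb]
  have hsea : Searching (S.push G p) S' → Searching S S' := by
    rintro ⟨-, h2⟩; exact ⟨by simp [hm], h2⟩
  have hblank : ∀ r, remark G σ p (σ p) i.markF r = .blank → σ r = .blank := by
    intro r hr
    by_cases h2 : r = G.rev p
    · rw [h2]; exact hb
    rwa [remark_same h2] at hr
  have hmk : arrivalMark G rendezvous c i .blank (G.rev p) = i.markF :=
    arrivalMark_blank_of_notMem hv
  have hchS' : ∀ lo hi, S'.mode = .chase lo hi → hi ≤ S.M :=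
    fun lo hi h1 => (h.right.chase lo hi h1).1.2.1
  constructor
  · constructor
    · intro n hn
      change n < S.M + 1 at hn
      rcases Nat.lt_succ_iff_lt_or_eq.1 hn with hn | rfl
      · rw [Trail.push_x hn, Trail.push_xn hn.le, Trail.push_xn (by omega)]
        exact h.left.path n hn
      · rw [Trail.push_x_last, Trail.push_xn le_rfl, Trail.push_xn_last]
        exact ⟨hnode, rfl⟩
    · have key : ∀ n ≤ S.M, S.xn n ≠ G.node (G.rev p) :=
        fun n hn h1 => hv (h1 ▸ h.left.vis n hn)
      intro n hn m hm' hnm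
      change n ≤ S.M + 1 at hn
      change m ≤ S.M + 1 at hm'
      rcases Nat.le_succ_iff.1 hn with hn | rfl <;> rcases Nat.le_succ_iff.1 hm' with hm' | rfl
      · rw [Trail.push_xn hn, Trail.push_xn hm'] at hnm
        exact h.left.inj n hn m hm' hnm
      · rw [Trail.push_xn hn, Trail.push_xn_last] at hnm
        exact absurd hnm (key n hn)
      · rw [Trail.push_xn hm', Trail.push_xn_last] at hnm
        exact absurd hnm.symm (key m hm')
      · rfl
    · intro n hn
      change n ≤ S.M + 1 at hn
      rcases Nat.le_succ_iff.1 hn with hn | rfl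
      · rw [Trail.push_xn hn]; exact subset_arrive_visited _ (h.left.vis n hn)
      · rw [Trail.push_xn_last, arrive_visited_self]; exact Set.mem_insert _ _
    · intro n hn
      change n < S.M + 1 at hn
      rcases Nat.lt_succ_iff_lt_or_eq.1 hn with hn | rfl
      · have hne := h.left.stack_ne hn hexc
        obtain ⟨h1, h2⟩ := remark_pair (G := G) (σ := σ) (a := σ p) (b := i.markF) hne.1 hne.2
        rw [Trail.push_x hn, h1, h2]
        exact h.left.marks n hn
      · rw [Trail.push_x_last, remark_self, remark_rev]
        refine ⟨fun h1 => ?_, fun _ => ⟨hE, rfl⟩⟩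
        rcases hm' : S'.mode with _ | q | q | ⟨a, b⟩ <;> rw [hm'] at h1
        · exact h1.elim
        · exact h1.elim
        · exact h1.elim
        · have := hchS' a b hm'
          simp at h1; omega
    · intro q hq; exact hq.elim
    · intro q hq; cases hq
    · intro q hq; cases hq
    · intro _
      exact Or.inl ⟨_, by rw [arrive_loc_self]; congr 1; exact Trail.push_xn_last.symm⟩
    · intro a b hq; cases hq
  · refine h.right.frame (arrive_loc_other hij) (subset_arrive_visited _) (fun r m' hr _ => ?_)
      (fun r hr => ?_) ?_ ?_ ?_
    · have : G.rev r ≠ G.rev p := fun h1 => by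
        cases G.rev_injective h1; exact hs m' hr
      exact ⟨arrive_mark_of_ne this, remark_same this⟩
    · have := h.symm.edge_ne hr (Or.inr hexc)
      exact remark_pair this.1 this.2
    · simp [hm, Trail.push]
    · intro lo hi h1
      have h2 := hchS' lo hi h1
      exact ⟨show hi ≤ S.M + 1 by omega, fun n hn => Trail.push_xn (by omega),
        fun n hn => Trail.push_x (by omega)⟩
    · simp [hm]
  · intro n m hn hm'
    have hn' : n < S.M + 1 := by
      rcases hn with hn | ⟨-, _, hn⟩
      · exact hn
      · exact hn.elim
    rw [Trail.push_xn (by omega)]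
    refine h.disj n m ?_ hm'
    rcases Nat.lt_succ_iff_lt_or_eq.1 hn' with hn | hn
    · exact Or.inl hn
    · exact Or.inr ⟨hn, p, hexc⟩
  · refine fun r => (h.cls r).remark (Or.inr (Or.inr (Or.inl (Or.inl (Or.inl
      ⟨S.M, Nat.lt_succ_self _, Trail.push_x_last.symm⟩)))))
      (fun q h1 _ hq => ?_) fun q _ _ hq => hq
    rcases hq with ⟨n, hn, rfl⟩ | hq
    · exact Or.inl ⟨n, Nat.lt_succ_of_lt hn, (Trail.push_x hn).symm⟩
    · rw [hm] at hq; exact absurd hq.symm h1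
  · exact agree_arrive h.agree hij hi (fun r hr => remark_same hr) (by rw [hmk, remark_rev])
  · intro hsr r hr hw
    rw [arrive_visited_self] at hw
    rcases hw with hw | hw
    · exact ⟨S.M + 1, le_rfl, by rw [Trail.push_xn_last, hw]⟩
    · obtain ⟨n, hn, h1⟩ := h.blankL (hsea hsr) r (hblank r hr) hw
      exact ⟨n, Nat.le_succ_of_le hn, by rw [Trail.push_xn hn, h1]⟩
  · rw [arrive_visited_other hij]
    exact fun hsr r hr => h.blankR (hsea hsr) r (hblank r hr)
  · intro hsr r hr
    rw [arrive_visited_self, arrive_visited_other hij]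
    have hvp : G.node p ∈ c.visited i := by rw [hnode]; exact h.left.vis _ le_rfl
    by_cases h1 : r = p
    · subst h1; exact Or.inl ⟨Or.inr hvp, Or.inl (Or.inl rfl)⟩
    by_cases h2 : r = G.rev p
    · subst h2; rw [G.rev_rev]; exact Or.inl ⟨Or.inl rfl, Or.inl (Or.inr hvp)⟩
    rw [remark_same h2] at hr
    refine (h.touched (hsea hsr) r hr).imp (And.imp Or.inr ?_) id
    rintro (h3 | h3)
    · exact Or.inl (Or.inr h3)
    · rw [hm] at h3; cases h3; exact absurd rfl h1
  · intro hsr w h1 h2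
    rw [arrive_visited_self] at h1
    rw [arrive_visited_other hij] at h2
    rcases h1 with rfl | h1
    · refine Or.inl ⟨rfl, ⟨_, arrive_loc_self⟩, present_arrive ?_ (by simp [hcb])⟩
      -- The passage by which `i` arrives was still blank, so if `j` knows this node then it is
      -- still on the trail of `j`. Either `j` has left it under its marker $E$, or it is the last
      -- node of that trail.
      obtain ⟨n, hn, h3⟩ := h.blankR (hsea hsr) _ hb h2
      rw [← h3]
      by_cases hl : S'.Leaves n
      · exact h.present_of_leaves hij hl (by simp [hm])
      · obtain rfl : n = S'.M := by
          by_contra h4; exact hl (Or.inl (by omega))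
        rcases hm' : S'.mode with _ | q | q | ⟨a, b⟩
        -- At the last node of its trail, `j` is either present, which would be a meeting, or on its
        -- way back; in the latter case the passage by which it will arrive still carries its $E$.
        · rcases h.right.home hm' with ⟨q, h4⟩ | ⟨r, m, h4, h5, h6⟩
          · rw [h3] at h4; exact absurd h4 (hap q)
          · rcases h6 with ⟨-, h6, -⟩ | ⟨-, -, -, -, a, b, h6⟩
            · exact ⟨_, h5, h6⟩
            · rw [hm] at h6; cases h6
        · exact absurd (Or.inr ⟨rfl, q, by rw [hm']; rfl⟩) hl
        · exact absurd (Or.inr ⟨rfl, q, by rw [hm']; rfl⟩) hl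
        · exact absurd hm' (hsr.2 a b)
    · rcases h.shared (hsea hsr) w h1 h2 with ⟨h3, -⟩ | ⟨h3, ⟨q', h4⟩, h5⟩
      · rw [hm] at h3; cases h3
      · exact Or.inr ⟨h3, ⟨q', by rw [arrive_loc_other hij, h4]⟩,
          present_arrive h5 (by simp [hcb])⟩

end

/-! ### Doomed configurations, and how they arise -/

section

variable {V P : Type*} {G : WeightedGraph V P} {c c' : Config V P RMark} {i j : Agent}
  {σ σ' : P → RMark} {S S' S'' : Trail V P} {y : ℕ → P} {yn : ℕ → V} {d a K : ℕ}

/-- At the node number `n` of the trail `y`, agents that move on this trail have no choice. -/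
structure Clean (G : WeightedGraph V P) (σ : P → RMark) (y : ℕ → P) (yn : ℕ → V) (d a n : ℕ) :
    Prop where
  notEA : ∀ p, G.node p = yn n → σ p ≠ .EA
  eqEAT : ∀ p, G.node p = yn n → σ p = .EAT → p = y n ∧ n < a
  eqFAT : ∀ p, G.node p = yn n → σ p = .FAT → p = G.rev (y (n - 1)) ∧ d < n

/-- The configurations in which Theseus, at the node number `d` of his own old trail, is behind
Ariadne, who is at the node number `a` of this trail with `K` edges. -/
structure Doomed (G : WeightedGraph V P) (c : Config V P RMark) (σ : P → RMark) (y : ℕ → P)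
    (yn : ℕ → V) (d a K : ℕ) : Prop where
  pos : 0 < d
  le : d ≤ a
  le' : a ≤ K
  path : ∀ n < K, G.node (y n) = yn n ∧ G.node (G.rev (y n)) = yn (n + 1)
  inj : ∀ n ≤ K, ∀ m ≤ K, yn n = yn m → n = m
  used : ∀ n, d ≤ n → n < a → σ (y n) = .EAT ∧ σ (G.rev (y n)) = .FAT
  unused : ∀ n, a ≤ n → n < K → σ (y n) = .ET ∧ σ (G.rev (y n)) = .FT
  noB : ∀ p k, σ p ≠ Agent.markB k
  eqET : ∀ p n, d ≤ n → n ≤ K → G.node p = yn n → σ p = .ET → p = y n ∧ a ≤ n ∧ n < K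
  clean : ∀ n, d ≤ n → n < K → Clean G σ y yn d a n
  theseus : (∃ q, c.loc .theseus = .node (yn d) q) ∨
    (c.loc .theseus = .edge (y (d - 1)) 0 .EAT ∧ c.mark (G.rev (y (d - 1))) = .FAT ∧
      σ (G.rev (y (d - 1))) = .FATT)
  ariadne : (∃ q, c.loc .ariadne = .node (yn a) q ∧
      (q = some (G.rev (y (a - 1))) ∨ Clean G σ y yn d a a)) ∨
    (d < a ∧ c.loc .ariadne = .edge (y (a - 1)) 0 .ET ∧ c.mark (G.rev (y (a - 1))) = .FT) ∨
    (∃ r, c.loc .ariadne = .edge r 0 .FAT ∧ G.node (G.rev r) = yn a ∧ a = K ∧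
      c.mark (G.rev r) = .EAT ∧ σ (G.rev r) = .D2 ∧ Clean G σ y yn d a a)
  agree : ∀ p, c.mark p = σ p ∨ ∃ k r m, c.loc k = .edge r 0 m ∧ m ≠ .blank ∧ p = G.rev r

/-- A $B$ belongs to an excursion whose agent has just found a known node, and followers have none;
the edges on the stacks carry $E$- and $F$-markers only. -/
theorem Regular.no_turn (h : Regular G c σ i S j S') {a b a' b' : ℕ}
    (hm : S.mode = .chase a b) (hm' : S'.mode = .chase a' b') (p : P) (k : Agent) :
    σ p ≠ k.markB := by
  intro hp
  have key : ∀ {i j : Agent} {S S' : Trail V P} {a b : ℕ} (h : Half G c σ i S j S')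
      (_ : S.mode = .chase a b), ¬ (S.Edge p ∨ S.Edge (G.rev p)) := by
    rintro i j S S' a b h hm ((⟨n, hn, h1⟩ | h1) | (⟨n, hn, h1⟩ | h1))
    · have := h.edge_markers (Or.inl ⟨n, hn, h1⟩)
      rw [hp] at this; simp at this
    · rw [hm] at h1; exact h1
    · have h2 := h.marks n hn
      rw [← h1, G.rev_rev, hp] at h2
      by_cases h3 : S'.mode.Chased n <;> simp [h3] at h2
    · rw [hm] at h1; exact h1
  rcases h.cls p with h1 | h1 | h1 | h1
  · rw [hp] at h1; simp at h1
  · rw [hp] at h1; simp [RMark.Dead] at h1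
  · exact key h.left hm h1
  · exact key h.right hm' h1

/-- What the marker of a passage says about its place on the trails, if both agents follow the
trail of the other. -/
theorem Regular.sort_chase (h : Regular G c σ i S j S') {a b a' b' : ℕ}
    (hm : S.mode = .chase a b) (hm' : S'.mode = .chase a' b') (p : P) :
    σ p = .blank ∨ (σ p).Dead ∨
    (∃ n < S.M, p = S.x n ∧ ((σ p = .EAT ∧ S'.mode.Chased n) ∨
      (σ p = i.markE ∧ ¬ S'.mode.Chased n))) ∨
    (∃ n < S.M, p = G.rev (S.x n) ∧ ((σ p = .FAT ∧ S'.mode.Chased n) ∨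
      (σ p = i.markF ∧ ¬ S'.mode.Chased n))) ∨
    (∃ n < S'.M, p = S'.x n ∧ ((σ p = .EAT ∧ S.mode.Chased n) ∨
      (σ p = j.markE ∧ ¬ S.mode.Chased n))) ∨
    (∃ n < S'.M, p = G.rev (S'.x n) ∧ ((σ p = .FAT ∧ S.mode.Chased n) ∨
      (σ p = j.markF ∧ ¬ S.mode.Chased n))) := by
  rcases h.cls p with h1 | h1 | (h1 | h1) | (h1 | h1)
  · exact Or.inl h1.1
  · exact Or.inr (Or.inl h1.1)
  · rcases h1 with ⟨n, hn, rfl⟩ | h1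
    · refine Or.inr (Or.inr (Or.inl ⟨n, hn, rfl, ?_⟩))
      have := h.left.marks n hn; tauto
    · rw [hm] at h1; exact h1.elim
  · rcases h1 with ⟨n, hn, h1⟩ | h1
    · rw [← G.eq_rev_iff] at h1; subst h1
      refine Or.inr (Or.inr (Or.inr (Or.inl ⟨n, hn, rfl, ?_⟩)))
      have := h.left.marks n hn; tauto
    · rw [hm] at h1; exact h1.elim
  · rcases h1 with ⟨n, hn, rfl⟩ | h1
    · refine Or.inr (Or.inr (Or.inr (Or.inr (Or.inl ⟨n, hn, rfl, ?_⟩))))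
      have := h.right.marks n hn; tauto
    · rw [hm'] at h1; exact h1.elim
  · rcases h1 with ⟨n, hn, h1⟩ | h1
    · rw [← G.eq_rev_iff] at h1; subst h1
      refine Or.inr (Or.inr (Or.inr (Or.inr (Or.inr ⟨n, hn, rfl, ?_⟩))))
      have := h.right.marks n hn; tauto
    · rw [hm'] at h1; exact h1.elim

/-- Theseus, at the end of Ariadne's trail, sees that she is ahead on his own trail. -/
theorem Regular.doom (h : Regular G c σ .theseus S .ariadne S') {lo lo' hi' : ℕ}
    (hm : S.mode = .chase lo S'.M) (hm' : S'.mode = .chase lo' hi') {u : V} {q : Option P}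
    (hi : c.loc .theseus = .node u q)
    (ho : ∀ m, c.loc .ariadne ≠ .edge (G.rev (S.x lo')) 0 m)
    (hs : ∀ m, c.loc .ariadne ≠ .edge (S.x lo') 0 m) :
    Doomed G (c.depart .theseus (S.x lo') Agent.theseus.thirdLine)
      (remark G σ (S.x lo') .EATT .FATT) S.x S.xn (lo' + 1) hi' S.M := by
  have hij : Agent.theseus ≠ Agent.ariadne := by simp
  obtain ⟨⟨hlt, hle, hend⟩, hloc⟩ := h.right.chase lo' hi' hm'
  replace hend := hend rfl
  have hlo : lo' < S.M := by omega
  have hch : ∀ n, S'.mode.Chased n ↔ lo' ≤ n ∧ n < hi' := by intro n; rw [hm']; rfl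
  have hmk := (h.left.marks lo' hlo).1 (by rw [hch]; omega)
  have hpath := h.left.path lo' hlo
  have hla := depart_loc_other (c := c) hij (p := S.x lo') (l := Agent.theseus.thirdLine)
  have hneL : ∀ n < S.M, n ≠ lo' → remark G σ (S.x lo') .EATT .FATT (S.x n) = σ (S.x n) ∧
      remark G σ (S.x lo') .EATT .FATT (G.rev (S.x n)) = σ (G.rev (S.x n)) := by
    intro n hn hne
    have := h.left.stack_inj hn hlo
    exact remark_pair (fun h1 => hne (this.1 h1)) this.2
  have hval : ∀ p m, remark G σ (S.x lo') .EATT .FATT p = m → m ≠ .EATT → m ≠ .FATT →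
      σ p = m ∧ p ≠ S.x lo' ∧ p ≠ G.rev (S.x lo') := by
    intro p m h1 h2 h3
    by_cases h4 : p = S.x lo'
    · subst h4; rw [remark_self] at h1; exact absurd h1.symm h2
    by_cases h5 : p = G.rev (S.x lo')
    · subst h5; rw [remark_rev] at h1; exact absurd h1.symm h3
    rw [remark_of_ne h4 h5] at h1
    exact ⟨h1, h4, h5⟩
  -- The trails share no node that both agents have left, and the last node of Ariadne's trail is
  -- number `lo'` of this one. Hence what lies beyond `lo'` is off her trail.
  have hoff : ∀ n, lo' < n → n < S.M → ∀ m ≤ S'.M, S'.xn m ≠ S.xn n := by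
    intro n h1 h2 m h3 h4
    rcases lt_or_eq_of_le h3 with h3 | rfl
    · exact h.disj n m (Or.inl h2) (Or.inl h3) h4.symm
    · rw [hend] at h4
      have := h.left.inj lo' hlo.le n h2.le h4
      omega
  -- Off Ariadne's trail, the markers $E_{AT}$ and $F_{AT}$ can come only from edges of the old
  -- trail of Theseus, and its nodes are distinct; so at most one passage carries each of them.
  have hclean : ∀ n, lo' < n → n ≤ S.M → (∀ m ≤ S'.M, S'.xn m ≠ S.xn n) →
      Clean G (remark G σ (S.x lo') .EATT .FATT) S.x S.xn (lo' + 1) hi' n := by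
    intro n h1 h2 hoff
    constructor
    · intro p hp hE
      obtain ⟨hE, -, -⟩ := hval p _ hE (by simp) (by simp)
      rcases h.sort_chase hm hm' p with h3 | h3 | ⟨k, h3, rfl, h4⟩ | ⟨k, h3, rfl, h4⟩ |
        ⟨k, h3, rfl, h4⟩ | ⟨k, h3, rfl, h4⟩
      · simp [hE] at h3
      · simp [hE, RMark.Dead] at h3
      · rw [hE] at h4; simp [Agent.markE] at h4
      · rw [hE] at h4; simp [Agent.markF] at h4
      · rw [(h.right.path k h3).1] at hp
        exact hoff k h3.le hp
      · rw [hE] at h4; simp [Agent.markF] at h4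
    · intro p hp hE
      obtain ⟨hE, h6, -⟩ := hval p _ hE (by simp) (by simp)
      rcases h.sort_chase hm hm' p with h3 | h3 | ⟨k, h3, rfl, h4⟩ | ⟨k, h3, rfl, h4⟩ |
        ⟨k, h3, rfl, h4⟩ | ⟨k, h3, rfl, h4⟩
      · simp [hE] at h3
      · simp [hE, RMark.Dead] at h3
      · rw [(h.left.path k h3).1] at hp
        obtain rfl := h.left.inj k h3.le n h2 hp
        rw [hch] at h4
        rw [hE] at h4; simp at h4
        exact ⟨rfl, h4.2⟩
      · rw [hE] at h4; simp at h4
      · rw [(h.right.path k h3).1] at hp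
        exact absurd hp (hoff k h3.le)
      · rw [hE] at h4; simp at h4
    · intro p hp hE
      obtain ⟨hE, -, h6⟩ := hval p _ hE (by simp) (by simp)
      rcases h.sort_chase hm hm' p with h3 | h3 | ⟨k, h3, rfl, h4⟩ | ⟨k, h3, rfl, h4⟩ |
        ⟨k, h3, rfl, h4⟩ | ⟨k, h3, rfl, h4⟩
      · simp [hE] at h3
      · simp [hE, RMark.Dead] at h3
      · rw [hE] at h4; simp at h4
      · rw [(h.left.path k h3).2] at hp
        obtain rfl := h.left.inj (k + 1) (by omega) n h2 hp
        rw [hch] at h4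
        rw [hE] at h4; simp at h4
        refine ⟨rfl, ?_⟩
        have : k ≠ lo' := by rintro rfl; exact h6 rfl
        omega
      · rw [hE] at h4; simp at h4
      · rw [(h.right.path k h3).2] at hp
        exact absurd hp (hoff (k + 1) h3)
  constructor
  · omega
  · omega
  · exact hle
  · exact h.left.path
  · exact h.left.inj
  · intro n h1 h2
    obtain ⟨h3, h4⟩ := hneL n (by omega) (by omega)
    rw [h3, h4]
    exact (h.left.marks n (by omega)).1 (by rw [hch]; omega)
  · intro n h1 h2
    obtain ⟨h3, h4⟩ := hneL n (by omega) (by omega)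
    rw [h3, h4]
    exact (h.left.marks n (by omega)).2 (by rw [hch]; omega)
  · intro p k hB
    obtain ⟨h1, -, -⟩ := hval p _ hB (by simp) (by simp)
    exact h.no_turn hm hm' p k h1
  · intro p n h1 h2 hp hE
    obtain ⟨hE, -, -⟩ := hval p _ hE (by simp) (by simp)
    rcases h.sort_chase hm hm' p with h3 | h3 | ⟨k, h3, rfl, h4⟩ | ⟨k, h3, rfl, h4⟩ |
        ⟨k, h3, rfl, h4⟩ | ⟨k, h3, rfl, h4⟩
    · simp [hE] at h3
    · simp [hE, RMark.Dead] at h3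
    · rw [(h.left.path k h3).1] at hp
      obtain rfl := h.left.inj k h3.le n h2 hp
      rw [hch] at h4
      rw [hE] at h4; simp at h4
      exact ⟨rfl, by omega, h3⟩
    · rw [hE] at h4; simp [Agent.markF] at h4
    · rw [hE] at h4; simp [Agent.markE] at h4
    · rw [hE] at h4; simp [Agent.markF] at h4
  · exact fun n h1 h2 => hclean n h1 h2.le (hoff n h1 h2)
  · refine Or.inr ⟨depart_loc_self, ?_, ?_⟩
    · rw [Nat.add_sub_cancel, depart_mark_of_ne (G.rev_ne _),
        h.mark_eq_of_node hij hi (by rw [G.rev_rev]; exact hs), hmk.2]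
    · rw [Nat.add_sub_cancel, remark_rev]
  · rw [hla]
    rcases hloc with ⟨q', h1, h2⟩ | ⟨h1, h2⟩ | ⟨-, h2, h3, -, r, h4, h5, h6, h7⟩
    · exact Or.inl ⟨q', h1, h2.imp id fun h2 => hclean hi' hlt hle h2⟩
    · refine Or.inr (Or.inl ⟨?_, h1, ?_⟩)
      -- Ariadne is not in the edge that Theseus enters (`hs`), so she is at least one edge further
      -- on.
      · have : hi' - 1 ≠ lo' := by rintro h3; rw [h3] at h1; exact hs _ h1
        omega
      · rw [(remark_target (σ := σ) (a := .EATT) (b := .FATT) ho hs h1).1, h2]; rfl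
    · refine Or.inr (Or.inr ⟨r, h4, h5, h2, ?_, ?_, hclean hi' hlt hle h3⟩)
      · rw [(remark_target (σ := σ) (a := .EATT) (b := .FATT) ho hs h4).1, h6]
      · rw [(remark_target (i := .theseus) (l := Agent.theseus.thirdLine) (σ := σ) ho hs h4).2, h7]
  · exact agree_depart h.agree hij hi rfl (Or.inl (by simp [Agent.thirdLine]))

/-! #### Moves in doomed configurations -/

theorem Doomed.edge_inj (h : Doomed G c σ y yn d a K) {n m : ℕ} (hn : d ≤ n) (hn' : n < K)
    (hm : d ≤ m) (hm' : m < K) : (y n = y m → n = m) ∧ y n ≠ G.rev (y m) := by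
  constructor
  · intro h1
    refine h.inj n hn'.le m hm'.le ?_
    rw [← (h.path n hn').1, h1, (h.path m hm').1]
  · intro h1
    have h2 : σ (y n) = .EAT ∨ σ (y n) = .ET := by
      rcases lt_or_ge n a with h2 | h2
      · exact Or.inl (h.used n hn h2).1
      · exact Or.inr (h.unused n h2 hn').1
    have h3 : σ (G.rev (y m)) = .FAT ∨ σ (G.rev (y m)) = .FT := by
      rcases lt_or_ge m a with h2 | h2
      · exact Or.inl (h.used m hm h2).2
      · exact Or.inr (h.unused m h2 hm').2
    rw [h1] at h2
    rcases h2 with h2 | h2 <;> rw [h2] at h3 <;> simp at h3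

theorem Doomed.remark_edge (h : Doomed G c σ y yn d a K) {n m : ℕ} (hn : d ≤ n) (hn' : n < K)
    (hm : d ≤ m) (hm' : m < K) (hne : n ≠ m) {b b' : RMark} :
    remark G σ (y m) b b' (y n) = σ (y n) ∧
      remark G σ (y m) b b' (G.rev (y n)) = σ (G.rev (y n)) := by
  have := h.edge_inj hn hn' hm hm'
  exact remark_pair (fun h1 => hne (this.1 h1)) this.2

/-- Unless the agents meet, Ariadne is ahead. -/
theorem Doomed.ahead (h : Doomed G c σ y yn d a K)
    (hap : ∀ v q q', c.loc .ariadne = .node v q → c.loc .theseus ≠ .node v q') :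
    d < a ∨ d = a ∧ ((∃ q, c.loc .ariadne = .node (yn a) q ∧
        c.loc .theseus = .edge (y (a - 1)) 0 .EAT ∧ c.mark (G.rev (y (a - 1))) = .FAT) ∨
      (a = K ∧ Clean G σ y yn d a a ∧ ∃ r m, c.loc .ariadne = .edge r 0 m ∧
        G.node (G.rev r) = yn a ∧ c.mark (G.rev r) = .EAT)) := by
  rcases lt_or_eq_of_le h.le with h1 | rfl
  · exact Or.inl h1
  refine Or.inr ⟨rfl, ?_⟩
  rcases h.ariadne with ⟨q, h1, h2⟩ | ⟨h1, -⟩ | ⟨r, h1, h2, h3, h4, -, h5⟩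
  · left
    rcases h.theseus with ⟨q', h3⟩ | ⟨h3, h4, -⟩
    · exact absurd h3 (hap _ _ _ h1)
    · exact ⟨q, h1, h3, h4⟩
  · exact absurd h1 (lt_irrefl _)
  · exact Or.inr ⟨h3, h5, r, _, h1, h2, h4⟩

theorem Doomed.mark_eq_of_node (h : Doomed G c σ y yn d a K) (hij : i ≠ j) {u : V} {q : Option P}
    (hi : c.loc i = .node u q) {p : P} (hp : ∀ m, c.loc j ≠ .edge (G.rev p) 0 m) :
    c.mark p = σ p := by
  rcases h.agree p with h4 | ⟨k, r, m, h4, h5, rfl⟩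
  · exact h4
  · rcases Agent.eq_or_eq hij k with rfl | rfl
    · rw [hi] at h4; cases h4
    · rw [G.rev_rev] at hp; exact absurd h4 (hp m)

theorem Doomed.mark_eq (h : Doomed G c σ y yn d a K) {p : P} (hp : σ p = .EAT ∨ σ p = .ET) :
    c.mark p = σ p := by
  rcases h.agree p with h4 | ⟨k, r, m, h4, h5, rfl⟩
  · exact h4
  exfalso
  cases k
  · rcases h.ariadne with ⟨q, h1, -⟩ | ⟨h0, h1, -⟩ | ⟨r, h1, -, -, -, h2, -⟩
    · rw [h1] at h4; cases h4
    · rw [h1] at h4; cases h4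
      have h3 := h.le'
      have := (h.used (a - 1) (by omega) (by omega)).2
      rw [this] at hp; simp at hp
    · rw [h1] at h4; cases h4
      rw [h2] at hp; simp at hp
  · rcases h.theseus with ⟨q, h1⟩ | ⟨h1, -, h2⟩
    · rw [h1] at h4; cases h4
    · rw [h1] at h4; cases h4
      rw [h2] at hp; simp at hp

/-- If Ariadne is strictly ahead, the marker is that of edge number `d`, which she has used. If she
is stepping back to this very node, it is still at the passage by which she will arrive. -/
theorem Doomed.present_theseus (h : Doomed G c σ y yn d a K)
    (hap : ∀ v q q', c.loc .ariadne = .node v q → c.loc .theseus ≠ .node v q') {u : V}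
    {q : Option P} (hi : c.loc .theseus = .node u q) :
    u = yn d ∧ Clean G σ y yn d a d ∧ Present G c u .EAT := by
  have hu : u = yn d := by
    rcases h.theseus with ⟨q', h1⟩ | ⟨h1, -⟩
    · rw [hi] at h1; cases h1; rfl
    · rw [hi] at h1; cases h1
  subst hu
  refine ⟨rfl, ?_⟩
  have hle := h.le'
  rcases h.ahead hap with h1 | ⟨rfl, ⟨q', -, h1, -⟩ | ⟨h1, h2, r, m, -, h3, h4⟩⟩
  · refine ⟨h.clean d le_rfl (by omega), y d, (h.path d (by omega)).1, ?_⟩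
    have := (h.used d le_rfl h1).1
    rw [h.mark_eq (Or.inl this), this]
  · rw [hi] at h1; cases h1
  · exact ⟨h2, G.rev r, h3, h4⟩

theorem Doomed.loc_ariadne (h : Doomed G c σ y yn d a K) {u : V} {q : Option P}
    (hi : c.loc .ariadne = .node u q) :
    u = yn a ∧ (q = some (G.rev (y (a - 1))) ∨ Clean G σ y yn d a a) := by
  rcases h.ariadne with ⟨q', h1, h2⟩ | ⟨-, h1, -⟩ | ⟨r, h1, -⟩
  · rw [hi] at h1; cases h1; exact ⟨rfl, h2⟩
  · rw [hi] at h1; cases h1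
  · rw [hi] at h1; cases h1

/-- This is the passage by which she can retreat. Even if Theseus is in the edge behind her, he
overwrites its marker only on arrival. -/
theorem Doomed.mark_behind (h : Doomed G c σ y yn d a K)
    (hap : ∀ v q q', c.loc .ariadne = .node v q → c.loc .theseus ≠ .node v q') {u : V}
    {q : Option P} (hi : c.loc .ariadne = .node u q) :
    c.mark (G.rev (y (a - 1))) = .FAT := by
  have hle := h.le'
  rcases h.ahead hap with h1 | ⟨rfl, ⟨q', -, -, h1⟩ | ⟨-, -, r, m, h1, -⟩⟩
  · have h2 := (h.used (a - 1) (by omega) (by omega)).2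
    rcases h.agree (G.rev (y (a - 1))) with h3 | ⟨k, r, m, h3, -, h4⟩
    · rw [h3, h2]
    · cases k
      · rw [hi] at h3; cases h3
      · rcases h.theseus with ⟨q', h5⟩ | ⟨h5, -, h6⟩
        · rw [h3] at h5; cases h5
        · rw [h3] at h5; cases h5
          rw [← h4, h2] at h6; cases h6
  · exact h1
  · rw [hi] at h1; cases h1

theorem Doomed.present_ariadne (h : Doomed G c σ y yn d a K)
    (hap : ∀ v q q', c.loc .ariadne = .node v q → c.loc .theseus ≠ .node v q') {u : V}
    {q : Option P} (hi : c.loc .ariadne = .node u q) :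
    (a < K ∧ Present G c u .ET) ∨ (a = K ∧ Present G c u .FAT) := by
  obtain ⟨rfl, -⟩ := h.loc_ariadne hi
  have hle := h.le
  have hpos := h.pos
  rcases lt_or_eq_of_le h.le' with h1 | h1
  · refine Or.inl ⟨h1, y a, (h.path a h1).1, ?_⟩
    have := (h.unused a le_rfl h1).1
    rw [h.mark_eq (Or.inr this), this]
  · refine Or.inr ⟨h1, G.rev (y (a - 1)), ?_, h.mark_behind hap hi⟩
    rw [(h.path (a - 1) (by omega)).2]
    congr 1; omega

/-- Theseus follows Ariadne. -/
theorem Doomed.depart_theseus (h : Doomed G c σ y yn d a K) {q : Option P}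
    (hi : c.loc .theseus = .node (yn d) q) (hd : d < a)
    (ho : ∀ m, c.loc .ariadne ≠ .edge (G.rev (y d)) 0 m)
    (hs : ∀ m, c.loc .ariadne ≠ .edge (y d) 0 m) :
    Doomed G (c.depart .theseus (y d) Agent.theseus.thirdLine)
      (remark G σ (y d) .EATT .FATT) y yn (d + 1) a K := by
  have hij : Agent.theseus ≠ Agent.ariadne := by simp
  have hle := h.le'
  have hmk := h.used d le_rfl hd
  have hla := depart_loc_other (c := c) hij (p := y d) (l := Agent.theseus.thirdLine)
  have hval : ∀ p m, remark G σ (y d) .EATT .FATT p = m → m ≠ .EATT → m ≠ .FATT →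
      σ p = m ∧ p ≠ G.rev (y d) := by
    intro p m h1 h2 h3
    by_cases h4 : p = y d
    · subst h4; rw [remark_self] at h1; exact absurd h1.symm h2
    by_cases h5 : p = G.rev (y d)
    · subst h5; rw [remark_rev] at h1; exact absurd h1.symm h3
    rw [remark_of_ne h4 h5] at h1
    exact ⟨h1, h5⟩
  have hclean : ∀ n, Clean G σ y yn d a n →
      Clean G (remark G σ (y d) .EATT .FATT) y yn (d + 1) a n := by
    intro n hn
    constructor
    · exact fun p hp h1 => hn.notEA p hp (hval p _ h1 (by simp) (by simp)).1
    · exact fun p hp h1 => hn.eqEAT p hp (hval p _ h1 (by simp) (by simp)).1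
    · intro p hp h1
      obtain ⟨h2, h3⟩ := hval p _ h1 (by simp) (by simp)
      obtain ⟨rfl, h5⟩ := hn.eqFAT p hp h2
      refine ⟨rfl, ?_⟩
      have : n - 1 ≠ d := by rintro rfl; exact h3 rfl
      omega
  constructor
  · omega
  · omega
  · exact hle
  · exact h.path
  · exact h.inj
  · intro n h1 h2
    obtain ⟨h3, h4⟩ := h.remark_edge (n := n) (m := d) (b := .EATT) (b' := .FATT) (by omega)
      (by omega) le_rfl (by omega) (by omega)
    rw [h3, h4]
    exact h.used n (by omega) h2
  · intro n h1 h2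
    obtain ⟨h3, h4⟩ := h.remark_edge (n := n) (m := d) (b := .EATT) (b' := .FATT) (by omega)
      (by omega) le_rfl (by omega) (by omega)
    rw [h3, h4]
    exact h.unused n h1 h2
  · exact fun p k hB => h.noB p k (hval p _ hB (by simp) (by simp)).1
  · exact fun p n h1 h2 hp hE =>
      h.eqET p n (by omega) h2 hp (hval p _ hE (by simp) (by simp)).1
  · exact fun n h1 h2 => hclean n (h.clean n (by omega) h2)
  · refine Or.inr ⟨depart_loc_self, ?_, ?_⟩
    · rw [Nat.add_sub_cancel, depart_mark_of_ne (G.rev_ne _),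
        h.mark_eq_of_node hij hi (by rw [G.rev_rev]; exact hs), hmk.2]
    · rw [Nat.add_sub_cancel, remark_rev]
  · rw [hla]
    rcases h.ariadne with ⟨q', h1, h2⟩ | ⟨h0, h1, h2⟩ | ⟨r, h4, h5, h2, h6, h7, h3⟩
    · exact Or.inl ⟨q', h1, h2.imp id (hclean a)⟩
    · refine Or.inr (Or.inl ⟨?_, h1, ?_⟩)
      · have : a - 1 ≠ d := by rintro h3; rw [h3] at h1; exact hs _ h1
        omega
      · rw [(remark_target (σ := σ) (a := .EATT) (b := .FATT) ho hs h1).1, h2]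
    · refine Or.inr (Or.inr ⟨r, h4, h5, h2, ?_, ?_, hclean a h3⟩)
      · rw [(remark_target (σ := σ) (a := .EATT) (b := .FATT) ho hs h4).1, h6]
      · rw [(remark_target (i := .theseus) (l := Agent.theseus.thirdLine) (σ := σ) ho hs h4).2, h7]
  · exact agree_depart h.agree hij hi rfl (Or.inl (by simp [Agent.thirdLine]))

/-- Ariadne follows the rest of the trail of Theseus. -/
theorem Doomed.depart_ariadne (h : Doomed G c σ y yn d a K) {q : Option P}
    (hi : c.loc .ariadne = .node (yn a) q) (ha : a < K) :
    Doomed G (c.depart .ariadne (y a) ⟨.ET, .EAT, .any, .FAT⟩)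
      (remark G σ (y a) .EAT .FAT) y yn d (a + 1) K := by
  have hij : Agent.ariadne ≠ Agent.theseus := by simp
  have hle := h.le
  have hpos := h.pos
  have hmk := h.unused a le_rfl ha
  have hpath := h.path a ha
  have hla := depart_loc_other (c := c) hij (p := y a) (l := ⟨.ET, .EAT, .any, .FAT⟩)
  have hclean : ∀ n ≤ K, Clean G σ y yn d a n →
      Clean G (remark G σ (y a) .EAT .FAT) y yn d (a + 1) n := by
    intro n hnK hn
    constructor
    · intro p hp h1
      by_cases h4 : p = y a
      · subst h4; rw [remark_self] at h1; cases h1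
      by_cases h5 : p = G.rev (y a)
      · subst h5; rw [remark_rev] at h1; cases h1
      rw [remark_of_ne h4 h5] at h1
      exact hn.notEA p hp h1
    · intro p hp h1
      by_cases h4 : p = y a
      · subst h4
        obtain rfl := h.inj a ha.le n hnK (hpath.1.symm.trans hp)
        exact ⟨rfl, Nat.lt_succ_self _⟩
      by_cases h5 : p = G.rev (y a)
      · subst h5; rw [remark_rev] at h1; cases h1
      rw [remark_of_ne h4 h5] at h1
      obtain ⟨h6, h7⟩ := hn.eqEAT p hp h1
      exact ⟨h6, by omega⟩
    · intro p hp h1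
      by_cases h4 : p = y a
      · subst h4; rw [remark_self] at h1; cases h1
      by_cases h5 : p = G.rev (y a)
      · subst h5
        obtain rfl := h.inj (a + 1) ha n hnK (hpath.2.symm.trans hp)
        exact ⟨rfl, by omega⟩
      rw [remark_of_ne h4 h5] at h1
      exact hn.eqFAT p hp h1
  constructor
  · omega
  · omega
  · omega
  · exact h.path
  · exact h.inj
  · intro n h1 h2
    by_cases h5 : n = a
    · subst h5; exact ⟨remark_self, remark_rev⟩
    obtain ⟨h3, h4⟩ := h.remark_edge (n := n) (m := a) (b := .EAT) (b' := .FAT) (by omega)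
      (by omega) hle ha h5
    rw [h3, h4]
    exact h.used n (by omega) (by omega)
  · intro n h1 h2
    obtain ⟨h3, h4⟩ := h.remark_edge (n := n) (m := a) (b := .EAT) (b' := .FAT) (by omega)
      (by omega) hle ha (by omega)
    rw [h3, h4]
    exact h.unused n (by omega) h2
  · intro p k hB
    by_cases h4 : p = y a
    · subst h4; rw [remark_self] at hB; simp at hB
    by_cases h5 : p = G.rev (y a)
    · subst h5; rw [remark_rev] at hB; simp at hB
    rw [remark_of_ne h4 h5] at hB
    exact h.noB p k hB
  · intro p n h1 h2 hp hE
    by_cases h4 : p = y a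
    · subst h4; rw [remark_self] at hE; cases hE
    by_cases h5 : p = G.rev (y a)
    · subst h5; rw [remark_rev] at hE; cases hE
    rw [remark_of_ne h4 h5] at hE
    obtain ⟨rfl, h6, h7⟩ := h.eqET p n h1 h2 hp hE
    have : n ≠ a := by rintro rfl; exact h4 rfl
    exact ⟨rfl, by omega, h7⟩
  · exact fun n h1 h2 => hclean n h2.le (h.clean n h1 h2)
  · rw [hla]
    rcases h.theseus with h1 | ⟨h1, h2, h3⟩
    · exact Or.inl h1
    · have hne : G.rev (y (d - 1)) ≠ G.rev (y a) := by
        intro h4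
        rw [h4, hmk.2] at h3; cases h3
      have hne' : G.rev (y (d - 1)) ≠ y a := by
        intro h4
        rw [h4, hmk.1] at h3; cases h3
      refine Or.inr ⟨h1, ?_, ?_⟩
      · rw [depart_mark_of_ne hne', h2]
      · rw [remark_of_ne hne' hne, h3]
  · refine Or.inr (Or.inl ⟨by omega, depart_loc_self, ?_⟩)
    rw [Nat.add_sub_cancel, depart_mark_of_ne (G.rev_ne _)]
    rcases h.agree (G.rev (y a)) with h3 | ⟨k, r, m, h3, -, h4⟩
    · rw [h3, hmk.2]
    · cases k
      · rw [hi] at h3; cases h3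
      · rcases h.theseus with ⟨q', h5⟩ | ⟨h5, -, h6⟩
        · rw [h3] at h5; cases h5
        · rw [h3] at h5; cases h5
          rw [← h4, hmk.2] at h6; cases h6
  · exact agree_depart h.agree hij hi rfl (Or.inl (by simp))

/-- Ariadne steps back along the trail of Theseus. -/
theorem Doomed.retreat {a' : ℕ} (h : Doomed G c σ y yn d a (a' + 1)) (ha : a = a' + 1)
    {q : Option P}
    (hi : c.loc .ariadne = .node (yn a) q) (hd : d < a) :
    Doomed G (c.depart .ariadne (G.rev (y a')) ⟨.FAT, .D2, .any, .D2⟩)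
      (remark G σ (G.rev (y a')) .D2 .D2) y yn d a' a' := by
  subst ha
  have hij : Agent.ariadne ≠ Agent.theseus := by simp
  have hpos := h.pos
  have hmk := h.used a' (by omega) (by omega)
  have hpath := h.path a' (by omega)
  have hla := depart_loc_other (c := c) hij (p := G.rev (y a')) (l := ⟨.FAT, .D2, .any, .D2⟩)
  have hval : ∀ p m, remark G σ (G.rev (y a')) .D2 .D2 p = m → m ≠ .D2 →
      σ p = m ∧ p ≠ y a' := by
    intro p m h1 h2
    by_cases h4 : p = G.rev (y a')
    · subst h4; rw [remark_self] at h1; exact absurd h1.symm h2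
    by_cases h5 : p = G.rev (G.rev (y a'))
    · subst h5; rw [remark_rev] at h1; exact absurd h1.symm h2
    rw [remark_of_ne h4 h5] at h1
    rw [G.rev_rev] at h5
    exact ⟨h1, h5⟩
  have hclean : ∀ n ≤ a', Clean G σ y yn d (a' + 1) n →
      Clean G (remark G σ (G.rev (y a')) .D2 .D2) y yn d a' n := by
    intro n hn' hn
    constructor
    · exact fun p hp h1 => hn.notEA p hp (hval p _ h1 (by simp)).1
    · intro p hp h1
      obtain ⟨h2, h3⟩ := hval p _ h1 (by simp)
      obtain ⟨rfl, -⟩ := hn.eqEAT p hp h2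
      refine ⟨rfl, lt_of_le_of_ne hn' ?_⟩
      rintro rfl; exact h3 rfl
    · exact fun p hp h1 => hn.eqFAT p hp (hval p _ h1 (by simp)).1
  have hmark : ∀ n, d ≤ n → n < a' →
      remark G σ (G.rev (y a')) .D2 .D2 (y n) = σ (y n) ∧
      remark G σ (G.rev (y a')) .D2 .D2 (G.rev (y n)) = σ (G.rev (y n)) := by
    intro n h1 h2
    have := h.edge_inj (n := n) (m := a') h1 (by omega) (by omega) (by omega)
    refine remark_pair this.2 fun h3 => ?_
    rw [G.rev_rev] at h3
    have := this.1 h3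
    omega
  constructor
  · omega
  · omega
  · exact le_rfl
  · exact fun n hn => h.path n (by omega)
  · exact fun n hn m hm => h.inj n (by omega) m (by omega)
  · intro n h1 h2
    rw [(hmark n h1 h2).1, (hmark n h1 h2).2]
    exact h.used n h1 (by omega)
  · intro n h1 h2; omega
  · exact fun p k hB => h.noB p k (hval p _ hB (by simp)).1
  · intro p n h1 h2 hp hE
    have := h.eqET p n h1 (by omega) hp (hval p _ hE (by simp)).1
    omega
  · exact fun n h1 h2 => hclean n (by omega) (h.clean n h1 (by omega))
  · rw [hla]
    rcases h.theseus with h1 | ⟨h1, h2, h3⟩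
    · exact Or.inl h1
    · have hne : G.rev (y (d - 1)) ≠ G.rev (y a') := by
        intro h4
        rw [h4, hmk.2] at h3; cases h3
      have hne' : G.rev (y (d - 1)) ≠ y a' := by
        intro h4
        rw [h4, hmk.1] at h3; cases h3
      refine Or.inr ⟨h1, ?_, ?_⟩
      · rw [depart_mark_of_ne hne, h2]
      · rw [remark_of_ne hne (by rwa [G.rev_rev]), h3]
  · refine Or.inr (Or.inr ⟨_, depart_loc_self, by rw [G.rev_rev, hpath.1], rfl, ?_, remark_rev,
      hclean a' le_rfl (h.clean a' (by omega) (by omega))⟩)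
    rw [G.rev_rev, depart_mark_of_ne (G.rev_ne _).symm, h.mark_eq (Or.inl hmk.1), hmk.1]
  · exact agree_depart h.agree hij hi rfl (Or.inl (by simp))

theorem Doomed.arrive_theseus (h : Doomed G c σ y yn d a K) {p : P} {m : RMark}
    (hi : c.loc .theseus = .edge p 0 m) :
    Doomed G (c.arrive G rendezvous .theseus p m) σ y yn d a K := by
  have hij : Agent.theseus ≠ Agent.ariadne := by simp
  have hle := h.le
  have hle' := h.le'
  have hpos := h.pos
  have hla := arrive_loc_other (G := G) (A := rendezvous) (c := c) hij (p := p) (m := m)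
  obtain ⟨rfl, rfl, hσ⟩ : p = y (d - 1) ∧ m = .EAT ∧ σ (G.rev p) = .FATT := by
    rcases h.theseus with ⟨q', h1⟩ | ⟨h1, h2, h3⟩
    · rw [hi] at h1; cases h1
    · rw [hi] at h1; cases h1; exact ⟨rfl, rfl, h3⟩
  have hmk : ∀ r, σ r ≠ .FATT →
      (c.arrive G rendezvous .theseus (y (d - 1)) .EAT).mark r = c.mark r := by
    intro r hr
    refine arrive_mark_of_ne ?_
    rintro rfl; exact hr hσ
  refine { h with
    theseus := Or.inl ⟨some (G.rev (y (d - 1))), ?_⟩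
    ariadne := ?_
    agree := agree_arrive h.agree hij hi (fun _ _ => rfl) (hσ ▸ arrivalMark_third .theseus _) }
  · rw [arrive_loc_self, (h.path (d - 1) (by omega)).2]
    congr 2; omega
  · rw [hla]
    rcases h.ariadne with h1 | ⟨h0, h1, h2⟩ | ⟨r, h4, h5, h2, h6, h7, h3⟩
    · exact Or.inl h1
    · refine Or.inr (Or.inl ⟨h0, h1, ?_⟩)
      rw [hmk _ (by rw [(h.used (a - 1) (by omega) (by omega)).2]; simp), h2]
    · refine Or.inr (Or.inr ⟨r, h4, h5, h2, ?_, h7, h3⟩)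
      rw [hmk _ (by rw [h7]; simp), h6]

theorem Doomed.arrive_ariadne (h : Doomed G c σ y yn d a K) {p : P} {m : RMark}
    (hi : c.loc .ariadne = .edge p 0 m) :
    Doomed G (c.arrive G rendezvous .ariadne p m) σ y yn d a K := by
  have hij : Agent.ariadne ≠ Agent.theseus := by simp
  have hle := h.le
  have hle' := h.le'
  have hpos := h.pos
  have hla := arrive_loc_other (G := G) (A := rendezvous) (c := c) hij (p := p) (m := m)
  obtain ⟨h1, h2, h3, h4⟩ : G.node (G.rev p) = yn a ∧
      arrivalMark G rendezvous c .ariadne m (G.rev p) = σ (G.rev p) ∧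
      (p = y (a - 1) ∨ Clean G σ y yn d a a) ∧ σ (G.rev p) ≠ .FATT := by
    rcases h.ariadne with ⟨q, h1, h2⟩ | ⟨h0, h1, h2⟩ | ⟨r, h4, h5, h2, h6, h7, h3⟩
    · rw [hi] at h1; cases h1
    · rw [hi] at h1; cases h1
      have h3 := (h.used (a - 1) (by omega) (by omega)).2
      refine ⟨?_, ?_, Or.inl rfl, by rw [h3]; simp⟩
      · rw [(h.path (a - 1) (by omega)).2]; congr 1; omega
      · rw [h3]; exact arrivalMark_markE hij _
    · rw [hi] at h4; cases h4
      exact ⟨h5, by rw [h7]; exact arrivalMark_third .ariadne _, Or.inr h3, by rw [h7]; simp⟩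
  refine { h with
    theseus := ?_
    ariadne := Or.inl ⟨_, by rw [arrive_loc_self, h1], h3.imp (fun h => by rw [h]) id⟩
    agree := agree_arrive h.agree hij hi (fun _ _ => rfl) h2 }
  rw [hla]
  refine h.theseus.imp id ?_
  rintro ⟨g1, g2, g3⟩
  refine ⟨g1, ?_, g3⟩
  rw [arrive_mark_of_ne, g2]
  intro g4
  rw [g4] at g3; exact h4 g3

end

section

variable {V P : Type*} {G : WeightedGraph V P} {c c' : Config V P RMark} {i j : Agent}
  {σ σ' : P → RMark} {S S' S'' : Trail V P} {p : P}

/-! ### Markers determine the place of a passage on the trails -/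

/-- The places of the passages of a trail, and their markers. -/
inductive Place (G : WeightedGraph V P) (i : Agent) (S S' : Trail V P) : P → RMark → Prop
  | lastE (n : ℕ) (hn : n < S.M) (h : S'.mode.Chased n) : Place G i S S' (S.x n) .EAT
  | lastF (n : ℕ) (hn : n < S.M) (h : S'.mode.Chased n) : Place G i S S' (G.rev (S.x n)) .FAT
  | ownE (n : ℕ) (hn : n < S.M) (h : ¬ S'.mode.Chased n) : Place G i S S' (S.x n) i.markE
  | ownF (n : ℕ) (hn : n < S.M) (h : ¬ S'.mode.Chased n) : Place G i S S' (G.rev (S.x n)) i.markF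
  | exc (q : P) (h : S.mode.Exc q) : Place G i S S' q i.markE
  | out (q : P) (h : S.mode = .out q) : Place G i S S' (G.rev q) .blank
  | turn (q : P) (h : S.mode = .turn q) : Place G i S S' (G.rev q) i.markB

theorem Half.place (h : Half G c σ i S j S') (hp : S.Edge p ∨ S.Edge (G.rev p)) :
    Place G i S S' p (σ p) := by
  rcases hp with (⟨n, hn, rfl⟩ | hp) | (⟨n, hn, hp⟩ | hp)
  · by_cases h1 : S'.mode.Chased n
    · rw [((h.marks n hn).1 h1).1]; exact .lastE n hn h1
    · rw [((h.marks n hn).2 h1).1]; exact .ownE n hn h1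
  · rw [(h.exc p hp).2]; exact .exc p hp
  · rw [← G.eq_rev_iff] at hp
    subst hp
    by_cases h1 : S'.mode.Chased n
    · rw [((h.marks n hn).1 h1).2]; exact .lastF n hn h1
    · rw [((h.marks n hn).2 h1).2]; exact .ownF n hn h1
  · rcases hm : S.mode with _ | q | q | ⟨a, b⟩ <;> rw [hm] at hp
    · exact hp.elim
    · obtain rfl : q = G.rev p := hp
      have h1 := (h.out _ hm).1
      have := Place.out (G := G) (i := i) (S' := S') _ hm
      rw [G.rev_rev] at h1 this
      rwa [h1]
    · obtain rfl : q = G.rev p := hp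
      have h1 := (h.turn _ hm).1
      have := Place.turn (G := G) (i := i) (S' := S') _ hm
      rw [G.rev_rev] at h1 this
      rwa [h1]
    · exact hp.elim

theorem Regular.place (h : Regular G c σ i S j S') (p : P) :
    (σ p = .blank ∧ σ (G.rev p) = .blank) ∨ (σ p).Dead ∨ Place G i S S' p (σ p) ∨
      Place G j S' S p (σ p) := by
  rcases h.cls p with h1 | h1 | h1 | h1
  · exact Or.inl h1
  · exact Or.inr (Or.inl h1.1)
  · exact Or.inr (Or.inr (Or.inl (h.left.place h1)))
  · exact Or.inr (Or.inr (Or.inr (h.right.place h1)))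

theorem Regular.of_markB (h : Regular G c σ i S j S') (hij : i ≠ j) (hp : σ p = i.markB) :
    ∃ q, p = G.rev q ∧ S.mode = .turn q := by
  rcases h.place p with h1 | h1 | h1 | h1 <;> rw [hp] at h1
  · simp at h1
  · simp [RMark.Dead] at h1
  · generalize hm : i.markB = m at h1
    cases h1 <;> simp at hm
    exact ⟨_, rfl, by assumption⟩
  · generalize hm : i.markB = m at h1
    cases h1 <;> simp at hm
    exact absurd hm hij

theorem Regular.of_markE (h : Regular G c σ i S j S') (hij : i ≠ j) (hp : σ p = j.markE) :
    (∃ n < S'.M, p = S'.x n ∧ ¬ S.mode.Chased n) ∨ S'.mode.Exc p := by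
  rcases h.place p with h1 | h1 | h1 | h1 <;> rw [hp] at h1
  · simp at h1
  · simp [RMark.Dead] at h1
  · generalize hm : j.markE = m at h1
    cases h1 <;> simp at hm
    · exact absurd hm.symm hij
    · exact absurd hm.symm hij
  · generalize hm : j.markE = m at h1
    cases h1 <;> simp at hm
    · exact Or.inl ⟨_, by assumption, rfl, by assumption⟩
    · exact Or.inr (by assumption)

theorem Regular.of_markF (h : Regular G c σ i S j S') (hij : i ≠ j) (hp : σ p = i.markF) :
    ∃ n < S.M, p = G.rev (S.x n) ∧ ¬ S'.mode.Chased n := by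
  rcases h.place p with h1 | h1 | h1 | h1 <;> rw [hp] at h1
  · simp at h1
  · simp [RMark.Dead] at h1
  · generalize hm : i.markF = m at h1
    cases h1 <;> simp at hm
    exact ⟨_, by assumption, rfl, by assumption⟩
  · generalize hm : i.markF = m at h1
    cases h1 <;> simp at hm
    exact absurd hm hij

theorem Regular.of_EAT (h : Regular G c σ i S j S') (hp : σ p = .EAT) :
    (∃ n < S.M, p = S.x n ∧ S'.mode.Chased n) ∨ ∃ n < S'.M, p = S'.x n ∧ S.mode.Chased n := by
  rcases h.place p with h1 | h1 | h1 | h1 <;> rw [hp] at h1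
  · simp at h1
  · simp [RMark.Dead] at h1
  · generalize hm : RMark.EAT = m at h1
    cases h1 <;> simp at hm
    exact Or.inl ⟨_, by assumption, rfl, by assumption⟩
  · generalize hm : RMark.EAT = m at h1
    cases h1 <;> simp at hm
    exact Or.inr ⟨_, by assumption, rfl, by assumption⟩

theorem Regular.of_FAT (h : Regular G c σ i S j S') (hp : σ p = .FAT) :
    (∃ n < S.M, p = G.rev (S.x n) ∧ S'.mode.Chased n) ∨
      ∃ n < S'.M, p = G.rev (S'.x n) ∧ S.mode.Chased n := by
  rcases h.place p with h1 | h1 | h1 | h1 <;> rw [hp] at h1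
  · simp at h1
  · simp [RMark.Dead] at h1
  · generalize hm : RMark.FAT = m at h1
    cases h1 <;> simp at hm
    exact Or.inl ⟨_, by assumption, rfl, by assumption⟩
  · generalize hm : RMark.FAT = m at h1
    cases h1 <;> simp at hm
    exact Or.inr ⟨_, by assumption, rfl, by assumption⟩

theorem Regular.of_blank (h : Regular G c σ i S j S') (hp : σ p = .blank) :
    σ (G.rev p) = .blank ∨ (∃ q, p = G.rev q ∧ S.mode = .out q) ∨
      ∃ q, p = G.rev q ∧ S'.mode = .out q := by
  rcases h.place p with h1 | h1 | h1 | h1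
  · exact Or.inl h1.2
  · simp [hp, RMark.Dead] at h1
  · rw [hp] at h1
    generalize hm : RMark.blank = m at h1
    cases h1 <;> simp at hm
    exact Or.inr (Or.inl ⟨_, rfl, by assumption⟩)
  · rw [hp] at h1
    generalize hm : RMark.blank = m at h1
    cases h1 <;> simp at hm
    exact Or.inr (Or.inr ⟨_, rfl, by assumption⟩)

/-! ### Agents at nodes -/

theorem Regular.chase_loc (h : Regular G c σ i S j S') {u : V} {q : Option P}
    (hi : c.loc i = .node u q) {lo hi' : ℕ} (hm : S.mode = .chase lo hi') :
    u = S'.xn hi' ∧ (q = some (G.rev (S'.x (hi' - 1))) ∨ ∀ n ≤ S.M, S.xn n ≠ S'.xn hi') := by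
  rcases (h.left.chase lo hi' hm).2 with ⟨q', h1, h2⟩ | ⟨h1, -⟩ | ⟨-, -, -, -, r, h1, -⟩
  · rw [hi] at h1; cases h1; exact ⟨rfl, h2⟩
  · rw [hi] at h1; cases h1
  · rw [hi] at h1; cases h1

/-- What an agent sees at the end of the trail of the other agent, which has found its trail. -/
theorem Regular.chase_end (h : Regular G c σ i S j S') (hij : i ≠ j) {u : V} {q : Option P}
    (hi : c.loc i = .node u q) (hap : ∀ q', c.loc j ≠ .node u q') {lo hi' : ℕ}
    (hm : S.mode = .chase lo hi') (hE : ¬ Present G c u j.markE) :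
    hi' = S'.M ∧ ((∃ a b, S'.mode = .chase a b) ∨
      (j = .ariadne ∧ S'.mode = .home ∧
        ∃ r, c.loc j = .edge r 0 .FAT ∧ G.node (G.rev r) = u ∧ c.mark (G.rev r) = .EAT)) := by
  obtain ⟨rfl, -⟩ := h.chase_loc hi hm
  have hbd := (h.left.chase lo hi' hm).1
  have hnl : ¬ S'.Leaves hi' := fun hl => hE (h.present_of_leaves hij hl (by rw [hm]; simp))
  obtain rfl : hi' = S'.M := by
    by_contra hne
    exact hnl (Or.inl (by omega))
  refine ⟨rfl, ?_⟩
  rcases hm' : S'.mode with _ | r | r | ⟨a, b⟩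
  · rcases h.right.home hm' with ⟨q', h1⟩ | ⟨r, m, h1, h2, ⟨-, h3, -⟩ | ⟨h3, h4, h5, -⟩⟩
    · exact absurd h1 (hap q')
    · exact absurd ⟨_, h2, h3⟩ hE
    · subst h4; exact Or.inr ⟨h3, rfl, r, h1, h2, h5⟩
  · exact absurd (Or.inr ⟨rfl, r, by rw [hm']; rfl⟩) hnl
  · exact absurd (Or.inr ⟨rfl, r, by rw [hm']; rfl⟩) hnl
  · exact Or.inl ⟨a, b, rfl⟩

theorem Regular.mark_chased (h : Regular G c σ i S j S') (hij : i ≠ j) {u : V} {q : Option P}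
    (hi : c.loc i = .node u q) {n : ℕ} (hn : n < S'.M) (hc : S.mode.Chased n) {a b : ℕ}
    (hm' : S'.mode = .chase a b) : c.mark (G.rev (S'.x n)) = .FAT := by
  rw [h.mark_eq_of_node hij hi, ((h.right.marks n hn).1 hc).2]
  intro m hm
  rw [G.rev_rev] at hm
  rcases h.symm.in_edge hm with ⟨h1, -⟩ | ⟨-, -, h1, -⟩ | ⟨lo, k, h1, h2, h3, h4, -⟩
  · rw [hm'] at h1; cases h1
  · rw [((h.right.marks n hn).1 hc).1] at h1; simp [RMark.Dead] at h1
  · exact (h.edge_ne (Or.inl ⟨k, h3, h4⟩) (Or.inl ⟨n, hn, rfl⟩)).1 rfl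

/-- A follower never falls back on searching. At the end of the other trail, where no $E$ of the
other agent is left, Ariadne finds the $F_{AT}$ of the edge behind her. Theseus finds the $E_{AT}$
of the edge by which Ariadne took up his trail, or of the edge through which she is returning. -/
theorem Regular.chase_present (h : Regular G c σ i S j S') (hij : i ≠ j) {u : V} {q : Option P}
    (hi : c.loc i = .node u q) (hap : ∀ q', c.loc j ≠ .node u q') {lo hi' : ℕ}
    (hm : S.mode = .chase lo hi') :
    Present G c u j.markE ∨ Present G c u i.thirdLine.out := by
  by_cases hE : Present G c u j.markE
  · exact Or.inl hE
  right
  obtain ⟨rfl, h2⟩ := h.chase_end hij hi hap hm hE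
  obtain ⟨rfl, -⟩ := h.chase_loc hi hm
  have hbd := (h.left.chase lo _ hm).1
  rcases h2 with ⟨a, b, hm'⟩ | ⟨rfl, -, r, -, h3, h4⟩
  · cases i
    · refine ⟨G.rev (S'.x (S'.M - 1)), ?_, h.mark_chased hij hi (by omega) ?_ hm'⟩
      · rw [(h.right.path _ (by omega)).2]; congr 1; omega
      · rw [hm]; simp; omega
    · have hbd' := (h.right.chase a b hm').1
      have hmk := (h.left.marks a (by omega)).1 (by rw [hm']; simp; omega)
      refine ⟨S.x a, ?_, ?_⟩
      · rw [(h.left.path a (by omega)).1, hbd'.2.2]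
        cases j <;> simp at hij ⊢
      · rw [h.mark_eq hij] <;> simp [hmk.1, Agent.thirdLine]
  · cases i
    · exact absurd rfl hij
    · exact ⟨_, h3, h4⟩

/-- In a regular configuration, unless the agents have met, no agent is stuck. -/
theorem Regular.chosen_ne_none (h : Regular G c σ i S j S') (hij : i ≠ j) {u : V} {q : Option P}
    (hi : c.loc i = .node u q) (hap : ∀ q', c.loc j ≠ .node u q') :
    chosenLine G rendezvous c i u ≠ none := by
  intro hnone
  obtain ⟨hB, hE, hT, hb, hF⟩ := rendezvous_not_chosen hij hnone
  rcases hm : S.mode with _ | r | r | ⟨lo, hi'⟩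
  · obtain rfl := h.left.home_loc hm hi
    -- With an empty stack and no blank passage, the nodes visited by `i` are closed under passing
    -- along edges, hence are all nodes; but none of them has been visited by `j`. With a nonempty
    -- stack, the last edge of the stack offers a marker.
    rcases Nat.eq_zero_or_pos S.M with h0 | h0
    · have hsr : Searching S S' := by
        refine ⟨by simp [hm], fun a b hab => ?_⟩
        have := (h.right.chase a b hab).1
        omega
      have hdj : ∀ w, w ∈ c.visited i → w ∉ c.visited j := by
        intro w h1 h2
        rcases h.shared hsr w h1 h2 with ⟨-, ⟨q', h3⟩, h4⟩ | ⟨-, ⟨q', h3⟩, r, -, h4⟩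
        · rw [hi] at h3; cases h3; exact hE h4
        · have h5 : σ r = i.markE := by
            rw [← h4]
            refine (h.mark_eq_of_node hij hi fun m hm => ?_).symm
            rw [hm] at h3; cases h3
          rcases h.symm.of_markE hij.symm h5 with ⟨n, hn, -⟩ | h6
          · omega
          · rw [hm] at h6; exact h6
      have hall : ∀ v, v ∈ c.visited i := by
        refine G.mem_of_closed (h.left.vis _ le_rfl) fun p hp => ?_
        by_cases hbl : σ p = .blank
        · obtain ⟨n, hn, h1⟩ := h.blankL hsr p hbl hp
          obtain rfl : n = S.M := by omega
          exact absurd ⟨p, h1.symm, by rw [h.mark_eq hij] <;> simp [hbl]⟩ hb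
        · rcases h.touched hsr p hbl with ⟨-, h1 | h1⟩ | ⟨h1, -⟩
          · exact h1
          · rw [hm] at h1; cases h1
          · exact absurd h1 (hdj _ hp)
      exact hdj _ (hall _) (h.right.vis 0 (Nat.zero_le _))
    · have hnode : G.node (G.rev (S.x (S.M - 1))) = S.xn S.M := by
        rw [(h.left.path _ (by omega)).2]; congr 1; omega
      by_cases hc : S'.mode.Chased (S.M - 1)
      · rcases hm' : S'.mode with _ | r | r | ⟨a, b⟩ <;> rw [hm'] at hc
        · exact hc
        · exact hc
        · exact hc
        obtain ⟨hbd, hloc⟩ := h.right.chase a b hm'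
        simp at hc
        obtain rfl : b = S.M := by omega
        rcases hloc with ⟨q', h1, -⟩ | ⟨-, h2⟩ | ⟨rfl, -, -, -, r, -, h2, h3, -⟩
        · exact hap q' h1
        · exact hF ⟨_, hnode, h2⟩
        · refine hT ⟨_, h2, ?_⟩
          cases i
          · exact absurd rfl hij
          · exact h3
      · have hmk := ((h.left.marks _ (by omega)).2 hc).2
        exact hF ⟨_, hnode, by rw [h.mark_eq hij] <;> simp [hmk]⟩
  · have := (h.left.out r hm).2
    rw [hi] at this; cases this
  · obtain ⟨h1, h2⟩ := h.left.turn r hm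
    rw [hi] at h2; cases h2
    exact hB ⟨_, rfl, by rw [h.mark_eq hij] <;> simp [h1]⟩
  · rcases h.chase_present hij hi hap hm with h1 | h1
    · exact hE h1
    · exact hT h1

/-! ### Departures -/

/-- The configurations from which each agent finds the way by itself, where at most the energy `R`
is needed outside of the edges the agents are in. -/
def Calm [Fintype P] (G : WeightedGraph V P) (c : Config V P RMark) (R : ℝ) : Prop :=
  ∃ σ, energy G σ ≤ R ∧ ((∃ S S', Regular G c σ .ariadne S .theseus S') ∨
    ∃ y yn d a K, Doomed G c σ y yn d a K)

/-- Agent `j` has to go back through the edge that `i` has just entered. -/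
def Cornered (G : WeightedGraph V P) (c : Config V P RMark) : Prop :=
  ∃ i j p m, i ≠ j ∧ c.loc i = .edge p 0 m ∧
    c.loc j = .node (G.node (G.rev p)) (some (G.rev p)) ∧ c.mark (G.rev p) = j.markB

theorem Calm.nonneg [Fintype P] {R : ℝ} (h : Calm G c R) : 0 ≤ R := by
  obtain ⟨σ, h, -⟩ := h
  exact energy_nonneg.trans h

theorem Regular.calm [Fintype P] {R : ℝ} (h : Regular G c σ i S j S') (hij : i ≠ j)
    (hR : energy G σ ≤ R) : Calm G c R := by
  cases i <;> cases j <;> simp only [ne_eq, not_true_eq_false] at hij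
  · exact ⟨σ, hR, Or.inl ⟨S, S', h⟩⟩
  · exact ⟨σ, hR, Or.inl ⟨S', S, h.symm⟩⟩

/-- The result of a departure of agent `i` by the passage `p`.  If the other agent is in the same
edge, then it will be the first to attain a node. -/
structure Departure [Fintype P] (G : WeightedGraph V P) (c : Config V P RMark) (i j : Agent)
    (p : P) (l : Line RMark) (R : ℝ) : Prop where
  nonneg : G.len p ≤ R
  alone : (∀ m, c.loc j ≠ .edge p 0 m) →
    Calm G (c.depart i p l) (R - G.len p) ∨ Cornered G (c.depart i p l)
  behind : ∀ m, c.loc j = .edge p 0 m → RMark.front m l.out ∧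
    (Calm G ((c.arrive G rendezvous j p m).depart i p l) (R - G.len p) ∨
      (c.arrive G rendezvous j p m).mark (G.rev p) = j.markB)

theorem Departure.of_regular [Fintype P] {R : ℝ} {l : Line RMark} (hij : i ≠ j)
    (hs : ∀ m, c.loc j ≠ .edge p 0 m) (h : Regular G (c.depart i p l) σ' i S j S')
    (hR : energy G σ' ≤ R - G.len p) : Departure G c i j p l R where
  nonneg := by
    have := energy_nonneg (G := G) (σ := σ')
    linarith
  alone _ := Or.inl (h.calm hij hR)
  behind m hm := absurd hm (hs m)

/-- The other agent may be in the edge that an agent enters only when it is exploring, or when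
it follows the trail of the latter. -/
theorem Regular.in_same (h : Regular G c σ i S j S') {m : RMark} (hj : c.loc j = .edge p 0 m)
    (hd : ¬ (σ p).Dead) : (S'.mode = .out p ∧ m = .blank ∧ σ p = j.markE) ∨
      (∃ a n, S'.mode = .chase a (n + 1) ∧ a ≤ n ∧ n < S.M ∧ p = S.x n ∧ m = i.markE ∧
        σ p = .EAT) := by
  rcases h.symm.in_edge hj with ⟨h1, h2⟩ | ⟨-, -, h1, -⟩ | ⟨a, n, h1, h2, h3, h4, h5, h6, -⟩
  · exact Or.inl ⟨h1, h2, (h.right.exc p (by rw [h1]; rfl)).2⟩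
  · exact absurd h1 hd
  · exact Or.inr ⟨a, n, h1, h2, h3, h4, h5, h6⟩

end

/-! ### Departures from regular configurations, by the line selected -/

section

variable {V P : Type*} {G : WeightedGraph V P} {c c' : Config V P RMark} {i j : Agent}
  {σ σ' : P → RMark} {S S' S'' : Trail V P} {p : P} [Fintype P]

theorem Regular.departure_B (h : Regular G c σ i S j S') (hij : i ≠ j)
    (ho : ∀ m, c.loc j ≠ .edge (G.rev p) 0 m) (hp : σ p = i.markB) :
    Departure G c i j p ⟨i.markB, .D, .any, .D⟩ (energy G σ) := by
  obtain ⟨q, rfl, hm⟩ := h.of_markB hij hp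
  rw [G.rev_rev] at ho
  have hE := h.left.exc q (by rw [hm]; rfl)
  have hs : ∀ m, c.loc j ≠ .edge (G.rev q) 0 m := by
    intro m hj
    rcases h.in_same hj (by simp [hp, RMark.Dead]) with ⟨-, -, h1⟩ | ⟨_, _, -, -, -, -, -, h1⟩ <;>
      rw [hp] at h1 <;> simp at h1
  refine .of_regular hij hs (h.turnBack hij ho hs hm) (energy_remark ?_)
  rw [hp, G.rev_rev, hE.2]
  simp; norm_num

/-- A passage with the $E$ of `j` is on its stack, and is followed; or it is that of the edge which
`j` is exploring, and then `i` is behind `j`; or `j` stands at the far end of this edge with its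
$B$, and is cornered. -/
theorem Regular.departure_E (h : Regular G c σ i S j S') (hij : i ≠ j) {u : V} {q : Option P}
    (hi : c.loc i = .node u q) (hu : G.node p = u)
    (ho : ∀ m, c.loc j ≠ .edge (G.rev p) 0 m) (hp : σ p = j.markE) (hB : ¬ Present G c u i.markB) :
    Departure G c i j p ⟨j.markE, .EAT, .any, .FAT⟩ (energy G σ) := by
  have hmode : ∀ n ≤ S'.M, u = S'.xn n → ∃ lo, (S.mode = .home ∧ lo = n) ∨ S.mode = .chase lo n := by
    intro n hn hn'
    rcases hm : S.mode with _ | r | r | ⟨lo, hi'⟩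
    · exact ⟨n, Or.inl ⟨rfl, rfl⟩⟩
    · have := (h.left.out r hm).2
      rw [hi] at this; cases this
    · obtain ⟨h1, h2⟩ := h.left.turn r hm
      rw [hi] at h2; cases h2
      exact absurd ⟨_, rfl, by rw [h.mark_eq hij] <;> simp [h1]⟩ hB
    · obtain ⟨h1, -⟩ := h.chase_loc hi hm
      have := (h.left.chase lo hi' hm).1.2.1
      obtain rfl := h.right.inj n hn hi' this (hn'.symm.trans h1)
      exact ⟨lo, Or.inr rfl⟩
  have hw : ∀ b : RMark, b.weight = 3 / 2 → (RMark.EAT).weight + (RMark.FAT).weight + 1 ≤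
      (σ p).weight + b.weight := by
    intro b hb
    rw [hp, hb]; simp; norm_num
  have hnn : (σ (G.rev p)).weight = 3 / 2 → G.len p ≤ energy G σ := by
    intro hb
    have := energy_remark (G := G) (hw _ hb)
    have := energy_nonneg (G := G) (σ := remark G σ p .EAT .FAT)
    linarith
  rcases h.of_markE hij hp with ⟨n, hn, rfl, hc⟩ | hexc
  · have hs : ∀ m, c.loc j ≠ .edge (S'.x n) 0 m := by
      intro m hj
      rcases h.in_same hj (by simp [hp, RMark.Dead]) with ⟨h1, -⟩ | ⟨_, _, -, -, -, -, -, h1⟩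
      · exact (h.right.stack_ne hn (by rw [h1]; rfl)).1 rfl
      · rw [hp] at h1; simp at h1
    rw [(h.right.path n hn).1] at hu
    subst hu
    obtain ⟨lo, hlo⟩ := hmode n hn.le rfl
    refine .of_regular hij hs (h.follow hij hn hi hlo ho hs) (energy_remark (hw _ ?_))
    rw [((h.right.marks n hn).2 hc).2]; simp
  · rcases hm' : S'.mode with _ | r | r | ⟨a, b⟩ <;> rw [hm'] at hexc
    · exact hexc.elim
    · obtain rfl : r = p := hexc
      obtain ⟨hb, hj⟩ := h.right.out r hm'
      obtain ⟨hnode, -⟩ := h.right.exc r (by rw [hm']; rfl)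
      have hwb : (σ (G.rev r)).weight = 3 / 2 := by rw [hb]; rfl
      refine ⟨hnn hwb, fun hs => absurd hj (hs _), fun m hm => ?_⟩
      rw [hj] at hm; cases hm
      refine ⟨by simp [RMark.front, RMark.entry], ?_⟩
      -- If `j` will find a known node, it has to come back through this edge and is cornered. If
      -- the node is new, its arrival makes this edge the last one of its trail, and `i` follows it
      -- there.
      by_cases hv : G.node (G.rev r) ∈ c.visited j
      · right
        rw [arrive_mark_rev, arrivalMark_blank_of_mem hv]
      left
      have hi1 : (c.arrive G rendezvous j r .blank).loc i = .node u q := by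
        rw [arrive_loc_other hij.symm, hi]
      have hj1 := arrive_loc_self (G := G) (A := rendezvous) (c := c) (i := j) (p := r)
        (m := .blank)
      have h1 := h.symm.arrive_new hij.symm hj hm' (by simp [hi]) (fun q' hq' => by
        rw [hi] at hq'; cases hq'
        apply hv
        rw [← hu, hnode]
        exact h.right.vis _ le_rfl) hv
      obtain ⟨lo, hlo⟩ := hmode S'.M le_rfl (hu.symm.trans hnode)
      have h2 := h1.symm.follow hij (lo := lo) (n := S'.M) (q := q) (Nat.lt_succ_self _)
        (by rw [hi1, Trail.push_xn le_rfl, ← hnode, hu]) hlo (by simp [hj1]) (by simp [hj1])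
      rw [Trail.push_x_last] at h2
      refine h2.calm hij ((energy_remark ?_).trans (sub_le_sub_right (energy_remark_le ?_) _))
      · rw [remark_self, remark_rev]
        exact hw _ (by simp)
      · rw [hb]; simp
    · obtain rfl : r = p := hexc
      obtain ⟨hb, hj⟩ := h.right.turn r hm'
      refine ⟨hnn (by rw [hb]; simp), fun hs => Or.inr ⟨i, j, r, _, hij, depart_loc_self, ?_, ?_⟩,
        fun m hm => ?_⟩
      · rw [depart_loc_other hij, hj]
      · rw [depart_mark_of_ne (G.rev_ne r), h.mark_eq hij] <;> simp [hb]
      · rw [hj] at hm; cases hm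
    · exact hexc.elim

/-- A node may carry $F_{AT}$ from both trails. If it lies on Ariadne's own trail as well, she has
come to it forwards along the trail of Theseus, and the convention of retracing singles out the edge
behind her. -/
theorem Regular.departure_retreat (h : Regular G c σ .ariadne S .theseus S') {u : V}
    {q : Option P} (hi : c.loc .ariadne = .node u q) (hu : G.node p = u)
    (hap : ∀ q', c.loc .theseus ≠ .node u q')
    (ho : ∀ m, c.loc .theseus ≠ .edge (G.rev p) 0 m) (hp : σ p = .FAT)
    (htie : ∀ q', q = some q' → c.mark q' = .FAT → p = q')
    (hB : ¬ Present G c u .BA) (hE : ¬ Present G c u .ET) :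
    Departure G c .ariadne .theseus p ⟨.FAT, .D2, .any, .D2⟩ (energy G σ) := by
  have hij : Agent.ariadne ≠ Agent.theseus := by simp
  have hs : ∀ m, c.loc .theseus ≠ .edge p 0 m := by
    intro m hj
    rcases h.in_same hj (by simp [hp, RMark.Dead]) with ⟨-, -, h1⟩ | ⟨_, _, -, -, -, -, -, h1⟩ <;>
      rw [hp] at h1 <;> simp at h1
  rcases hm : S.mode with _ | r | r | ⟨lo, hi'⟩
  · exfalso
    obtain rfl := h.left.home_loc hm hi
    rcases h.of_FAT hp with ⟨n, hn, rfl, hc⟩ | ⟨n, hn, rfl, hc⟩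
    · rw [(h.left.path n hn).2] at hu
      have := h.left.inj (n + 1) hn _ le_rfl hu
      rcases hm' : S'.mode with _ | r | r | ⟨a, b⟩ <;> rw [hm'] at hc
      · exact hc
      · exact hc
      · exact hc
      obtain ⟨hbd, hloc⟩ := h.right.chase a b hm'
      simp at hc
      obtain rfl : b = n + 1 := by omega
      rcases hloc with ⟨q', h1, -⟩ | ⟨h1, -⟩ | ⟨h1, -⟩
      · rw [← hu] at hap; exact hap q' h1
      · rw [G.rev_rev] at ho; exact ho _ h1
      · cases h1
    · rw [hm] at hc; exact hc
  · have := (h.left.out r hm).2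
    rw [hi] at this; cases this
  · obtain ⟨h1, h2⟩ := h.left.turn r hm
    rw [hi] at h2; cases h2
    exact absurd ⟨_, rfl, by rw [h.mark_eq hij] <;> simp [h1, Agent.markB]⟩ hB
  · obtain ⟨rfl, h3⟩ := h.chase_end hij hi hap hm hE
    obtain ⟨rfl, h4⟩ := h.chase_loc hi hm
    have hbd := (h.left.chase lo _ hm).1
    rcases h3 with ⟨a, b, hm'⟩ | ⟨h1, -⟩
    · obtain ⟨k, hk⟩ : ∃ k, S'.M = k + 1 := ⟨S'.M - 1, by omega⟩
      have hkc : S.mode.Chased k := by rw [hm]; simp; omega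
      obtain rfl : p = G.rev (S'.x k) := by
        rcases h.of_FAT hp with ⟨n, hn, rfl, hc⟩ | ⟨n, hn, rfl, hc⟩
        · rcases h4 with h4 | h4
          · rw [hk, Nat.add_sub_cancel] at h4
            exact htie _ h4 (h.mark_chased hij hi (by omega) hkc hm')
          · rw [(h.left.path n hn).2] at hu
            exact absurd hu (h4 _ hn)
        · rw [(h.right.path n hn).2] at hu
          have := h.right.inj (n + 1) hn _ le_rfl hu
          obtain rfl : n = k := by omega
          rfl
      rw [G.rev_rev] at ho
      rw [hk] at hm
      have hmk := (h.right.marks k (by omega)).1 hkc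
      have hen : energy G (remark G σ (G.rev (S'.x k)) .D2 .D2) ≤
          energy G σ - G.len (G.rev (S'.x k)) := by
        refine energy_remark ?_
        rw [G.rev_rev, hmk.1, hmk.2]; simp; norm_num
      refine .of_regular (S := { S with mode := if lo < k then .chase lo k else .home })
        hij hs (h.retreat hij rfl hm hk hm' hi ho hs ?_) hen
      split
      · exact Or.inl ⟨by assumption, rfl⟩
      · exact Or.inr ⟨by omega, rfl⟩
    · cases h1

/-- Theseus is at the end of Ariadne's trail, where the only $E_{AT}$ is at the edge by which she
began to follow his. If she is still inside that edge he enters behind her, and her arrival is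
carried out before his departure is judged. -/
theorem Regular.departure_doom (h : Regular G c σ .theseus S .ariadne S') {u : V}
    {q : Option P} (hi : c.loc .theseus = .node u q) (hu : G.node p = u)
    (hap : ∀ q', c.loc .ariadne ≠ .node u q')
    (ho : ∀ m, c.loc .ariadne ≠ .edge (G.rev p) 0 m) (hp : σ p = .EAT)
    (hB : ¬ Present G c u .BT) (hE : ¬ Present G c u .EA) :
    Departure G c .theseus .ariadne p Agent.theseus.thirdLine (energy G σ) := by
  have hij : Agent.theseus ≠ Agent.ariadne := by simp
  rcases hm : S.mode with _ | r | r | ⟨lo, hi'⟩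
  · exfalso
    obtain rfl := h.left.home_loc hm hi
    rcases h.of_EAT hp with ⟨n, hn, rfl, hc⟩ | ⟨n, hn, rfl, hc⟩
    · rw [(h.left.path n hn).1] at hu
      have := h.left.inj n hn.le _ le_rfl hu
      omega
    · rw [hm] at hc; exact hc
  · have := (h.left.out r hm).2
    rw [hi] at this; cases this
  · obtain ⟨h1, h2⟩ := h.left.turn r hm
    rw [hi] at h2; cases h2
    exact absurd ⟨_, rfl, by rw [h.mark_eq hij] <;> simp [h1, Agent.markB]⟩ hB
  · obtain ⟨rfl, -⟩ := h.chase_end hij hi hap hm hE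
    obtain ⟨rfl, -⟩ := h.chase_loc hi hm
    rcases h.of_EAT hp with ⟨n, hn, rfl, hc⟩ | ⟨n, hn, rfl, hc⟩
    · rcases hm' : S'.mode with _ | r | r | ⟨a, b⟩ <;> rw [hm'] at hc
      · exact hc.elim
      · exact hc.elim
      · exact hc.elim
      have hbd := (h.right.chase a b hm').1
      obtain rfl : n = a := by
        refine h.left.inj n hn.le a (by omega) ?_
        rw [← (h.left.path n hn).1, hu, hbd.2.2 rfl]
      have hmk := (h.left.marks n hn).1 (by rw [hm']; simp; omega)
      have hen : energy G (remark G σ (S.x n) .EATT .FATT) ≤ energy G σ - G.len (S.x n) := by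
        refine energy_remark ?_
        rw [hmk.1, hmk.2]; simp; norm_num
      refine ⟨?_, fun hs => Or.inl ⟨_, hen, Or.inr ⟨_, _, _, _, _, h.doom hm hm' hi ho hs⟩⟩,
        fun m hj => ?_⟩
      · have := energy_nonneg (G := G) (σ := remark G σ (S.x n) .EATT .FATT)
        linarith
      · rcases h.in_same hj (by simp [hp, RMark.Dead]) with ⟨-, -, h1⟩ | ⟨_, _, -, -, -, -, rfl, -⟩
        · rw [hp] at h1; simp at h1
        refine ⟨by simp [RMark.front, RMark.entry, Agent.thirdLine], Or.inl ?_⟩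
        have h1 := (h.symm.arrive_chase hij.symm hj hm' (by simp [hi])).symm
        have hj1 := arrive_loc_self (G := G) (A := rendezvous) (c := c) (i := .ariadne)
          (p := S.x n) (m := Agent.theseus.markE)
        exact ⟨_, hen, Or.inr ⟨_, _, _, _, _, h1.doom hm hm'
          (by rw [arrive_loc_other hij.symm, hi]) (by simp [hj1]) (by simp [hj1])⟩⟩
    · rw [(h.right.path n hn).1] at hu
      have := h.right.inj n hn.le _ le_rfl hu
      omega

/-- Only an agent at the end of its own trail explores: a follower has a marker of higher priority
(`Regular.chase_present`). The far passage is blank too, since otherwise `j` would be exploring this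
edge from the other end, against `ho`. -/
theorem Regular.departure_blank (h : Regular G c σ i S j S') (hij : i ≠ j) {u : V} {q : Option P}
    (hi : c.loc i = .node u q) (hu : G.node p = u) (hap : ∀ q', c.loc j ≠ .node u q')
    (ho : ∀ m, c.loc j ≠ .edge (G.rev p) 0 m) (hp : σ p = .blank) (hB : ¬ Present G c u i.markB)
    (hE : ¬ Present G c u j.markE) (hT : ¬ Present G c u i.thirdLine.out) {l : Line RMark}
    (hl : l.out = .blank) (hl' : l.newOut = i.markE) :
    Departure G c i j p l (energy G σ) := by
  have hs : ∀ m, c.loc j ≠ .edge p 0 m := by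
    intro m hj
    rcases h.in_same hj (by simp [hp, RMark.Dead]) with ⟨-, -, h1⟩ | ⟨_, _, -, -, -, -, -, h1⟩ <;>
      rw [hp] at h1 <;> simp at h1
  rcases hm : S.mode with _ | r | r | ⟨lo, hi'⟩
  · have hb' : σ (G.rev p) = .blank := by
      rcases h.of_blank hp with h1 | ⟨r, rfl, h1⟩ | ⟨r, rfl, h1⟩
      · exact h1
      · rw [hm] at h1; cases h1
      · have := (h.right.out r h1).2
        rw [G.rev_rev] at ho
        exact absurd this (ho _)
    refine .of_regular hij hs (h.explore hij hi hu ho hs hm hp hb' hE hl hl') (energy_remark ?_)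
    rw [hp, hb']; simp; norm_num
  · have := (h.left.out r hm).2
    rw [hi] at this; cases this
  · obtain ⟨h1, h2⟩ := h.left.turn r hm
    rw [hi] at h2; cases h2
    exact absurd ⟨_, rfl, by rw [h.mark_eq hij] <;> simp [h1]⟩ hB
  · rcases h.chase_present hij hi hap hm with h1 | h1 <;> contradiction

theorem Regular.departure_F (h : Regular G c σ i S j S') (hij : i ≠ j) {u : V} {q : Option P}
    (hi : c.loc i = .node u q) (hu : G.node p = u) (hap : ∀ q', c.loc j ≠ .node u q')
    (ho : ∀ m, c.loc j ≠ .edge (G.rev p) 0 m) (hp : σ p = i.markF) (hB : ¬ Present G c u i.markB)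
    (hE : ¬ Present G c u j.markE) (hT : ¬ Present G c u i.thirdLine.out)
    (hb : ¬ Present G c u .blank) :
    Departure G c i j p ⟨i.markF, .D, .any, .D⟩ (energy G σ) := by
  have hs : ∀ m, c.loc j ≠ .edge p 0 m := by
    intro m hj
    rcases h.in_same hj (by simp [hp, RMark.Dead]) with ⟨-, -, h1⟩ | ⟨_, _, -, -, -, -, -, h1⟩ <;>
      rw [hp] at h1 <;> simp at h1
  obtain ⟨n, hn, rfl, hc⟩ := h.of_markF hij hp
  have hmk := (h.left.marks n hn).2 hc
  rcases hm : S.mode with _ | r | r | ⟨lo, hi'⟩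
  · obtain rfl := h.left.home_loc hm hi
    rw [(h.left.path n hn).2] at hu
    have hM := h.left.inj (n + 1) hn _ le_rfl hu
    rw [G.rev_rev] at ho
    refine .of_regular hij hs (h.pop hij hM.symm hi hm hc hb hE ho hs) (energy_remark ?_)
    rw [hp, G.rev_rev, hmk.1]; simp; norm_num
  · have := (h.left.out r hm).2
    rw [hi] at this; cases this
  · obtain ⟨h1, h2⟩ := h.left.turn r hm
    rw [hi] at h2; cases h2
    exact absurd ⟨_, rfl, by rw [h.mark_eq hij] <;> simp [h1]⟩ hB
  · rcases h.chase_present hij hi hap hm with h1 | h1 <;> contradiction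

theorem Regular.departure (h : Regular G c σ i S j S') (hij : i ≠ j) {u : V} {q : Option P}
    (hi : c.loc i = .node u q) (hap : ∀ q', c.loc j ≠ .node u q') {l : Line RMark}
    (hl : chosenLine G rendezvous c i u = some l) (hu : G.node p = u) (hp : c.mark p = l.out)
    (htie : ∀ q', q = some q' → c.mark q' = l.out → p = q')
    (ho : ∀ m, c.loc j ≠ .edge (G.rev p) 0 m) : Departure G c i j p l (energy G σ) := by
  rw [h.mark_eq_of_node hij hi ho] at hp
  rcases rendezvous_chosen hij hl with rfl | ⟨hB, rfl | ⟨hE, rfl | ⟨hT, ⟨h1, h2⟩ | ⟨hb, rfl⟩⟩⟩⟩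
  · exact h.departure_B hij ho hp
  · exact h.departure_E hij hi hu ho hp hB
  · cases i <;> cases j <;> simp only [ne_eq, not_true_eq_false] at hij
    · exact h.departure_retreat hi hu hap ho hp htie hB hE
    · exact h.departure_doom hi hu hap ho hp hB hE
  · exact h.departure_blank hij hi hu hap ho (hp.trans h1) hB hE hT h1 h2
  · exact h.departure_F hij hi hu hap ho hp hB hE hT hb

end

/-! ### Departures from doomed configurations, and calm configurations in general -/

section

variable {V P : Type*} {G : WeightedGraph V P} {c c' : Config V P RMark} {i j : Agent}
  {σ σ' : P → RMark} {S S' S'' : Trail V P} {p : P} {y : ℕ → P} {yn : ℕ → V} {d a K : ℕ}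

theorem Doomed.not_same (h : Doomed G c σ y yn d a K) {m m' : RMark}
    (hA : c.loc .ariadne = .edge p 0 m) (hT : c.loc .theseus = .edge p 0 m') : False := by
  have hle := h.le'
  have hT' : p = y (d - 1) ∧ σ (G.rev p) = .FATT := by
    rcases h.theseus with ⟨q, h1⟩ | ⟨h1, -, h2⟩
    · rw [hT] at h1; cases h1
    · rw [hT] at h1; cases h1; exact ⟨rfl, h2⟩
  rcases h.ariadne with ⟨q, h1, -⟩ | ⟨h0, h1, -⟩ | ⟨r, h1, -, -, -, h2, -⟩
  · rw [hA] at h1; cases h1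
  · rw [hA] at h1; cases h1
    have := (h.used (a - 1) (by omega) (by omega)).2
    rw [this] at hT'; simp at hT'
  · rw [hA] at h1; cases h1
    rw [h2] at hT'; simp at hT'

theorem Doomed.chosen_ne_none (h : Doomed G c σ y yn d a K) (hij : i ≠ j) {u : V} {q : Option P}
    (hi : c.loc i = .node u q) (hap : ∀ q', c.loc j ≠ .node u q') :
    chosenLine G rendezvous c i u ≠ none := by
  intro hnone
  obtain ⟨-, hE, hT, -, -⟩ := rendezvous_not_chosen hij hnone
  cases i <;> cases j <;> simp only [ne_eq, not_true_eq_false] at hij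
  · rcases h.present_ariadne (fun v q' q'' h1 h2 => by
      rw [hi] at h1; cases h1; exact hap _ h2) hi with ⟨-, h1⟩ | ⟨-, h1⟩
    · exact hE h1
    · exact hT h1
  · exact hT (h.present_theseus (fun v q' q'' h1 h2 => by
      rw [hi] at h2; cases h2; exact hap _ h1) hi).2.2

variable [Fintype P]

theorem Doomed.calm {R : ℝ} (h : Doomed G c σ y yn d a K) (hR : energy G σ ≤ R) : Calm G c R :=
  ⟨σ, hR, Or.inr ⟨y, yn, d, a, K, h⟩⟩

theorem Doomed.departure_theseus (h : Doomed G c σ y yn d a K) {u : V} {q : Option P}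
    (hi : c.loc .theseus = .node u q) (hap : ∀ q', c.loc .ariadne ≠ .node u q') {l : Line RMark}
    (hl : chosenLine G rendezvous c .theseus u = some l) (hu : G.node p = u)
    (hp : c.mark p = l.out) (ho : ∀ m, c.loc .ariadne ≠ .edge (G.rev p) 0 m) :
    Departure G c .theseus .ariadne p l (energy G σ) := by
  have hij : Agent.theseus ≠ Agent.ariadne := by simp
  rw [h.mark_eq_of_node hij hi ho] at hp
  obtain ⟨rfl, hcl, hpr⟩ := h.present_theseus (fun v q' q'' h1 h2 => by
    rw [hi] at h2; cases h2; exact hap _ h1) hi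
  rcases rendezvous_chosen hij hl with rfl | ⟨-, rfl | ⟨-, rfl | ⟨hT, -⟩⟩⟩
  · exact (h.noB p .theseus hp).elim
  · exact absurd hp (hcl.notEA p hu)
  · obtain ⟨rfl, hd⟩ := hcl.eqEAT p hu hp
    have hmk := h.used d le_rfl hd
    have hen : energy G (remark G σ (y d) .EATT .FATT) ≤ energy G σ - G.len (y d) := by
      refine energy_remark ?_
      rw [hmk.1, hmk.2]; simp; norm_num
    refine ⟨?_, fun hs => Or.inl ((h.depart_theseus hi hd ho hs).calm hen), fun m hj => ?_⟩
    · have := energy_nonneg (G := G) (σ := remark G σ (y d) .EATT .FATT)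
      linarith
    · have hj1 := arrive_loc_self (G := G) (A := rendezvous) (c := c) (i := .ariadne)
        (p := y d) (m := m)
      refine ⟨?_, Or.inl (((h.arrive_ariadne hj).depart_theseus
        (by rw [arrive_loc_other hij.symm, hi]) hd (by simp [hj1]) (by simp [hj1])).calm hen)⟩
      rcases h.ariadne with ⟨q, h1, -⟩ | ⟨h0, h1, -⟩ | ⟨r, h1, -, -, -, h2, -⟩
      · rw [hj] at h1; cases h1
      · rw [hj] at h1; injection h1 with _ _ h1
        rw [h1]; simp [RMark.front, RMark.entry, Agent.thirdLine]
      · rw [hj] at h1; injection h1 with h1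
        rw [← h1, hmk.2] at h2; cases h2
  · exact absurd hpr hT

theorem Doomed.departure_ariadne (h : Doomed G c σ y yn d a K) {u : V} {q : Option P}
    (hi : c.loc .ariadne = .node u q) (hap : ∀ q', c.loc .theseus ≠ .node u q') {l : Line RMark}
    (hl : chosenLine G rendezvous c .ariadne u = some l) (hu : G.node p = u)
    (hp : c.mark p = l.out) (htie : ∀ q', q = some q' → c.mark q' = l.out → p = q')
    (ho : ∀ m, c.loc .theseus ≠ .edge (G.rev p) 0 m) :
    Departure G c .ariadne .theseus p l (energy G σ) := by
  have hij : Agent.ariadne ≠ Agent.theseus := by simp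
  rw [h.mark_eq_of_node hij hi ho] at hp
  have hap' : ∀ v q q', c.loc .ariadne = .node v q → c.loc .theseus ≠ .node v q' := by
    intro v q' q'' h1 h2
    rw [hi] at h1; cases h1; exact hap _ h2
  have hpr := h.present_ariadne hap' hi
  obtain ⟨rfl, hor⟩ := h.loc_ariadne hi
  rcases rendezvous_chosen hij hl with rfl | ⟨-, rfl | ⟨hE, rfl | ⟨hT, -⟩⟩⟩
  · exact (h.noB p .ariadne hp).elim
  · obtain ⟨rfl, -, ha⟩ := h.eqET p a h.le h.le' hu hp
    have hmk := h.unused a le_rfl ha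
    have hen : energy G (remark G σ (y a) .EAT .FAT) ≤ energy G σ - G.len (y a) := by
      refine energy_remark ?_
      rw [hmk.1, hmk.2]; simp [RMark.weight]; norm_num
    refine ⟨?_, fun hs => Or.inl ((h.depart_ariadne hi ha).calm hen), fun m hj => ?_⟩
    · have := energy_nonneg (G := G) (σ := remark G σ (y a) .EAT .FAT)
      linarith
    · rcases h.theseus with ⟨q', h1⟩ | ⟨h1, -, h2⟩
      · rw [hj] at h1; cases h1
      · rw [hj] at h1; injection h1 with h1
        rw [← h1, hmk.2] at h2; cases h2
  · obtain ⟨rfl, -⟩ := hpr.resolve_left fun h1 => hE h1.2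
    have hpos := h.pos
    have hle := h.le
    obtain ⟨a', rfl⟩ : ∃ a', a = a' + 1 := ⟨a - 1, by omega⟩
    -- Either she came forwards along the path and retraces, or the node is clean; in both cases the
    -- passage behind her is the only choice.
    obtain rfl : p = G.rev (y a') := by
      rcases hor with h1 | h1
      · exact htie _ h1 (h.mark_behind hap' hi)
      · exact (h1.eqFAT p hu hp).1
    rw [G.rev_rev] at ho
    -- If Theseus were not strictly behind, he would be in the edge behind her and coming against
    -- her, which `ho` excludes.
    have hd : d < a' + 1 := by
      rcases h.ahead hap' with h1 | ⟨-, ⟨q', -, h1, -⟩ | ⟨-, -, r, m, h1, -⟩⟩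
      · exact h1
      · exact absurd h1 (ho _)
      · rw [hi] at h1; cases h1
    have hmk := h.used a' (by omega) (by omega)
    have hen : energy G (remark G σ (G.rev (y a')) .D2 .D2) ≤
        energy G σ - G.len (G.rev (y a')) := by
      refine energy_remark ?_
      rw [G.rev_rev, hmk.1, hmk.2]; simp; norm_num
    refine ⟨?_, fun hs => Or.inl ((h.retreat rfl hi hd).calm hen), fun m hj => ?_⟩
    · have := energy_nonneg (G := G) (σ := remark G σ (G.rev (y a')) .D2 .D2)
      linarith
    · rcases h.theseus with ⟨q', h1⟩ | ⟨h1, -, h2⟩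
      · rw [hj] at h1; cases h1
      · rw [hj] at h1; injection h1 with h1
        rw [← h1, G.rev_rev, hmk.1] at h2; cases h2
  · exact absurd hpr (by rintro (⟨-, h1⟩ | ⟨-, h1⟩); exacts [hE h1, hT h1])

/-! ### Calm configurations -/

theorem Departure.mono {R R' : ℝ} {l : Line RMark} (h : Departure G c i j p l R) (hR : R ≤ R') :
    Departure G c i j p l R' := by
  have key : ∀ {c' : Config V P RMark}, Calm G c' (R - G.len p) → Calm G c' (R' - G.len p) :=
    fun ⟨σ, h1, h2⟩ => ⟨σ, by linarith, h2⟩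
  exact ⟨h.nonneg.trans hR, fun hs => (h.alone hs).imp key id,
    fun m hm => (h.behind m hm).imp id (Or.imp key id)⟩

/-- A calm configuration seen from agent `i`. -/
theorem Calm.cases {R : ℝ} (h : Calm G c R) (hij : i ≠ j) :
    ∃ σ, energy G σ ≤ R ∧ ((∃ S S', Regular G c σ i S j S') ∨
      ∃ y yn d a K, Doomed G c σ y yn d a K) := by
  obtain ⟨σ, hR, h | h⟩ := h
  · refine ⟨σ, hR, Or.inl ?_⟩
    obtain ⟨S, S', h⟩ := h
    cases i <;> cases j <;> simp only [ne_eq, not_true_eq_false] at hij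
    · exact ⟨S, S', h⟩
    · exact ⟨S', S, h.symm⟩
  · exact ⟨σ, hR, Or.inr h⟩

theorem Calm.not_same {R : ℝ} (h : Calm G c R) (hij : i ≠ j) {m m' : RMark}
    (hi : c.loc i = .edge p 0 m) : c.loc j ≠ .edge p 0 m' := by
  intro hj
  obtain ⟨σ, -, ⟨S, S', h⟩ | ⟨y, yn, d, a, K, h⟩⟩ := h.cases hij
  · exact h.not_both_in hij hi hj
  · cases i <;> cases j <;> simp only [ne_eq, not_true_eq_false] at hij
    · exact h.not_same hi hj
    · exact h.not_same hj hi

theorem Calm.chosen_ne_none {R : ℝ} (h : Calm G c R) (hij : i ≠ j) {u : V} {q : Option P}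
    (hi : c.loc i = .node u q) (hap : ∀ q', c.loc j ≠ .node u q') :
    chosenLine G rendezvous c i u ≠ none := by
  obtain ⟨σ, -, ⟨S, S', h⟩ | ⟨y, yn, d, a, K, h⟩⟩ := h.cases hij
  · exact h.chosen_ne_none hij hi hap
  · exact h.chosen_ne_none hij hi hap

theorem Calm.departure {R : ℝ} (h : Calm G c R) (hij : i ≠ j) {u : V} {q : Option P}
    (hi : c.loc i = .node u q) (hap : ∀ q', c.loc j ≠ .node u q') {l : Line RMark}
    (hl : chosenLine G rendezvous c i u = some l) (hu : G.node p = u) (hp : c.mark p = l.out)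
    (htie : ∀ q', q = some q' → c.mark q' = l.out → p = q')
    (ho : ∀ m, c.loc j ≠ .edge (G.rev p) 0 m) : Departure G c i j p l R := by
  obtain ⟨σ, hR, ⟨S, S', h⟩ | ⟨y, yn, d, a, K, h⟩⟩ := h.cases hij
  · exact (h.departure hij hi hap hl hu hp htie ho).mono hR
  · refine Departure.mono ?_ hR
    cases i <;> cases j <;> simp only [ne_eq, not_true_eq_false] at hij
    · exact h.departure_ariadne hi hap hl hu hp htie ho
    · exact h.departure_theseus hi hap hl hu hp ho

theorem Calm.arrive {R : ℝ} (h : Calm G c R) (hij : i ≠ j) {m : RMark}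
    (hi : c.loc i = .edge p 0 m) (hap : ∀ q, c.loc j ≠ .node (G.node (G.rev p)) q) :
    Calm G (c.arrive G rendezvous i p m) R := by
  have hs : ∀ m', c.loc j ≠ .edge p 0 m' := fun m' => h.not_same hij hi
  obtain ⟨σ, hR, ⟨S, S', h⟩ | ⟨y, yn, d, a, K, h⟩⟩ := h.cases hij
  · rcases hm : S.mode with _ | r | r | ⟨a, b⟩
    · exact (h.arrive_home hij hi hm hs hap).calm hij hR
    · obtain ⟨hb, h1⟩ := h.left.out r hm
      rw [hi] at h1; cases h1
      have hen : ∀ b : RMark, b.weight = 3 / 2 → energy G (remark G σ p (σ p) b) ≤ R :=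
        fun b h1 => (energy_remark_le (by rw [hb, h1]; simp)).trans hR
      by_cases hv : G.node (G.rev p) ∈ c.visited i
      · exact (h.arrive_known hij hi hm hs hv).calm hij (hen _ (by simp))
      · exact (h.arrive_new hij hi hm hs hap hv).calm hij (hen _ (by simp))
    · have := (h.left.turn r hm).2
      rw [hi] at this; cases this
    · exact (h.arrive_chase hij hi hm hs).calm hij hR
  · cases i <;> cases j <;> simp only [ne_eq, not_true_eq_false] at hij
    · exact (h.arrive_ariadne hi).calm hR
    · exact (h.arrive_theseus hi).calm hR

end

section

variable {V P : Type*} {M : Type} {G : WeightedGraph V P} {A : Algorithm M} {c : Config V P M}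
  {i j : Agent} {p : P}

/-! ### Exchanging departures and arrivals -/

theorem arrivalMark_congr {c c' : Config V P M} {m : M} {q : P} (hm : c'.mark q = c.mark q)
    (hv : c'.visited = c.visited) : arrivalMark G A c' i m q = arrivalMark G A c i m q := by
  have : ∀ r : Reading M, r.Holds G c' q ↔ r.Holds G c q := by
    intro r
    cases r <;> simp [Reading.Holds, hm, hv]
  have h2 : Reading.Holds G c' q = Reading.Holds G c q := funext fun r => propext (this r)
  unfold arrivalMark
  rw [h2, hm]

/-- The agent that enters second rewrites only the near passage, while the one ahead reads and
writes at the far one. So the arrival may be carried out before the departure. -/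
theorem depart_arrive (hij : i ≠ j) {m : M} {l : Line M} :
    (c.depart i p l).arrive G A j p m = (c.arrive G A j p m).depart i p l := by
  have h1 := G.rev_ne p
  simp only [Config.arrive, Config.depart, Config.mk.injEq, true_and]
  classical
  constructor
  · funext q
    have := arrivalMark_congr (G := G) (A := A) (i := j) (m := m) (c := c) (c' := c.depart i p l)
      (depart_mark_of_ne h1) rfl
    simp only [Config.depart] at this
    by_cases h2 : q = p
    · subst h2; simp [h1.symm]
    · by_cases h3 : q = G.rev p
      · subst h3; simpa [h2] using this
      · simp [h2, h3]
  · funext k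
    rcases Agent.eq_or_eq hij k with rfl | rfl <;> simp [hij, hij.symm]

end

section

variable {V P : Type*} {G : WeightedGraph V P} {c : Config V P RMark}
  {e : Agent → ℝ → ℝ} {i j : Agent} {p : P}

noncomputable def transits {M : Type} (G : WeightedGraph V P) (c : Config V P M) : ℝ :=
  ∑ k, (c.loc k).transit G

theorem chosen_out_of_present (hij : i ≠ j) {u : V} {l : Line RMark}
    (hl : chosenLine G rendezvous c i u = some l) (h : Present G c u i.markB) :
    l.out = i.markB := by
  rcases rendezvous_chosen hij hl with rfl | ⟨h1, -⟩
  · rfl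
  · exact absurd h h1

theorem Apart.node_ne {M : Type} {front : M → M → Prop} {c : Config V P M}
    (hc : Apart G front c) (hij : i ≠ j) {u : V} {q : Option P}
    (hi : c.loc i = .node u q) (q' : Option P) : c.loc j ≠ .node u q' := by
  intro hj
  refine hc.apart i j hij (Or.inl ⟨u, ?_, ?_⟩)
  · rw [hi]; rfl
  · rw [hj]; rfl

theorem Apart.end_ne {M : Type} {front : M → M → Prop} {c : Config V P M}
    (hc : Apart G front c) (hij : i ≠ j) {m : M}
    (hi : c.loc i = .edge p (G.len p) m) (q : Option P) :
    c.loc j ≠ .node (G.node (G.rev p)) q := by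
  intro hj
  refine hc.apart i j hij (Or.inl ⟨G.node (G.rev p), ?_, ?_⟩)
  · rw [hi]; exact Or.inr ⟨rfl, rfl⟩
  · rw [hj]; rfl

theorem transit_nonneg {M : Type} {front : M → M → Prop} {c : Config V P M}
    (hc : Apart G front c) (k : Agent) : 0 ≤ (c.loc k).transit G := by
  rcases hk : c.loc k with ⟨v, q⟩ | ⟨r, s, m⟩
  · exact le_rfl
  · exact sub_nonneg.2 (hc.bounds _ _ _ _ hk).2

theorem transits_eq {M : Type} {c : Config V P M} (hij : i ≠ j) :
    transits G c = (c.loc i).transit G + (c.loc j).transit G :=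
  Agent.sum_eq hij _

theorem transits_depart {M : Type} {c : Config V P M} (hij : i ≠ j) {u : V} {q : Option P}
    (hi : c.loc i = .node u q) {l : Line M} : transits G (c.depart i p l) = transits G c + G.len p := by
  rw [transits_eq hij, transits_eq hij, depart_loc_self, depart_loc_other hij, hi]
  simp only [Loc.transit]; ring

theorem transits_arrive {M : Type} {A : Algorithm M} {c : Config V P M} (hij : i ≠ j) {m m' : M}
    (hi : c.loc i = .edge p (G.len p) m) :
    transits G (c.arrive G A i p m') = transits G c := by
  rw [transits_eq hij, transits_eq hij, arrive_loc_self, arrive_loc_other hij, hi]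
  simp [Loc.transit]

variable [Fintype P]

/-! ### The invariant of the rendezvous algorithm -/

/-- An agent has entered an edge behind the other one. -/
def Tailing (G : WeightedGraph V P) (c : Config V P RMark) (R : ℝ) : Prop :=
  0 ≤ R ∧ ∃ i j p m m', i ≠ j ∧ c.loc i = .edge p 0 m ∧ c.loc j = .edge p 0 m' ∧
    RMark.front m' m ∧
    (Calm G (c.arrive G rendezvous j p m') R ∨ Cornered G (c.arrive G rendezvous j p m'))

/-- The configurations in which the agents do not face each other in an edge. -/
def Phase (G : WeightedGraph V P) (c : Config V P RMark) (R : ℝ) : Prop :=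
  Calm G c R ∨ Tailing G c R ∨ (0 ≤ R ∧ Cornered G c)

/-- The agents move towards each other in an edge. -/
def Facing (c : Config V P RMark) (G : WeightedGraph V P) (p : P) : Prop :=
  ∃ i j s m s' m', i ≠ j ∧ c.loc i = .edge p s m ∧ c.loc j = .edge (G.rev p) s' m'

/-- When the agents have spent the energy `κ` without having met, the energy `B` is enough. -/
structure Pending (G : WeightedGraph V P) (c : Config V P RMark) (κ B : ℝ) : Prop where
  apart : Apart G RMark.front c
  arrived : ∀ k u q, c.loc k = .node u (some q) → G.node q = u
  phase : (∃ R, Phase G c.flat R ∧ κ + R + transits G c ≤ B) ∨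
    ∃ p, Facing c G p ∧ κ + transits G c ≤ B + G.len p

theorem Phase.nonneg {R : ℝ} (h : Phase G c R) : 0 ≤ R := by
  rcases h with h | h | h
  · exact h.nonneg
  · exact h.1
  · exact h.1

/-- The length of the entered edge moves from the fund `R` to the distances still to be covered, so
the account is unchanged. The only unpaid departure is one against the other agent. -/
theorem Pending.depart {κ B : ℝ} (h : Pending G c κ B) (hij : i ≠ j) {u : V} {q : Option P}
    (hi : c.loc i = .node u q) {l : Line RMark} (hl : chosenLine G rendezvous c i u = some l)
    (hu : G.node p = u) (hp : c.mark p = l.out)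
    (htie : ∀ q', q = some q' → c.mark q' = l.out → p = q') : Pending G (c.depart i p l) κ B := by
  have hap := h.apart.node_ne hij hi
  have hap' : ∀ q', c.flat.loc j ≠ .node u q' := fun q' hq' =>
    hap q' (Config.flat_loc_node.1 hq')
  have htr := transits_depart (G := G) (p := p) (l := l) hij hi
  have harr : ∀ k v r, (c.depart i p l).loc k = .node v (some r) → G.node r = v := by
    intro k v r hk
    rcases Agent.eq_or_eq hij k with rfl | rfl
    · rw [depart_loc_self] at hk; cases hk
    · rw [depart_loc_other hij] at hk; exact h.arrived _ _ _ hk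
  have hi' : c.flat.loc i = .node u q := Config.flat_loc_node.2 hi
  rcases h.phase with ⟨R, hR, hB⟩ | ⟨r, ⟨i', j', s, m, s', m', h1, h2, h3⟩, -⟩
  · have hR0 := hR.nonneg
    -- Nothing is taken from `R` here. The agents will meet before they have covered the edge twice,
    -- so the facing phase may carry an excess of `G.len p`.
    have facing : ∀ s m, c.loc j = .edge (G.rev p) s m →
        Pending G (c.depart i p l) κ B := by
      intro s m hj
      refine ⟨h.apart.depart hij hi hu fun s' m' hs' => ?_, harr, Or.inr ⟨p, ?_, by linarith⟩⟩
      · rw [hj] at hs'; injection hs' with h1; exact absurd h1 (G.rev_ne p)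
      · exact ⟨i, j, _, _, s, m, hij, depart_loc_self, by rw [depart_loc_other hij, hj]⟩
    rcases hR with hR | ⟨-, i', j', r, m, m', h1, h2, h3, -⟩ | ⟨-, i', j', r, m, h1, h2, h3, h4⟩
    · by_cases ho : ∃ s m, c.loc j = .edge (G.rev p) s m
      · obtain ⟨s, m, hj⟩ := ho
        exact facing s m hj
      have hd := hR.departure hij hi' hap' hl hu hp htie fun m hm => by
        obtain ⟨s, hs⟩ := Config.exists_of_flat_loc_edge hm
        exact ho ⟨s, m, hs⟩
      have hd0 := hd.nonneg
      -- If `j` is ahead in the same edge, it will attain the node before `i` does; what is recorded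
      -- is the state after that arrival.
      by_cases hs : ∃ s m, c.loc j = .edge p s m
      · obtain ⟨s, m, hj⟩ := hs
        obtain ⟨hf, hr⟩ := hd.behind m (Config.flat_loc_edge hj)
        refine ⟨h.apart.depart hij hi hu fun s' m' hs' => ?_, harr, Or.inl ⟨R - G.len p, ?_, ?_⟩⟩
        · rw [hj] at hs'; cases hs'
          exact not_lt_of_gt hf
        · refine Or.inr (Or.inl ⟨by linarith, i, j, p, l.out, m, hij, ?_, ?_, hf, ?_⟩)
          · rw [Config.flat_depart]; exact depart_loc_self
          · rw [Config.flat_depart, depart_loc_other hij]; exact Config.flat_loc_edge hj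
          · rw [Config.flat_depart]
            rw [depart_arrive hij]
            refine hr.imp id fun hr => ⟨i, j, p, l.out, hij, depart_loc_self, ?_, ?_⟩
            · rw [depart_loc_other hij, arrive_loc_self]
            · rw [depart_mark_of_ne (G.rev_ne p), hr]
        · linarith
      · have := hd.alone fun m hm => by
          obtain ⟨s, hs'⟩ := Config.exists_of_flat_loc_edge hm
          exact hs ⟨s, m, hs'⟩
        refine ⟨h.apart.depart hij hi hu fun s' m' hs' => absurd ⟨s', m', hs'⟩ hs, harr,
          Or.inl ⟨R - G.len p, ?_, by linarith⟩⟩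
        rw [← Config.flat_depart] at this
        exact this.imp id fun h1 => Or.inr ⟨by linarith, h1⟩
    · rcases Agent.eq_or_eq h1 i with rfl | rfl
      · rw [hi'] at h2; cases h2
      · rw [hi'] at h3; cases h3
    · rcases Agent.eq_or_eq h1 i with rfl | rfl
      · rw [hi'] at h2; cases h2
      · obtain rfl := (Agent.eq_or_eq hij i').resolve_left h1
        rw [hi'] at h3; cases h3
        -- The cornered agent must use a passage with $B$, and retracing sends it into the edge in
        -- which the other agent is coming.
        have hB := chosen_out_of_present hij hl ⟨_, rfl, h4⟩
        obtain rfl := htie _ rfl (h4.trans hB.symm)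
        obtain ⟨s, hs⟩ := Config.exists_of_flat_loc_edge h2
        exact facing s m (by rw [G.rev_rev, hs])
  · rcases Agent.eq_or_eq h1 i with rfl | rfl
    · rw [hi] at h2; cases h2
    · rw [hi] at h3; cases h3

theorem Pending.arrive {κ B : ℝ} (h : Pending G c κ B) (hij : i ≠ j) {m : RMark}
    (hi : c.loc i = .edge p (G.len p) m) : Pending G (c.arrive G rendezvous i p m) κ B := by
  have hap := h.apart.end_ne hij hi
  refine ⟨h.apart.arrive hij hi, fun k v r hk => ?_, Or.inl ?_⟩
  · rcases Agent.eq_or_eq hij k with rfl | rfl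
    · rw [arrive_loc_self] at hk; cases hk; rfl
    · rw [arrive_loc_other hij] at hk; exact h.arrived _ _ _ hk
  rcases h.phase with ⟨R, hR, hB⟩ | ⟨r, ⟨i', j', s, m, s', m', h1, h2, h3⟩, -⟩
  · refine ⟨R, ?_, by rwa [transits_arrive hij hi]⟩
    have hi' : c.flat.loc i = .edge p 0 m := Config.flat_loc_edge hi
    rw [Config.flat_arrive]
    rcases hR with hR | ⟨hR, i', j', r, m, m', h1, h2, h3, h4, h5⟩ |
      ⟨-, i', j', r, m, h1, h2, h3, h4⟩
    · exact Or.inl (hR.arrive hij hi' fun q hq => hap q (Config.flat_loc_node.1 hq))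
    · rcases Agent.eq_or_eq h1 i with rfl | rfl
      · rw [hi'] at h2; cases h2
        obtain ⟨s, hs⟩ := Config.exists_of_flat_loc_edge h3
        -- The agent behind cannot be the first to attain the end: the one ahead would be beyond it.
        have h6 := h.apart.behind _ _ h1.symm _ _ _ _ _ hs hi h4
        have h7 := (h.apart.bounds _ _ _ _ hs).2
        linarith
      · rw [hi'] at h3; cases h3
        exact h5.imp id fun h5 => Or.inr ⟨hR, h5⟩
    · rcases Agent.eq_or_eq h1 i with rfl | rfl
      · rw [hi'] at h2; cases h2
        obtain rfl := (Agent.eq_or_eq hij j').resolve_left h1.symm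
        exact absurd (Config.flat_loc_node.1 h3) (hap _)
      · rw [hi'] at h3; cases h3
  -- Facing agents meet before either of them attains an end of the edge.
  · have h4 := h.apart.opposite _ _ h1 _ _ _ _ _ h2 h3
    have h5 := (h.apart.bounds _ _ _ _ h2).1
    have h6 := (h.apart.bounds _ _ _ _ h3).1
    rcases Agent.eq_or_eq h1 i with rfl | rfl
    · rw [hi] at h2; cases h2; linarith
    · rw [hi] at h3; cases h3; rw [G.len_rev] at h4; linarith

theorem Pending.event {κ B t : ℝ} (h : Pending G c κ B) {c' : Config V P RMark}
    (hev : Event G rendezvous e t i c c') : Pending G c' κ B := by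
  have hij := i.other_ne
  cases hev with
  | depart u q l p hloc hmove hline hp htie =>
    exact h.depart hij hloc hline hp.1 hp.2 (htie trivial)
  | arrive p m hloc hfirst => exact h.arrive hij hloc
  | overtake p m s hloc hother hm =>
    exfalso
    -- Overtaking would have been a meeting: the other agent holds the blank marker, which `front`
    -- places before every other, so it is still ahead.
    have h1 := h.apart.behind _ _ hij.symm _ _ _ _ _ hother hloc
      (by cases m <;> simp [RMark.front, RMark.entry, rendezvous] at hm ⊢)
    have h2 := (h.apart.bounds _ _ _ _ hother).2
    linarith

theorem Pending.chosen_ne_none {κ B : ℝ} (h : Pending G c κ B) {u : V} {q : Option P}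
    (hi : c.loc i = .node u q) : chosenLine G rendezvous c i u ≠ none := by
  have hij := i.other_ne
  have hap := h.apart.node_ne hij hi
  have hi' : c.flat.loc i = .node u q := Config.flat_loc_node.2 hi
  rcases h.phase with ⟨R, hR, hB⟩ | ⟨r, ⟨i', j', s, m, s', m', h1, h2, h3⟩, -⟩
  · rcases hR with hR | ⟨-, i', j', r, m, m', h1, h2, h3, -⟩ | ⟨-, i', j', r, m, h1, h2, h3, h4⟩
    · exact hR.chosen_ne_none hij hi' fun q' hq' => hap q' (Config.flat_loc_node.1 hq')
    · rcases Agent.eq_or_eq h1 i with rfl | rfl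
      · rw [hi'] at h2; cases h2
      · rw [hi'] at h3; cases h3
    · rcases Agent.eq_or_eq h1 i with rfl | rfl
      · rw [hi'] at h2; cases h2
      · rw [hi'] at h3; cases h3
        intro hn
        exact (rendezvous_not_chosen hij hn).1 ⟨_, rfl, h4⟩
  · rcases Agent.eq_or_eq h1 i with rfl | rfl
    · rw [hi] at h2; cases h2
    · rw [hi] at h3; cases h3

theorem Pending.advance {a b B : ℝ} (he : IsAdversary e) (h : Pending G c (cost e a) B)
    (hadv : CanAdvance G rendezvous e c a b)
    (hm : ∀ t ∈ Set.Icc a b, ¬ SamePlace G ((c.advance e a t).loc .ariadne)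
      ((c.advance e a t).loc .theseus)) : Pending G (c.advance e a b) (cost e b) B := by
  -- No agent is stuck, so no energy is lost, and what is spent reduces the distances left inside
  -- the edges by the same amount.
  have htr : cost e b + transits G (c.advance e a b) = cost e a + transits G c := by
    have h1 : ∀ k, ((c.advance e a b).loc k).transit G = (c.loc k).transit G - (e k b - e k a) :=
      fun k => transit_advance hadv fun u q hk => h.chosen_ne_none hk
    unfold transits
    rw [cost_eq_sum, cost_eq_sum, Finset.sum_congr rfl fun k _ => h1 k, Finset.sum_sub_distrib,
      Finset.sum_sub_distrib]
    ring
  refine ⟨h.apart.advance he hadv hm, fun k u q hk => h.arrived k u q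
    (Config.advance_loc_node.1 hk), ?_⟩
  rcases h.phase with ⟨R, hR, hB⟩ | ⟨r, ⟨i', j', s, m, s', m', h1, h2, h3⟩, hB⟩
  · exact Or.inl ⟨R, by rwa [Config.flat_advance], by linarith⟩
  · exact Or.inr ⟨r, ⟨i', j', s + (e i' b - e i' a), m, s' + (e j' b - e j' a), m', h1,
      by rw [Config.advance_loc_edge, h2]; simp, by rw [Config.advance_loc_edge, h3]; simp⟩, by linarith⟩

/-- When nothing is left to be spent, an agent at the end of an edge can be moved to the node. -/
theorem Pending.to_node {B : ℝ} (h : Pending G c B B) (hij : i ≠ j) (hc : Calm G c.flat 0)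
    (ht : transits G c ≤ 0) : ∃ c', Pending G c' B B ∧ Calm G c'.flat 0 ∧ transits G c' ≤ 0 ∧
      c'.loc j = c.loc j ∧ ∃ u q, c'.loc i = .node u q := by
  have h1 := transit_nonneg h.apart i
  have h2 := transit_nonneg h.apart j
  rw [transits_eq hij] at ht
  rcases hi : c.loc i with ⟨u, q⟩ | ⟨p, s, m⟩
  · exact ⟨c, h, hc, by rwa [transits_eq hij], rfl, u, q, hi⟩
  · obtain rfl : s = G.len p := by
      have := (h.apart.bounds _ _ _ _ hi).2
      rw [hi] at h1 ht
      simp only [Loc.transit] at h1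
      have h3 : G.len p - s ≤ 0 := by
        have : (Loc.edge p s m : Loc V P RMark).transit G = G.len p - s := rfl
        linarith
      linarith
    refine ⟨_, h.arrive hij hi, ?_, ?_, arrive_loc_other hij, _, _, arrive_loc_self⟩
    · rw [Config.flat_arrive]
      exact hc.arrive hij (Config.flat_loc_edge hi) fun q hq =>
        h.apart.end_ne hij hi q (Config.flat_loc_node.1 hq)
    · rwa [transits_arrive hij hi, transits_eq hij]

/-- If the agents have not met, then not all of the energy has been spent. -/
theorem Pending.false {B : ℝ} (h : Pending G c B B) : False := by
  have hij : Agent.ariadne ≠ Agent.theseus := by simp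
  have hnn : ∀ k, 0 ≤ (c.loc k).transit G := transit_nonneg h.apart
  rcases h.phase with ⟨R, hR, hB⟩ | ⟨r, ⟨i', j', s, m, s', m', h1, h2, h3⟩, hB⟩
  · have hR0 := hR.nonneg
    have h0 : ∀ k, (c.loc k).transit G ≤ 0 := by
      intro k
      have := hnn k
      have := hnn k.other
      rw [transits_eq k.other_ne] at hB
      linarith
    have hlen : ∀ k p s m, c.loc k = .edge p s m → s = G.len p := by
      intro k p s m hk
      have h1 := (h.apart.bounds _ _ _ _ hk).2
      have h2 := h0 k
      rw [hk] at h2; simp only [Loc.transit] at h2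
      linarith
    rcases hR with hR | ⟨-, i', j', r, m, m', h1, h2, h3, h4, -⟩ | ⟨-, i', j', r, m, h1, h2, h3, h4⟩
    · have ht : transits G c ≤ 0 := by linarith
      obtain rfl : R = 0 := by
        rw [transits_eq hij] at hB
        linarith [hnn .ariadne, hnn .theseus]
      obtain ⟨c1, g1, g2, g3, -, u, q, g4⟩ := h.to_node hij hR ht
      obtain ⟨c2, g5, g6, -, g7, u', q', g8⟩ := g1.to_node hij.symm g2 g3
      rw [← g7] at g4
      obtain ⟨l, hl⟩ := Option.ne_none_iff_exists'.1 (g5.chosen_ne_none g4)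
      have hex : ∃ p, G.node p = u ∧ c2.mark p = l.out := by
        have := List.find?_some hl
        simpa using this
      -- A passage that the convention of retracing permits: the passage of arrival if it carries
      -- the marker, otherwise any one that does.
      obtain ⟨p, hp1, hp2, htie⟩ : ∃ p, G.node p = u ∧ c2.mark p = l.out ∧
          ∀ q', q = some q' → c2.mark q' = l.out → p = q' := by
        by_cases hq : ∃ q', q = some q' ∧ c2.mark q' = l.out ∧ G.node q' = u
        · obtain ⟨q', rfl, hq1, hq2⟩ := hq
          exact ⟨q', hq2, hq1, by simp⟩
        · obtain ⟨p, hp1, hp2⟩ := hex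
          refine ⟨p, hp1, hp2, fun q' hq1 hq2 => absurd ⟨q', hq1, hq2, ?_⟩ hq⟩
          subst hq1
          exact g5.arrived _ _ _ g4
      -- The departure is hypothetical; it suffices that the account would have to contain `G.len p
      -- > 0` for it, while it contains nothing.
      have hd := g6.departure hij (Config.flat_loc_node.2 g4) (fun q' hq' =>
        g5.apart.node_ne hij g4 q' (Config.flat_loc_node.1 hq')) hl hp1 hp2 htie
        fun m hm => by rw [Config.flat_loc_node.2 g8] at hm; cases hm
      have := hd.nonneg
      have := G.len_pos p
      linarith
    · obtain ⟨s, h2⟩ := Config.exists_of_flat_loc_edge h2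
      obtain ⟨s', h3⟩ := Config.exists_of_flat_loc_edge h3
      have := h.apart.behind _ _ h1.symm _ _ _ _ _ h3 h2 h4
      rw [hlen _ _ _ _ h2, hlen _ _ _ _ h3] at this
      exact lt_irrefl _ this
    · obtain ⟨s, h2⟩ := Config.exists_of_flat_loc_edge h2
      rw [Config.flat_loc_node] at h3
      obtain rfl := hlen _ _ _ _ h2
      exact h.apart.end_ne h1 h2 _ h3
  -- Facing agents that have not met have more than `G.len r` of transit left, so less than `B` has
  -- been spent.
  · have h4 := h.apart.opposite _ _ h1 _ _ _ _ _ h2 h3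
    rw [transits_eq h1, h2, h3] at hB
    simp only [Loc.transit, G.len_rev] at hB
    linarith

end

/-! ### Initial configuration of the rendezvous, and the bound of three times the total length -/

section

variable {V P : Type*} {G : WeightedGraph V P} {e : Agent → ℝ → ℝ} {start : Agent → V} {T : ℝ}

/-- At the beginning of the rendezvous algorithm. -/
theorem regular_initial (hs : start .ariadne ≠ start .theseus) (x : P) :
    Regular G (initial rendezvous start) (fun _ => .blank) .ariadne
      ⟨0, fun _ => x, fun _ => start .ariadne, .home⟩ .theseus
      ⟨0, fun _ => x, fun _ => start .theseus, .home⟩ := by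
  have half : ∀ (i j : Agent) (S' : Trail V P), Half G (initial rendezvous start)
      (fun _ => .blank) i ⟨0, fun _ => x, fun _ => start i, .home⟩ j S' := by
    intro i j S'
    constructor
    · intro n hn; cases hn
    · intro n hn m hm _
      exact (Nat.le_zero.1 hn).trans (Nat.le_zero.1 hm).symm
    · intro n _; exact rfl
    · intro n hn; cases hn
    · intro q hq; exact hq.elim
    · intro q hq; cases hq
    · intro q hq; cases hq
    · intro _; exact Or.inl ⟨none, rfl⟩
    · intro a b hq; cases hq
  constructor
  · exact half _ _ _
  · exact half _ _ _
  · rintro n m (hn | ⟨-, _, hn⟩) _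
    · cases hn
    · exact hn.elim
  · exact fun p => Or.inl ⟨rfl, rfl⟩
  · exact fun p => Or.inl rfl
  · exact fun _ p _ hp => ⟨0, le_rfl, (Set.mem_singleton_iff.1 hp).symm⟩
  · exact fun _ p _ hp => ⟨0, le_rfl, (Set.mem_singleton_iff.1 hp).symm⟩
  · exact fun _ p hp => absurd rfl hp
  · exact fun _ w h1 h2 => absurd ((Set.mem_singleton_iff.1 h1).symm.trans
      (Set.mem_singleton_iff.1 h2)) hs

theorem pending_initial [Fintype P] (hs : start .ariadne ≠ start .theseus) :
    Pending G (initial rendezvous start) 0 (3 * G.totalLength) := by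
  -- An empty trail still needs a default passage. There is one, because a connected graph with two
  -- distinct nodes has an edge.
  obtain ⟨x⟩ : Nonempty P := by
    by_contra hP
    rw [not_nonempty_iff] at hP
    exact hs (G.mem_of_closed (S := {start .theseus}) rfl (fun p => hP.elim p) _)
  constructor
  · constructor
    · intro i p s m h; cases h
    · intro i j _ p s m s' m' h; cases h
    · intro i j _ p s m s' m' h; cases h
    · refine apart_of_ariadne ?_
      rintro (⟨v, h1, h2⟩ | ⟨p, s, h1, -⟩)
      · exact hs (Eq.trans h1 (Eq.symm h2))
      · exact h1.elim
  · intro k u q h; cases h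
  -- Every passage is blank, of weight 3/2, and each edge has two passages.
  · refine Or.inl ⟨3 * G.totalLength, Or.inl ⟨_, ?_, Or.inl ⟨_, _, regular_initial hs x⟩⟩, ?_⟩
    · rw [energy, WeightedGraph.totalLength, ← Finset.mul_sum]
      simp only [RMark.weight_eq]
      linarith
    · simp [transits, initial, Loc.transit]

/-- Rendezvous of two agents. -/
theorem rendezvous_meetAt [Fintype P] (he : IsAdversary e) (x : Run G rendezvous e start T)
    (hT : 3 * G.totalLength ≤ cost e T) :
    ∃ t ∈ Set.Icc 0 T, x.MeetAt t ∧ cost e t ≤ 3 * G.totalLength := by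
  obtain ⟨t₁, ht₁, hc⟩ := exists_cost_eq he x.nonneg
    (mul_nonneg (by norm_num) G.totalLength_nonneg) hT
  obtain ⟨k, hk, hk1, hk2⟩ := x.exists_index ht₁
  have key := x.sweep he (fun t c => Pending G c (cost e t) (3 * G.totalLength))
    (fun t => ∃ r ∈ Set.Icc 0 t, x.MeetAt r)
    (fun t t' htt ⟨r, hr, hm⟩ => ⟨r, ⟨hr.1, hr.2.trans htt⟩, hm⟩) ?_ ?_ ?_ hk hk1 hk2
  · rcases key with ⟨r, hr, hm⟩ | h
    · exact ⟨r, ⟨hr.1, hr.2.trans ht₁.2⟩, hm, hc ▸ cost_mono he hr.2⟩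
    · rw [hc] at h
      exact h.false.elim
  · by_cases hs : start .ariadne = start .theseus
    · refine Or.inl ⟨0, ⟨le_rfl, le_rfl⟩, _, x.time_zero ▸ x.isAt_config (Nat.zero_le _), ?_⟩
      rw [x.config_zero]
      exact Or.inl ⟨start .ariadne, rfl, hs.symm⟩
    · right
      have : cost e 0 = 0 := by simp [cost, he.zero]
      rw [this]
      exact pending_initial hs
  · intro k hk t h1 h2 hadv h
    by_cases hm : ∃ r ∈ Set.Icc 0 t, x.MeetAt r
    · exact Or.inl hm
    · refine Or.inr (h.advance he hadv fun r hr hsame => hm ⟨r, ⟨?_, hr.2⟩, _,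
        x.isAt hk hr.1 (hr.2.trans h2), hsame⟩)
      exact (x.time_nonneg (by omega)).trans hr.1
  · exact fun k hk i hev h => Or.inr (h.event hev)

end

/-! ### The structure of partially explored graphs -/

section

variable {V P : Type*} {G : WeightedGraph V P} {c c' : Config V P EMark} {i j : Agent} {p : P}
  {X X' T : P → Prop} {a b : V}

/-- The node `v` has been discovered. -/
def Known (c : Config V P EMark) (v : V) : Prop := ∃ k, v ∈ c.visited k

open Classical in
/-- The parity of the number of passages in `T` at a node. -/
noncomputable def parity [Fintype P] (G : WeightedGraph V P) (T : P → Prop) (v : V) : ZMod 2 :=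
  ∑ p, if T p ∧ G.node p = v then 1 else 0

open Classical in
noncomputable def indicator (a v : V) : ZMod 2 := if a = v then 1 else 0

theorem add_self_zmod_two (x : ZMod 2) : x + x = 0 := by
  revert x; decide

/-- The edge of `p`, as a set of passages. -/
def WeightedGraph.Same (G : WeightedGraph V P) (p q : P) : Prop := q = p ∨ q = G.rev p

theorem WeightedGraph.same_rev {q : P} : G.Same p (G.rev q) ↔ G.Same p q := by
  unfold WeightedGraph.Same
  rw [← G.eq_rev_iff, G.rev_injective.eq_iff, or_comm]

theorem WeightedGraph.rev_same {q : P} : G.Same (G.rev p) q ↔ G.Same p q := by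
  unfold WeightedGraph.Same
  rw [G.rev_rev, or_comm]

/-- An edge contributes one passage at each of its ends. Modulo 2, removing them is adding two
indicators, and for a loop these cancel. -/
theorem parity_erase [Fintype P] {T' : P → Prop} (hT' : ∀ q, T' q ↔ T q ∧ ¬ G.Same p q)
    (hp : T p) (hp' : T (G.rev p)) (v : V) :
    parity G T' v =
      parity G T v + (indicator (G.node p) v + indicator (G.node (G.rev p)) v) := by
  classical
  have h1 : ∀ f : P → ZMod 2, ∑ q, f q = (∑ q ∈ Finset.univ \ {p, G.rev p}, f q) +
      (f p + f (G.rev p)) := by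
    intro f
    rw [← Finset.sum_pair (G.rev_ne p).symm]
    exact (Finset.sum_sdiff (Finset.subset_univ _)).symm
  unfold parity
  rw [h1, h1 (fun q => if T q ∧ G.node q = v then 1 else 0)]
  have h2 : ∑ q ∈ Finset.univ \ {p, G.rev p}, (if T' q ∧ G.node q = v then (1 : ZMod 2) else 0) =
      ∑ q ∈ Finset.univ \ {p, G.rev p}, if T q ∧ G.node q = v then 1 else 0 := by
    refine Finset.sum_congr rfl fun q hq => ?_
    simp only [Finset.mem_sdiff, Finset.mem_univ, Finset.mem_insert, Finset.mem_singleton,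
      true_and] at hq
    simp [hT', WeightedGraph.Same, hq]
  have h3 : ¬ T' p := by simp [hT', WeightedGraph.Same]
  have h4 : ¬ T' (G.rev p) := by simp [hT', WeightedGraph.Same]
  rw [h2]
  simp only [h3, h4, hp, hp', indicator, false_and, if_false, true_and, add_zero]
  rw [add_assoc, add_self_zmod_two, add_zero]

theorem parity_insert [Fintype P] (hp : ¬ T p) (hp' : ¬ T (G.rev p)) (v : V) :
    parity G (fun q => T q ∨ G.Same p q) v =
      parity G T v + (indicator (G.node p) v + indicator (G.node (G.rev p)) v) := by
  rw [parity_erase (T := fun q => T q ∨ G.Same p q) (T' := T) (p := p) (fun q => ?_)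
    (Or.inr (Or.inl rfl)) (Or.inr (Or.inr rfl)), add_assoc, add_self_zmod_two, add_zero]
  refine ⟨fun h => ⟨Or.inl h, ?_⟩, fun h => h.1.resolve_right h.2⟩
  rintro (rfl | rfl) <;> contradiction

/-- Partially explored graphs: `X` are the passages of edges that agents are dealing with, `T` those
of edges that are yet to be traversed back, which are paths between the nodes `a` and `b`. -/
structure Core [Fintype P] (G : WeightedGraph V P) (c : Config V P EMark) (X T : P → Prop)
    (a b : V) : Prop where
  cls : ∀ p, ¬ X p → T p ∨ (c.mark p = .blank ∧ c.mark (G.rev p) = .blank) ∨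
    (c.mark p = .D ∧ c.mark (G.rev p) = .D)
  tree : ∀ p, T p → T (G.rev p) ∧ ¬ X p ∧ ((c.mark p = .E ∧ c.mark (G.rev p) = .F) ∨
    (c.mark p = .F ∧ c.mark (G.rev p) = .E))
  parity : ∀ v, parity G T v = indicator a v + indicator b v
  rank : ∃ rank : V → ℕ, ∀ p, T p → c.mark p = .E → rank (G.node p) < rank (G.node (G.rev p))
  uniq : ∀ p q, T p → T q → c.mark p = .F → c.mark q = .F → G.node p = G.node q → p = q
  known : ∀ p, ¬ X p → c.mark p ≠ .blank → Known c (G.node p)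
  blank : ∀ p, c.mark p = .blank → Known c (G.node p) →
    G.node p = a ∨ G.node p = b ∨ ∃ q, T q ∧ G.node q = G.node p

variable [Fintype P]

theorem Core.symm (h : Core G c X T a b) : Core G c X T b a :=
  { h with
    parity := fun v => by rw [h.parity, add_comm]
    blank := fun p h1 h2 => by have := h.blank p h1 h2; tauto }

theorem Core.frame (h : Core G c X T a b) (hk : ∀ v, Known c' v ↔ Known c v)
    (hm : ∀ q, ¬ X q → c'.mark q = c.mark q ∧ c'.mark (G.rev q) = c.mark (G.rev q))
    (hb : ∀ q, c'.mark q = .blank → c.mark q = .blank) : Core G c' X T a b where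
  cls p hp := by rw [(hm p hp).1, (hm p hp).2]; exact h.cls p hp
  tree p hp := by
    have := hm p (h.tree p hp).2.1
    rw [this.1, this.2]; exact h.tree p hp
  parity := h.parity
  rank := by
    obtain ⟨rank, hr⟩ := h.rank
    refine ⟨rank, fun p hp => ?_⟩
    rw [(hm p (h.tree p hp).2.1).1]; exact hr p hp
  uniq p q hp hq := by
    rw [(hm p (h.tree p hp).2.1).1, (hm q (h.tree q hq).2.1).1]; exact h.uniq p q hp hq
  known p hp := by rw [(hm p hp).1, hk]; exact h.known p hp
  blank p hp := by rw [hk]; exact h.blank p (hb p hp)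

theorem Core.enlarge (h : Core G c X T a b) (hX : ∀ q, X q → X' q) (hT : ∀ q, T q → ¬ X' q) :
    Core G c X' T a b :=
  { h with
    cls := fun p hp => h.cls p fun h' => hp (hX p h')
    tree := fun p hp => ⟨(h.tree p hp).1, hT p hp, (h.tree p hp).2.2⟩
    known := fun p hp => h.known p fun h' => hp (hX p h') }

theorem Core.shrink (h : Core G c X T a b) (hX : ∀ q, X' q → X q)
    (hD : ∀ q, X q → ¬ X' q → c.mark q = .D ∧ c.mark (G.rev q) = .D ∧ Known c (G.node q)) :
    Core G c X' T a b :=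
  { h with
    cls := fun p hp => by
      by_cases h1 : X p
      · have := hD p h1 hp; tauto
      · exact h.cls p h1
    tree := fun p hp => ⟨(h.tree p hp).1, fun h' => (h.tree p hp).2.1 (hX p h'), (h.tree p hp).2.2⟩
    known := fun p hp hm => by
      by_cases h1 : X p
      · exact (hD p h1 hp).2.2
      · exact h.known p h1 hm }

/-- An agent takes a passage of the tree. -/
theorem Core.cut (h : Core G c X T (G.node p) b) (hp : T p)
    (hb : ∀ q, G.node q = G.node p → c.mark q ≠ .blank) :
    Core G c (fun q => X q ∨ G.Same p q) (fun q => T q ∧ ¬ G.Same p q) (G.node (G.rev p)) b where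
  cls q hq := by
    have := h.cls q fun h' => hq (Or.inl h')
    tauto
  tree q hq := by
    obtain ⟨h1, h2, h3⟩ := h.tree q hq.1
    exact ⟨⟨h1, by rw [WeightedGraph.same_rev]; exact hq.2⟩, by tauto, h3⟩
  parity v := by
    -- The indicator of the near end cancels, so the end of the path moves to the other side of the
    -- edge.
    rw [parity_erase (fun _ => Iff.rfl) hp (h.tree p hp).1, h.parity]
    generalize indicator (G.node p) v = x
    have := add_self_zmod_two x
    linear_combination this
  rank := by
    obtain ⟨rank, hr⟩ := h.rank
    exact ⟨rank, fun q hq => hr q hq.1⟩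
  uniq q r hq hr := h.uniq q r hq.1 hr.1
  known q hq := h.known q fun h' => hq (Or.inl h')
  blank q hq hk := by
    rcases h.blank q hq hk with h1 | h1 | ⟨r, h1, h2⟩
    · exact absurd hq (hb q h1)
    · exact Or.inr (Or.inl h1)
    · by_cases h3 : G.Same p r
      · rcases h3 with rfl | rfl
        · exact absurd hq (hb q h2.symm)
        · exact Or.inl h2.symm
      · exact Or.inr (Or.inr ⟨r, ⟨h1, h3⟩, h2⟩)

/-- An agent has discovered a node at the end of the edge of `p`. -/
theorem Core.graft (h : Core G c X T (G.node p) b) (hp : X p) (hp' : X (G.rev p))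
    (hk : ¬ Known c (G.node (G.rev p))) (hkp : Known c (G.node p))
    (hk' : ∀ v, Known c' v ↔ v = G.node (G.rev p) ∨ Known c v)
    (hm : ∀ q, q ≠ G.rev p → c'.mark q = c.mark q)
    (hE : c.mark p = .E) (hF : c'.mark (G.rev p) = .F)
    (hX : ∀ q, X q ↔ X' q ∨ G.Same p q) (hX' : ∀ q, X' q → ¬ G.Same p q) :
    Core G c' X' (fun q => T q ∨ G.Same p q) (G.node (G.rev p)) b := by
  have hmT : ∀ q, ¬ X q → c'.mark q = c.mark q ∧ c'.mark (G.rev q) = c.mark (G.rev q) := by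
    intro q hq
    refine ⟨hm q ?_, hm _ ?_⟩
    · rintro rfl; exact hq hp'
    · rintro h1; rw [← G.rev_injective h1] at hp; exact hq hp
  -- Nodes with tree passages are discovered, so the new node meets no tree edge other than the one
  -- being added.
  have hTw : ∀ q, T q → G.node q ≠ G.node (G.rev p) := by
    intro q hq h1
    obtain ⟨-, h2, h3⟩ := h.tree q hq
    exact hk (h1 ▸ h.known q h2 (by rcases h3 with h3 | h3 <;> simp [h3.1]))
  have hEp : c'.mark p = .E := by rw [hm p (G.rev_ne p).symm, hE]
  have hkw : G.node p ≠ G.node (G.rev p) := fun h1 => hk (h1 ▸ hkp)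
  constructor
  · intro q hq
    by_cases h1 : G.Same p q
    · exact Or.inl (Or.inr h1)
    · have h2 : ¬ X q := by rw [hX]; tauto
      rw [(hmT q h2).1, (hmT q h2).2]
      have := h.cls q h2; tauto
  · rintro q (hq | hq)
    · obtain ⟨h1, h2, h3⟩ := h.tree q hq
      rw [(hmT q h2).1, (hmT q h2).2]
      exact ⟨Or.inl h1, fun h4 => h2 ((hX q).2 (Or.inl h4)), h3⟩
    · refine ⟨Or.inr (WeightedGraph.same_rev.2 hq), fun h1 => hX' q h1 hq, ?_⟩
      rcases hq with rfl | rfl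
      · exact Or.inl ⟨hEp, hF⟩
      · rw [G.rev_rev]; exact Or.inr ⟨hF, hEp⟩
  · intro v
    rw [parity_insert (fun h1 => (h.tree _ h1).2.1 hp) (fun h1 => (h.tree _ h1).2.1 hp'), h.parity]
    generalize indicator (G.node p) v = x
    have := add_self_zmod_two x
    linear_combination this
  · classical
    obtain ⟨rank, hr⟩ := h.rank
    -- The new node is a leaf; putting it just above its parent disturbs no other edge.
    refine ⟨Function.update rank (G.node (G.rev p)) (rank (G.node p) + 1), ?_⟩
    rintro q (hq | rfl | rfl) hqE
    · have h1 := h.tree q hq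
      rw [(hmT q h1.2.1).1] at hqE
      rw [Function.update_of_ne (hTw q hq), Function.update_of_ne (hTw _ h1.1)]
      exact hr q hq hqE
    · rw [Function.update_of_ne hkw, Function.update_self]
      exact Nat.lt_succ_self _
    · rw [hF] at hqE; cases hqE
  · have key : ∀ q, T q ∨ G.Same p q → c'.mark q = .F → (T q ∧ c.mark q = .F) ∨ q = G.rev p := by
      rintro q (hq | rfl | rfl) hqF
      · rw [(hmT q (h.tree q hq).2.1).1] at hqF
        exact Or.inl ⟨hq, hqF⟩
      · rw [hEp] at hqF; cases hqF
      · exact Or.inr rfl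
    intro q r hq hr hqF hrF hqr
    rcases key q hq hqF with ⟨h1, h2⟩ | rfl <;> rcases key r hr hrF with ⟨h3, h4⟩ | rfl
    · exact h.uniq q r h1 h3 h2 h4 hqr
    · exact absurd hqr (hTw q h1)
    · exact absurd hqr.symm (hTw r h3)
    · rfl
  · intro q hq hqm
    rw [hk']
    by_cases h1 : G.Same p q
    · rcases h1 with rfl | rfl
      · exact Or.inr hkp
      · exact Or.inl rfl
    · have h2 : ¬ X q := by rw [hX]; tauto
      rw [(hmT q h2).1] at hqm
      exact Or.inr (h.known q h2 hqm)
  · intro q hq hkq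
    rw [hk'] at hkq
    rcases hkq with hkq | hkq
    · exact Or.inl hkq
    · have h1 : q ≠ G.rev p := by rintro rfl; rw [hF] at hq; cases hq
      rw [hm q h1] at hq
      rcases h.blank q hq hkq with h2 | h2 | ⟨r, h2, h3⟩
      · exact Or.inr (Or.inr ⟨p, Or.inr (Or.inl rfl), h2.symm⟩)
      · exact Or.inr (Or.inl h2)
      · exact Or.inr (Or.inr ⟨r, Or.inl h2, h3⟩)

/-- If the ends of the paths agree, then there are no paths. -/
theorem Core.tree_empty (h : Core G c X T a a) (p : P) : ¬ T p := by
  classical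
  intro hp
  obtain ⟨rank, hr⟩ := h.rank
  have hex : (Finset.univ.filter fun q => T q ∧ c.mark q = .F).Nonempty := by
    obtain ⟨h1, -, h2 | h2⟩ := h.tree p hp
    · exact ⟨G.rev p, by simp [h1, h2.2]⟩
    · exact ⟨p, by simp [hp, h2.1]⟩
  -- An $F$ of maximal rank sits at a leaf: a second $F$ there is excluded by `uniq`, and an $E$
  -- there would lead to an $F$ of larger rank. A leaf has odd degree, but all degrees are even.
  obtain ⟨q, hq, hmax⟩ := Finset.exists_max_image _ (fun q => rank (G.node q)) hex
  simp only [Finset.mem_filter, Finset.mem_univ, true_and] at hq hmax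
  have h1 := h.parity (G.node q)
  rw [add_self_zmod_two] at h1
  have h2 : MobileAgents.parity G T (G.node q) = 1 := by
    unfold MobileAgents.parity
    rw [Finset.sum_eq_single q]
    · simp [hq.1]
    · intro r _ hrq
      rw [if_neg]
      rintro ⟨h3, h4⟩
      obtain ⟨h5, -, h6 | h6⟩ := h.tree r h3
      · have h7 := hmax (G.rev r) ⟨h5, h6.2⟩
        have h8 := hr r h3 h6.1
        rw [h4] at h8; omega
      · exact hrq (h.uniq r q h3 hq.1 h6.1 hq.2 h4)
    · simp
  rw [h1] at h2
  exact absurd h2 (by decide)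

/-- The end of the exploration. -/
theorem Core.finish (h : Core G c X T a a) (ha : Known c a)
    (hb : ∀ p, G.node p = a → c.mark p ≠ .blank)
    (hX : ∀ p, X p → X (G.rev p) ∧ Known c (G.node p)) (p : P) (hp : ¬ X p) :
    c.mark p = .D ∧ c.mark (G.rev p) = .D := by
  have hT := h.tree_empty
  -- A blank passage at a discovered node can only be at an end of the path or on it. Hence there is
  -- none, and the discovered nodes are closed under passing along edges.
  have hbl : ∀ q, Known c (G.node q) → c.mark q ≠ .blank := by
    intro q hq hqb
    rcases h.blank q hqb hq with h1 | h1 | ⟨r, h1, -⟩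
    · exact hb q h1 hqb
    · exact hb q h1 hqb
    · exact hT r h1
  have hall : ∀ v, Known c v := by
    refine G.mem_of_closed (S := {v | Known c v}) ha fun q hq => ?_
    by_cases h1 : X q
    · exact (hX _ (hX q h1).1).2
    · rcases h.cls q h1 with h2 | h2 | h2
      · exact absurd h2 (hT q)
      · exact absurd h2.1 (hbl q hq)
      · refine h.known _ (fun h3 => h1 ?_) (by simp [h2.2])
        rw [← G.rev_rev q]; exact (hX _ h3).1
  rcases h.cls p hp with h2 | h2 | h2
  · exact absurd h2 (hT p)
  · exact absurd h2.1 (hbl p (hall _))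
  · exact h2

end

section

variable {V P : Type*} {G : WeightedGraph V P} {c c' : Config V P EMark} {i j : Agent} {p : P}

/-! ### The table of the exploration algorithm -/

theorem exploration_chosen {u : V} {l : Line EMark}
    (h : chosenLine G exploration c i u = some l) :
    l = ⟨.B, .D, .any, .D⟩ ∨
    (¬ Present G c u .B ∧ ((l.out = .blank ∧ l.newOut = .E) ∨
      (¬ Present G c u .blank ∧ (l = ⟨.F, .D, .any, .D⟩ ∨
        (¬ Present G c u .F ∧ l = ⟨.E, .D, .any, .D⟩))))) := by
  unfold Present
  simp only [chosenLine, exploration, List.find?] at h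
  repeat' split at h
  all_goals simp_all
  all_goals subst h; simp

theorem exploration_not_chosen {u : V} (h : chosenLine G exploration c i u = none) (p : P)
    (hp : G.node p = u) : c.mark p = .D := by
  simp only [chosenLine, exploration, List.find?] at h
  repeat' split at h
  all_goals simp_all
  cases hm : c.mark p
  all_goals first | rfl | exact absurd hm (by solve_by_elim)

theorem exploration_not_chosen_iff {u : V} (h : ∀ p, G.node p = u → c.mark p = .D) :
    chosenLine G exploration c i u = none := by
  simp only [chosenLine, exploration, List.find?_eq_none]
  intro l hl hp
  simp only [decide_eq_true_eq] at hp
  obtain ⟨p, h1, h2⟩ := hp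
  rw [h p h1] at h2
  simp only [List.mem_cons, List.not_mem_nil, or_false] at hl
  rcases hl with rfl | rfl | rfl | rfl | rfl | rfl <;> cases h2

theorem exploration_arrivalMark {m : EMark} {q : P} (hm : m ≠ .D)
    (h : m = .blank → c.mark q = .E) : arrivalMark G exploration c i m q = .D := by
  cases m <;> simp_all [arrivalMark, exploration, List.find?, Reading.Holds]

theorem exploration_arrivalMark_of_known {q : P} (hm : c.mark q ≠ .E) (h : Known c (G.node q)) :
    arrivalMark G exploration c i .blank q = .B := by
  obtain ⟨k, hk⟩ := h
  have : ∃ k, G.node q ∈ c.visited k := ⟨k, hk⟩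
  simp [arrivalMark, exploration, List.find?, Reading.Holds, hm, this]

theorem exploration_arrivalMark_of_not_known {q : P} (hm : c.mark q ≠ .E)
    (h : ¬ Known c (G.node q)) : arrivalMark G exploration c i .blank q = .F := by
  have h2 : ∀ k, G.node q ∉ c.visited k := fun k hk => h ⟨k, hk⟩
  simp [arrivalMark, exploration, List.find?, Reading.Holds, hm, h2]

theorem known_arrive {m : EMark} {v : V} :
    Known (c.arrive G exploration i p m) v ↔ v = G.node (G.rev p) ∨ Known c v := by
  constructor
  · rintro ⟨k, hk⟩
    by_cases h : k = i
    · subst h; rw [arrive_visited_self] at hk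
      exact hk.imp id fun h => ⟨k, h⟩
    · rw [arrive_visited_other fun h' => h h'.symm] at hk
      exact Or.inr ⟨k, hk⟩
  · rintro (rfl | ⟨k, hk⟩)
    · exact ⟨i, by rw [arrive_visited_self]; exact Set.mem_insert _ _⟩
    · exact ⟨k, subset_arrive_visited _ hk⟩

/-! ### The number of traversals to come -/

/-- The number of times that an edge with these markers is still to be entered. -/
noncomputable def pairWeight : EMark → EMark → ℝ
  | .blank, .blank => 2
  | .D, _ => 0
  | _, .D => 0
  | .E, .E => 0
  | _, _ => 1

theorem pairWeight_nonneg (m m' : EMark) : 0 ≤ pairWeight m m' := by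
  cases m <;> cases m' <;> simp [pairWeight]

theorem pairWeight_comm (m m' : EMark) : pairWeight m m' = pairWeight m' m := by
  cases m <;> cases m' <;> rfl

/-- Each edge is counted at both of its passages, hence the division by 2. -/
noncomputable def effort [Fintype P] (G : WeightedGraph V P) (μ : P → EMark) : ℝ :=
  ∑ p, pairWeight (μ p) (μ (G.rev p)) / 2 * G.len p

theorem effort_nonneg [Fintype P] (μ : P → EMark) : 0 ≤ effort G μ :=
  Finset.sum_nonneg fun p _ =>
    mul_nonneg (div_nonneg (pairWeight_nonneg _ _) (by norm_num)) (G.len_pos p).le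

theorem effort_change [Fintype P] {μ μ' : P → EMark}
    (h : ∀ q, ¬ G.Same p q → μ' q = μ q) :
    effort G μ' = effort G μ +
      (pairWeight (μ' p) (μ' (G.rev p)) - pairWeight (μ p) (μ (G.rev p))) * G.len p := by
  classical
  have h1 : ∀ f : P → ℝ, ∑ q, f q = (∑ q ∈ Finset.univ \ {p, G.rev p}, f q) +
      (f p + f (G.rev p)) := by
    intro f
    rw [← Finset.sum_pair (G.rev_ne p).symm]
    exact (Finset.sum_sdiff (Finset.subset_univ _)).symm
  unfold effort
  rw [h1, h1 (fun q => pairWeight (μ q) (μ (G.rev q)) / 2 * G.len q)]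
  have h2 : ∑ q ∈ Finset.univ \ {p, G.rev p}, pairWeight (μ' q) (μ' (G.rev q)) / 2 * G.len q =
      ∑ q ∈ Finset.univ \ {p, G.rev p}, pairWeight (μ q) (μ (G.rev q)) / 2 * G.len q := by
    refine Finset.sum_congr rfl fun q hq => ?_
    have h3 : ¬ G.Same p q := by
      simpa [WeightedGraph.Same] using hq
    rw [h q h3, h _ (by rwa [WeightedGraph.same_rev])]
  rw [h2]
  simp only [G.rev_rev, G.len_rev, pairWeight_comm (μ (G.rev p)) (μ p),
    pairWeight_comm (μ' (G.rev p)) (μ' p)]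
  ring

/-! ### What the agents do -/

/-- What an agent does: it is at a node (`idle`), at the end of the edge of `p` which led it to a
known node (`turn`), explores this edge (`out`), or traverses it for the last time (`fin`). -/
inductive Kind (V P : Type*)
  | idle (v : V)
  | turn (p : P)
  | out (p : P)
  | fin (p : P)

def Kind.Edge (G : WeightedGraph V P) : Kind V P → P → Prop
  | .idle _, _ => False
  | .turn p, q => G.Same p q
  | .out p, q => G.Same p q
  | .fin p, q => G.Same p q

/-- The end of the path of the tree at which the agent is. -/
def Kind.base (G : WeightedGraph V P) : Kind V P → V
  | .idle v => v
  | .turn p => G.node p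
  | .out p => G.node p
  | .fin p => G.node (G.rev p)

/-- Agent `i` is of a kind; `Cv` are the passages of edges that have been explored. -/
def Kind.Fits (G : WeightedGraph V P) (c : Config V P EMark) (Cv : P → Prop) (i : Agent) :
    Kind V P → Prop
  | .idle v => Known c v ∧ ∃ q, c.loc i = .node v q
  | .turn p => Known c (G.node p) ∧ Known c (G.node (G.rev p)) ∧ Cv p ∧
      (∃ q, c.loc i = .node (G.node (G.rev p)) q) ∧ c.mark p = .E ∧ c.mark (G.rev p) = .B
  | .out p => Known c (G.node p) ∧ c.loc i = .edge p 0 .blank ∧ c.mark p = .E ∧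
      c.mark (G.rev p) = .blank
  | .fin p => Known c (G.node p) ∧ Known c (G.node (G.rev p)) ∧ Cv p ∧ c.mark p = .D ∧
      ∃ m, c.loc i = .edge p 0 m ∧ m ≠ .D ∧
        (c.mark (G.rev p) = .E ∨ c.mark (G.rev p) = .F ∧ m ≠ .blank)

variable {Cv : P → Prop} {k ki kj : Kind V P}

theorem Kind.edge_rev (q : P) : k.Edge G (G.rev q) ↔ k.Edge G q := by
  cases k
  · rfl
  all_goals exact WeightedGraph.same_rev

theorem Kind.Fits.frame (h : k.Fits G c Cv i) (hl : c'.loc i = c.loc i)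
    (hk : ∀ v, Known c v → Known c' v) (hm : ∀ q, k.Edge G q → c'.mark q = c.mark q) :
    k.Fits G c' Cv i := by
  have hs : ∀ q : P, G.Same q q := fun q => Or.inl rfl
  have hs' : ∀ q : P, G.Same q (G.rev q) := fun q => Or.inr rfl
  cases k
  · exact ⟨hk _ h.1, by rw [hl]; exact h.2⟩
  · obtain ⟨h1, h2, h3, h4, h5, h6⟩ := h
    exact ⟨hk _ h1, hk _ h2, h3, by rwa [hl], by rwa [hm _ (hs _)], by rwa [hm _ (hs' _)]⟩
  · obtain ⟨h1, h4, h5, h6⟩ := h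
    exact ⟨hk _ h1, by rwa [hl], by rwa [hm _ (hs _)], by rwa [hm _ (hs' _)]⟩
  · obtain ⟨h1, h2, h3, h4, m, h5, h6, h7⟩ := h
    exact ⟨hk _ h1, hk _ h2, h3, by rwa [hm _ (hs _)], m, by rwa [hl], h6, by rwa [hm _ (hs' _)]⟩

variable [Fintype P]

/-- The agents deal with different edges. -/
structure Roles (G : WeightedGraph V P) (c : Config V P EMark) (Cv : P → Prop) (i : Agent)
    (ki : Kind V P) (j : Agent) (kj : Kind V P) : Prop where
  left : ki.Fits G c Cv i
  right : kj.Fits G c Cv j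
  disj : ∀ p, ki.Edge G p → ¬ kj.Edge G p
  core : ∃ T, Core G c (fun p => ki.Edge G p ∨ kj.Edge G p) T (ki.base G) (kj.base G)
  cov : ∀ p, ¬ (ki.Edge G p ∨ kj.Edge G p) → c.mark p ≠ .blank → Cv p

/-- The agents explore the same edge, from both ends. -/
structure Crossing (G : WeightedGraph V P) (c : Config V P EMark) (Cv : P → Prop) (i j : Agent)
    (p : P) : Prop where
  left : c.loc i = .edge p 0 .blank
  right : c.loc j = .edge (G.rev p) 0 .blank
  markL : c.mark p = .E
  markR : c.mark (G.rev p) = .E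
  knownL : Known c (G.node p)
  knownR : Known c (G.node (G.rev p))
  core : ∃ T, Core G c (G.Same p) T (G.node p) (G.node (G.rev p))
  cov : ∀ q, ¬ G.Same p q → c.mark q ≠ .blank → Cv q

/-- Agent `i` explores the last edge, and agent `j` has entered it too. -/
structure Convoy (G : WeightedGraph V P) (c : Config V P EMark) (Cv : P → Prop) (i j : Agent)
    (p : P) : Prop where
  left : c.loc i = .edge p 0 .blank
  right : c.loc j = .edge p 0 .E
  markL : c.mark p = .D
  markR : c.mark (G.rev p) = .blank
  knownL : Known c (G.node p)
  knownR : ¬ Known c (G.node (G.rev p))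
  full : ∀ q, G.node q = G.node p → c.mark q ≠ .blank
  core : ∃ T, Core G c (G.Same p) T (G.node p) (G.node p)
  cov : ∀ q, ¬ G.Same p q → c.mark q ≠ .blank → Cv q

/-- All edges have been explored, and both passages of the edge that the agents have entered from
both ends are discarded. -/
structure Closing (G : WeightedGraph V P) (c : Config V P EMark) (Cv : P → Prop) (i j : Agent)
    (p : P) : Prop where
  left : ∃ m, c.loc i = .edge p 0 m
  right : ∃ m, c.loc j = .edge (G.rev p) 0 m
  markL : c.mark p = .D
  markR : c.mark (G.rev p) = .D
  cov : ∀ q, Cv q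

/-- All edges have been explored, and agent `i` will go back through the edge that `j` has
entered. -/
structure Returning (G : WeightedGraph V P) (c : Config V P EMark) (Cv : P → Prop) (i j : Agent)
    (p : P) : Prop where
  left : ∃ q, c.loc i = .node (G.node (G.rev p)) q
  right : c.loc j = .edge p 0 .E
  markL : c.mark p = .D
  markR : c.mark (G.rev p) = .B
  rest : ∀ q, ¬ G.Same p q → c.mark q = .D
  cov : ∀ q, Cv q

theorem Roles.symm (h : Roles G c Cv i ki j kj) : Roles G c Cv j kj i ki where
  left := h.right
  right := h.left
  disj p h1 h2 := h.disj p h2 h1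
  core := by
    obtain ⟨T, hT⟩ := h.core
    have h1 : (fun p => kj.Edge G p ∨ ki.Edge G p) = fun p => ki.Edge G p ∨ kj.Edge G p :=
      funext fun p => propext or_comm
    exact ⟨T, h1 ▸ hT.symm⟩
  cov p hp := h.cov p fun h1 => hp h1.symm

end

section

variable {V P : Type*} {G : WeightedGraph V P} {c c' : Config V P EMark} {i j : Agent} {p : P}
  {X T Cv : P → Prop} {a b : V} {l : Line EMark} {k ki kj : Kind V P}

/-! ### Departures in the exploration algorithm -/

theorem Kind.Fits.depart (h : k.Fits G c Cv j) (hij : i ≠ j) (hp : ¬ k.Edge G p) :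
    k.Fits G (c.depart i p l) Cv j :=
  h.frame (depart_loc_other hij) (fun _ => id) fun _ hq =>
    depart_mark_of_ne fun h1 => hp (h1 ▸ hq)

theorem Kind.Fits.transfer {u : V} {q q' : Option P} (h : k.Fits G c Cv j)
    (hj : c.loc j = .node u q) (hi : c.loc i = .node u q') : k.Fits G c Cv i := by
  cases k
  · obtain ⟨h1, r, h2⟩ := h
    rw [hj] at h2; cases h2
    exact ⟨h1, _, hi⟩
  · obtain ⟨h1, h2, h3, ⟨r, h4⟩, h5⟩ := h
    rw [hj] at h4; cases h4
    exact ⟨h1, h2, h3, ⟨_, hi⟩, h5⟩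
  · exact absurd (hj.symm.trans h.2.1) (by simp)
  · obtain ⟨-, -, -, -, m, h5, -⟩ := h
    exact absurd (hj.symm.trans h5) (by simp)

/-- An agent at a node without marker `B` is idle. -/
theorem Kind.Fits.eq_idle {u : V} {q : Option P} (h : k.Fits G c Cv i)
    (hi : c.loc i = .node u q) (hB : ¬ Present G c u .B) : k = .idle u := by
  cases k
  · obtain ⟨h1, r, h2⟩ := h
    rw [hi] at h2; cases h2; rfl
  · obtain ⟨h1, h2, h3, ⟨r, h4⟩, h5, h6⟩ := h
    rw [hi] at h4; cases h4
    exact absurd ⟨_, rfl, h6⟩ hB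
  · exact absurd (hi.symm.trans h.2.1) (by simp)
  · obtain ⟨-, -, -, -, m, h5, -⟩ := h
    exact absurd (hi.symm.trans h5) (by simp)

theorem mark_depart_ne_blank {q : P} (hl : l.newOut ≠ .blank) (h : q ≠ p → c.mark q ≠ .blank) :
    (c.depart i p l).mark q ≠ .blank := by
  by_cases h1 : q = p
  · subst h1; rwa [depart_mark_self]
  · rw [depart_mark_of_ne h1]; exact h h1

variable [Fintype P]

theorem effort_depart : effort G (c.depart i p l).mark = effort G c.mark +
    (pairWeight l.newOut (c.mark (G.rev p)) - pairWeight (c.mark p) (c.mark (G.rev p))) *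
      G.len p := by
  rw [effort_change (p := p) (μ := c.mark) fun q hq =>
    depart_mark_of_ne fun h1 => hq (Or.inl h1), depart_mark_self,
    depart_mark_of_ne (G.rev_ne p)]

theorem Core.depart (h : Core G c X T a b) (hp : X p) (hp' : X (G.rev p))
    (hl : l.newOut ≠ .blank) : Core G (c.depart i p l) X T a b := by
  refine h.frame (fun _ => Iff.rfl) (fun q hq => ⟨depart_mark_of_ne ?_, depart_mark_of_ne ?_⟩)
    fun q hq => ?_
  · rintro rfl; exact hq hp
  · intro h1; rw [← h1, G.rev_rev] at hp'; exact hq hp'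
  · by_cases h1 : q = p
    · subst h1; exact absurd (depart_mark_self.symm.trans hq) hl
    · rwa [depart_mark_of_ne h1] at hq

/-- The tables are the same and the choice of passage is free, so at a common node either agent may
use the $B$ left by the other. Agents there can exchange their roles. -/
theorem Roles.swap {u : V} {q q' : Option P} (h : Roles G c Cv i ki j kj)
    (hi : c.loc i = .node u q) (hj : c.loc j = .node u q') : Roles G c Cv i kj j ki :=
  { h.symm with
    left := h.right.transfer hj hi
    right := h.left.transfer hi hj }

theorem Roles.turnBack {q : P} (h : Roles G c Cv i (.turn q) j kj) (hij : i ≠ j)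
    (hCv : ∀ p, Cv (G.rev p) ↔ Cv p) :
    Roles G (c.depart i (G.rev q) ⟨.B, .D, .any, .D⟩) Cv i (.fin (G.rev q)) j kj := by
  obtain ⟨h1, h2, h3, h4, h5, h6⟩ := h.left
  have hs : ∀ r, G.Same (G.rev q) r ↔ G.Same q r := fun r => WeightedGraph.rev_same
  constructor
  · refine ⟨h2, (G.rev_rev q).symm ▸ h1, (hCv q).2 h3, depart_mark_self, _, depart_loc_self,
      (by simp), Or.inl ?_⟩
    rw [depart_mark_of_ne (G.rev_ne _), G.rev_rev, h5]
  · exact h.right.depart hij (h.disj _ (Or.inr rfl))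
  · exact fun p hp => h.disj p ((hs p).1 hp)
  · obtain ⟨T, hT⟩ := h.core
    have hX : (fun p => (Kind.fin (G.rev q)).Edge G p ∨ kj.Edge G p) =
        fun p => (Kind.turn q).Edge G p ∨ kj.Edge G p :=
      funext fun p => propext (or_congr (hs p) Iff.rfl)
    refine ⟨T, ?_⟩
    rw [hX]
    have := hT.depart (i := i) (p := G.rev q) (l := ⟨.B, .D, .any, .D⟩) (Or.inl (Or.inr rfl))
      (Or.inl (by rw [G.rev_rev]; exact Or.inl rfl)) (by simp)
    simpa only [Kind.base, G.rev_rev] using this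
  · intro p hp hm
    have hp' : ¬ G.Same (G.rev q) p := fun h1 => hp (Or.inl h1)
    refine h.cov p (fun h1 => hp (h1.imp (hs p).2 id)) ?_
    rwa [depart_mark_of_ne fun h1 => hp' (Or.inl h1)] at hm

theorem Roles.explore (h : Roles G c Cv i (.idle (G.node p)) j kj) (hij : i ≠ j)
    (hX : ¬ kj.Edge G p) (hp : c.mark p = .blank) (ho : l.out = .blank) (hn : l.newOut = .E) :
    c.mark (G.rev p) = .blank ∧ Roles G (c.depart i p l) Cv i (.out p) j kj := by
  obtain ⟨T, hT⟩ := h.core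
  have hTp : ¬ T p := fun h1 => by
    have := (hT.tree p h1).2.2; simp [hp] at this
  have hTp' : ¬ T (G.rev p) := fun h1 => by
    have := (hT.tree _ h1).1; rw [G.rev_rev] at this; exact hTp this
  have hbb : c.mark (G.rev p) = .blank := by
    rcases hT.cls p (fun h1 => h1.elim id hX) with h1 | h1 | h1
    · exact absurd h1 hTp
    · exact h1.2
    · rw [hp] at h1; cases h1.1
  refine ⟨hbb, ⟨h.left.1, ?_, ?_, ?_⟩, h.right.depart hij hX, ?_, ⟨T, ?_⟩, ?_⟩
  · rw [depart_loc_self, ho]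
  · rw [depart_mark_self, hn]
  · rw [depart_mark_of_ne (G.rev_ne p), hbb]
  · rintro q (rfl | rfl)
    · exact hX
    · rwa [Kind.edge_rev]
  · refine Core.depart (hT.enlarge (fun q hq => Or.inr (hq.elim False.elim id)) fun q hq => ?_)
      (Or.inl (Or.inl rfl)) (Or.inl (Or.inr rfl)) (by simp [hn])
    rintro ((rfl | rfl) | h1)
    · exact hTp hq
    · exact hTp' hq
    · exact (hT.tree q hq).2.1 (Or.inr h1)
  · intro q hq hm
    rw [depart_mark_of_ne fun h1 => hq (Or.inl (Or.inl h1))] at hm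
    exact h.cov q (fun h1 => hq (Or.inr (h1.elim False.elim id))) hm

theorem Roles.meetUnexplored (h : Roles G c Cv i (.idle (G.node (G.rev p))) j (.out p))
    (hij : i ≠ j) (ho : l.out = .blank) (hn : l.newOut = .E) :
    Crossing G (c.depart i (G.rev p) l) Cv j i p := by
  obtain ⟨h1, h2, h3, h4⟩ := h.right
  obtain ⟨T, hT⟩ := h.core
  constructor
  · rw [depart_loc_other hij, h2]
  · rw [depart_loc_self, ho]
  · rw [depart_mark_of_ne (G.rev_ne p).symm, h3]
  · rw [depart_mark_self, hn]
  · exact h1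
  · exact h.left.1
  · have hX : G.Same p = fun q => (Kind.idle (G.node (G.rev p))).Edge G q ∨ (Kind.out p).Edge G q :=
      funext fun q => propext (by simp [Kind.Edge])
    refine ⟨T, ?_⟩
    rw [hX]
    exact Core.depart hT.symm (Or.inr (Or.inr rfl)) (Or.inr (by rw [G.rev_rev]; exact Or.inl rfl))
      (by simp [hn])
  · intro q hq hm
    rw [depart_mark_of_ne fun h1 => hq (Or.inr h1)] at hm
    exact h.cov q (fun h1 => hq (h1.elim False.elim id)) hm

/-- A passage with $F$ or $E$ outside the edge of `j` belongs to the tree, since blank and discarded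
edges carry neither marker. Its last traversal has begun, so the edge is cut off and the end of the
path passes to the other side. -/
theorem Roles.climb (h : Roles G c Cv i (.idle (G.node p)) j kj) (hij : i ≠ j)
    (hX : ¬ kj.Edge G p) (hp : c.mark p = .F ∨ c.mark p = .E)
    (hb : ∀ q, G.node q = G.node p → c.mark q ≠ .blank) (ho : l.out = c.mark p)
    (hn : l.newOut = .D) :
    pairWeight (c.mark p) (c.mark (G.rev p)) = 1 ∧ Roles G (c.depart i p l) Cv i (.fin p) j kj := by
  obtain ⟨T, hT⟩ := h.core
  have hTp : T p := by
    rcases hT.cls p (fun h1 => h1.elim id hX) with h1 | h1 | h1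
    · exact h1
    · rw [h1.1] at hp; simp at hp
    · rw [h1.1] at hp; simp at hp
  have hEF := (hT.tree p hTp).2.2
  refine ⟨by rcases hEF with h1 | h1 <;> simp [h1, pairWeight], ⟨h.left.1, ?_, ?_, ?_, _,
    depart_loc_self, ?_, ?_⟩, h.right.depart hij hX, ?_, ⟨fun q => T q ∧ ¬ G.Same p q, ?_⟩, ?_⟩
  · refine hT.known _ (fun h1 => h1.elim id fun h2 => hX ((Kind.edge_rev p).1 h2)) ?_
    rcases hEF with h1 | h1 <;> simp [h1.2]
  · refine h.cov p (fun h1 => h1.elim id hX) ?_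
    rcases hp with hp | hp <;> simp [hp]
  · rw [depart_mark_self, hn]
  · rw [ho]; rcases hp with hp | hp <;> simp [hp]
  · rw [depart_mark_of_ne (G.rev_ne p), ho]
    rcases hEF with h1 | h1 <;> simp [h1]
  · rintro q (rfl | rfl)
    · exact hX
    · rwa [Kind.edge_rev]
  · have h1 := (hT.cut hTp hb).depart (i := i) (p := p) (l := l) (Or.inr (Or.inl rfl))
      (Or.inr (Or.inr rfl)) (by simp [hn])
    have hXe : (fun q => (Kind.fin p).Edge G q ∨ kj.Edge G q) =
        fun q => ((Kind.idle (G.node p)).Edge G q ∨ kj.Edge G q) ∨ G.Same p q :=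
      funext fun q => propext (by simp [Kind.Edge, or_comm])
    rw [hXe]
    exact h1
  · intro q hq hm
    rw [depart_mark_of_ne fun h1 => hq (Or.inl (Or.inl h1))] at hm
    exact h.cov q (fun h1 => hq (Or.inr (h1.elim False.elim id))) hm

/-- The ends of the path coincide and no passage there is blank, so `Core.finish` applies to
everything but the edge of `j`. -/
theorem Roles.rest_discarded {u : V} (h : Roles G c Cv i (.idle u) j kj) (hu : kj.base G = u)
    (hb : ∀ q, G.node q = u → c.mark q ≠ .blank)
    (hk : ∀ q, kj.Edge G q → Known c (G.node q)) (q : P) (hq : ¬ kj.Edge G q) :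
    c.mark q = .D ∧ c.mark (G.rev q) = .D ∧ Cv q := by
  obtain ⟨T, hT⟩ := h.core
  rw [hu] at hT
  have hq' : ¬ ((Kind.idle u).Edge G q ∨ kj.Edge G q) := fun h1 => h1.elim id hq
  have h1 := hT.finish h.left.1 hb (fun r hr => by
    have hr := hr.resolve_left id
    exact ⟨Or.inr ((Kind.edge_rev r).2 hr), hk r hr⟩) q hq'
  exact ⟨h1.1, h1.2, h.cov q hq' (by simp [h1.1])⟩

/-- The edge traversed by `j` for the last time ends where `i` is, so both ends of the path agree
and all other edges are discarded and covered. -/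
theorem Roles.meetExplored (h : Roles G c Cv i (.idle (G.node (G.rev p))) j (.fin p))
    (hij : i ≠ j) (hb : ∀ q, G.node q = G.node (G.rev p) → c.mark q ≠ .blank)
    (hn : l.newOut = .D) (hCv : ∀ p, Cv (G.rev p) ↔ Cv p) :
    Closing G (c.depart i (G.rev p) l) Cv j i p := by
  obtain ⟨h1, h2, h3, h4, m, h5, h6⟩ := h.right
  constructor
  · exact ⟨m, by rw [depart_loc_other hij, h5]⟩
  · exact ⟨_, depart_loc_self⟩
  · rw [depart_mark_of_ne (G.rev_ne p).symm, h4]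
  · rw [depart_mark_self, hn]
  · intro q
    by_cases hq : G.Same p q
    · rcases hq with rfl | rfl
      · exact h3
      · exact (hCv p).2 h3
    · refine (h.rest_discarded rfl hb ?_ q hq).2.2
      rintro r (rfl | rfl)
      · exact h1
      · exact h2

/-- Both ends of the path are at this node and none of its passages is blank, so the tree is empty.
If the far end were known, its blank passage would have to be at an end of the path or on it; so the
explorer will find a new node. -/
theorem Roles.follow (h : Roles G c Cv i (.idle (G.node p)) j (.out p)) (hij : i ≠ j)
    (hb : ∀ q, G.node q = G.node p → c.mark q ≠ .blank) (ho : l.out = .E) (hn : l.newOut = .D) :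
    Convoy G (c.depart i p l) Cv j i p := by
  obtain ⟨h1, h2, h3, h4⟩ := h.right
  obtain ⟨T, hT⟩ := h.core
  constructor
  · rw [depart_loc_other hij, h2]
  · rw [depart_loc_self, ho]
  · rw [depart_mark_self, hn]
  · rw [depart_mark_of_ne (G.rev_ne p), h4]
  · exact h1
  · intro hk
    rcases hT.blank _ h4 hk with h5 | h5 | ⟨q, h5, -⟩
    · exact hb _ h5 h4
    · exact hb _ h5 h4
    · exact hT.tree_empty q h5
  · exact fun q hq => mark_depart_ne_blank (by simp [hn]) fun _ => hb q hq
  · have hX : G.Same p = fun q => (Kind.idle (G.node p)).Edge G q ∨ (Kind.out p).Edge G q :=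
      funext fun q => propext (by simp [Kind.Edge])
    refine ⟨T, ?_⟩
    rw [hX]
    exact Core.depart hT (Or.inr (Or.inl rfl)) (Or.inr (Or.inr rfl)) (by simp [hn])
  · intro q hq hm
    rw [depart_mark_of_ne fun h1 => hq (Or.inl h1)] at hm
    exact h.cov q (fun h1 => hq (h1.elim False.elim id)) hm

/-- Apart from this edge everything is discarded, and this edge has been covered by `j`. What is
left is that `j` meets `i` on its way back, or that `i` arrives before and leaves `j` without a
line. -/
theorem Roles.letReturn (h : Roles G c Cv i (.idle (G.node p)) j (.turn p)) (hij : i ≠ j)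
    (hb : ∀ q, G.node q = G.node p → c.mark q ≠ .blank) (ho : l.out = .E) (hn : l.newOut = .D)
    (hCv : ∀ p, Cv (G.rev p) ↔ Cv p) : Returning G (c.depart i p l) Cv j i p := by
  obtain ⟨h1, h2, h3, ⟨q, h4⟩, h5, h6⟩ := h.right
  have hrest := h.rest_discarded rfl hb (by
    rintro r (rfl | rfl)
    · exact h1
    · exact h2)
  constructor
  · exact ⟨q, by rw [depart_loc_other hij, h4]⟩
  · rw [depart_loc_self, ho]
  · rw [depart_mark_self, hn]
  · rw [depart_mark_of_ne (G.rev_ne p), h6]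
  · intro q hq
    rw [depart_mark_of_ne fun h1 => hq (Or.inl h1)]
    exact (hrest q hq).1
  · intro q
    by_cases hq : G.Same p q
    · rcases hq with rfl | rfl
      · exact h3
      · exact (hCv p).2 h3
    · exact (hrest q hq).2.2

/-- These are the phases in which the exploration need not be complete. `Closing` and `Returning`
contain it already, and no longer need the fund. -/
def Stage (G : WeightedGraph V P) (c : Config V P EMark) (Cv : P → Prop) : Prop :=
  (∃ i j ki kj, i ≠ j ∧ Roles G c Cv i ki j kj) ∨ (∃ i j p, i ≠ j ∧ Crossing G c Cv i j p) ∨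
    ∃ i j p, i ≠ j ∧ Convoy G c Cv i j p

/-- The passages with marker `B` are those by which the agents will return. -/
theorem Roles.of_markB (h : Roles G c Cv i ki j kj) {u : V} {q : Option P}
    (hi : c.loc i = .node u q) (hu : G.node p = u) (hp : c.mark p = .B) :
    ∃ q kj', p = G.rev q ∧ Roles G c Cv i (.turn q) j kj' := by
  have key : ∀ {k : Kind V P} {i : Agent}, k.Fits G c Cv i → k.Edge G p →
      ∃ q, k = .turn q ∧ p = G.rev q := by
    intro k i hk he
    cases k
    · exact he.elim
    · rcases he with rfl | rfl
      · rw [hk.2.2.2.2.1] at hp; cases hp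
      · exact ⟨_, rfl, rfl⟩
    · rcases he with rfl | rfl
      · rw [hk.2.2.1] at hp; cases hp
      · rw [hk.2.2.2] at hp; cases hp
    · obtain ⟨-, -, -, h4, m, -, -, h7⟩ := hk
      rcases he with rfl | rfl
      · rw [h4] at hp; cases hp
      · rcases h7 with h7 | h7
        · rw [h7] at hp; cases hp
        · rw [h7.1] at hp; cases hp
  by_cases h1 : ki.Edge G p
  · obtain ⟨q, rfl, hq⟩ := key h.left h1
    exact ⟨q, kj, hq, h⟩
  by_cases h2 : kj.Edge G p
  · obtain ⟨r, rfl, hr⟩ := key h.right h2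
    obtain ⟨-, -, -, ⟨q', hj⟩, -⟩ := h.right
    rw [← hr, hu] at hj
    exact ⟨r, ki, hr, h.swap hi hj⟩
  · obtain ⟨T, hT⟩ := h.core
    rcases hT.cls p (fun h3 => h3.elim h1 h2) with h3 | h3 | h3
    · have := (hT.tree p h3).2.2
      simp [hp] at this
    · rw [hp] at h3; cases h3.1
    · rw [hp] at h3; cases h3.1

/-- Every departure lowers the effort by the length of its edge, except one into the edge in which
`j` approaches on its last traversal: the weight is 0 there. It leads to `Closing`, where the
distance left to `j` pays for both agents. -/
theorem Roles.depart (h : Roles G c Cv i ki j kj) (hij : i ≠ j) (hCv : ∀ p, Cv (G.rev p) ↔ Cv p)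
    {u : V} {q : Option P} (hi : c.loc i = .node u q)
    (hl : chosenLine G exploration c i u = some l) (hu : G.node p = u) (hp : c.mark p = l.out) :
    effort G (c.depart i p l).mark + G.len p ≤ effort G c.mark ∧
      (Stage G (c.depart i p l) Cv ∨ Returning G (c.depart i p l) Cv j i p) ∨
    ∃ r, p = G.rev r ∧ Closing G (c.depart i p l) Cv j i r := by
  have hlen := G.len_pos p
  rw [effort_depart]
  rcases exploration_chosen hl with rfl | ⟨hB, hl⟩
  · obtain ⟨r, kj', rfl, h'⟩ := h.of_markB hi hu hp
    have h5 := h'.left.2.2.2.2.1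
    refine Or.inl ⟨?_, Or.inl (Or.inl ⟨i, j, _, _, hij, h'.turnBack hij hCv⟩)⟩
    rw [hp, G.rev_rev, h5]; simp [pairWeight]
  obtain rfl := h.left.eq_idle hi hB
  rcases hl with ⟨ho, hn⟩ | ⟨hb, hl⟩
  · rw [ho] at hp
    subst hu
    by_cases hX : kj.Edge G p
    · cases kj
      · exact hX.elim
      · obtain ⟨-, -, -, -, h5, h6⟩ := h.right
        rcases hX with rfl | rfl <;> simp_all
      · rename_i r
        obtain ⟨-, -, h3, h4⟩ := h.right
        rcases hX with rfl | rfl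
        · rw [hp] at h3; cases h3
        · refine Or.inl ⟨?_, Or.inl (Or.inr (Or.inl ⟨j, i, _, hij.symm, h.meetUnexplored hij ho hn⟩))⟩
          rw [hp, hn, G.rev_rev, h3]; simp [pairWeight]
      · obtain ⟨-, -, -, h4, m, -, -, h7⟩ := h.right
        rcases hX with rfl | rfl <;> simp_all
    · obtain ⟨h1, h2⟩ := h.explore hij hX hp ho hn
      refine Or.inl ⟨?_, Or.inl (Or.inl ⟨i, j, _, _, hij, h2⟩)⟩
      rw [hp, h1, hn]; simp only [pairWeight]; linarith
  · have hb' : ∀ q, G.node q = u → c.mark q ≠ .blank := fun q h1 h2 => hb ⟨q, h1, h2⟩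
    have hl' : (l.out = .F ∨ l.out = .E) ∧ l.newOut = .D := by
      rcases hl with rfl | ⟨-, rfl⟩ <;> simp
    obtain ⟨ho, hn⟩ := hl'
    rw [← hp] at ho
    subst hu
    by_cases hX : kj.Edge G p
    · cases kj
      · exact hX.elim
      · obtain ⟨-, -, -, -, h5, h6⟩ := h.right
        rcases hX with rfl | rfl
        · refine Or.inl ⟨?_, Or.inr (h.letReturn hij hb' (hp ▸ h5) hn hCv)⟩
          rw [hn, h5, h6]; simp [pairWeight]
        · rw [h6] at ho; simp at ho
      · obtain ⟨-, -, h3, h4⟩ := h.right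
        rcases hX with rfl | rfl
        · refine Or.inl ⟨?_, Or.inl (Or.inr (Or.inr ⟨j, i, _, hij.symm, h.follow hij hb' (hp ▸ h3) hn⟩))⟩
          rw [hn, h3, h4]; simp [pairWeight]
        · rw [h4] at ho; simp at ho
      · rename_i r
        obtain ⟨-, -, -, h4, m, -, -, h7⟩ := h.right
        rcases hX with rfl | rfl
        · rw [h4] at ho; simp at ho
        · exact Or.inr ⟨r, rfl, h.meetExplored hij hb' hn hCv⟩
    · obtain ⟨h1, h2⟩ := h.climb hij hX ho hb' hp.symm hn
      refine Or.inl ⟨?_, Or.inl (Or.inl ⟨i, j, _, _, hij, h2⟩)⟩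
      rw [h1, hn]
      simp [pairWeight]

end

section

variable {V P : Type*} {G : WeightedGraph V P} {c c' : Config V P EMark} {i j : Agent} {p : P}
  {X T Cv : P → Prop} {a b : V} {m : EMark} {k ki kj : Kind V P}

/-! ### Arrivals in the exploration algorithm -/

theorem Kind.Fits.arrive (h : k.Fits G c Cv j) (hij : i ≠ j) (hp : ¬ k.Edge G p) :
    k.Fits G (c.arrive G exploration i p m) Cv j :=
  h.frame (arrive_loc_other hij) (fun _ hv => known_arrive.2 (Or.inr hv)) fun _ hq =>
    arrive_mark_of_ne fun h1 => hp ((Kind.edge_rev p).1 (h1 ▸ hq))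

/-- Agent `i`, at the end of the edge of `p`, exchanges the lines with agent `j`. -/
def Config.exchange (c : Config V P EMark) (i j : Agent) (p : P) (s s' : ℝ)
    (m : EMark) : Config V P EMark where
  mark := c.mark
  visited := c.visited
  loc := Function.update (Function.update c.loc j (.edge p s' m)) i (.edge p s .blank)

theorem Returning.depart (h : Returning G c Cv i j p) (hij : i ≠ j) {u : V} {q : Option P}
    {l : Line EMark} {r : P} (hi : c.loc i = .node u q)
    (hl : chosenLine G exploration c i u = some l) (hr : c.mark r = l.out) :
    r = G.rev p ∧ Closing G (c.depart i r l) Cv j i p := by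
  obtain ⟨q', h1⟩ := h.left
  rw [hi] at h1; cases h1
  rcases exploration_chosen hl with rfl | ⟨h2, -⟩
  · have h3 : r = G.rev p := by
      by_cases h4 : G.Same p r
      · refine h4.resolve_left ?_
        rintro rfl
        rw [h.markL] at hr; cases hr
      · rw [h.rest r h4] at hr; cases hr
    subst h3
    refine ⟨rfl, ⟨_, (depart_loc_other hij).trans h.right⟩, ⟨_, depart_loc_self⟩, ?_, ?_, h.cov⟩
    · rw [depart_mark_of_ne (G.rev_ne p).symm, h.markL]
    · rw [depart_mark_self]
  · exact absurd ⟨_, rfl, h.markR⟩ h2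

theorem Returning.arrive (h : Returning G c Cv i j p) (q : P) :
    (c.arrive G exploration j p .E).mark q = .D := by
  by_cases h1 : q = G.rev p
  · subst h1
    rw [arrive_mark_rev]
    exact exploration_arrivalMark (by simp) (by simp)
  · rw [arrive_mark_of_ne h1]
    by_cases h2 : q = p
    · rw [h2, h.markL]
    · exact h.rest q fun h3 => h3.elim h2 h1

variable [Fintype P]

theorem effort_arrive (h : pairWeight (c.mark p) (arrivalMark G exploration c i m (G.rev p)) ≤
      pairWeight (c.mark p) (c.mark (G.rev p))) :
    effort G (c.arrive G exploration i p m).mark ≤ effort G c.mark := by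
  rw [effort_change (p := p) (μ := c.mark) fun q hq =>
    arrive_mark_of_ne fun h1 => hq (Or.inr h1), arrive_mark_rev,
    arrive_mark_of_ne (G.rev_ne p).symm]
  have := mul_nonneg (sub_nonneg.2 h) (G.len_pos p).le
  linarith

theorem Core.arrive (h : Core G c X T a b) (hp : X p) (hp' : X (G.rev p))
    (hk : Known c (G.node (G.rev p))) (hm : arrivalMark G exploration c i m (G.rev p) ≠ .blank) :
    Core G (c.arrive G exploration i p m) X T a b := by
  refine h.frame (fun v => ?_) (fun q hq => ⟨arrive_mark_of_ne ?_, arrive_mark_of_ne ?_⟩)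
    fun q hq => ?_
  · rw [known_arrive]
    exact ⟨fun h1 => h1.elim (fun h2 => h2 ▸ hk) id, Or.inr⟩
  · rintro rfl; exact hq hp'
  · intro h1; rw [← G.rev_injective h1] at hp; exact hq hp
  · by_cases h1 : q = G.rev p
    · subst h1; exact absurd (arrive_mark_rev.symm.trans hq) hm
    · rwa [arrive_mark_of_ne h1] at hq

theorem Roles.arrive_fin (h : Roles G c Cv i (.fin p) j kj) (hij : i ≠ j)
    (hi : c.loc i = .edge p 0 m) (hCv : ∀ p, Cv (G.rev p) ↔ Cv p) :
    effort G (c.arrive G exploration i p m).mark ≤ effort G c.mark ∧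
      Roles G (c.arrive G exploration i p m) Cv i (.idle (G.node (G.rev p))) j kj := by
  obtain ⟨h1, h2, h3, h4, m', h5, h6, h7⟩ := h.left
  rw [hi] at h5; cases h5
  have hD : arrivalMark G exploration c i m (G.rev p) = .D :=
    exploration_arrivalMark h6 fun h8 => h7.resolve_right fun h9 => h9.2 h8
  have hjp : ¬ kj.Edge G p := h.disj p (Or.inl rfl)
  obtain ⟨T, hT⟩ := h.core
  have hkp : Known (c.arrive G exploration i p m) (G.node p) := known_arrive.2 (Or.inr h1)
  have hkp' : Known (c.arrive G exploration i p m) (G.node (G.rev p)) := known_arrive.2 (Or.inl rfl)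
  have hmp : (c.arrive G exploration i p m).mark p = .D := by
    rw [arrive_mark_of_ne (G.rev_ne p).symm, h4]
  have hmp' : (c.arrive G exploration i p m).mark (G.rev p) = .D := by
    rw [arrive_mark_rev, hD]
  refine ⟨effort_arrive ?_, ⟨hkp', _, arrive_loc_self⟩, h.right.arrive hij hjp,
    fun _ h => h.elim, ⟨T, ?_⟩, ?_⟩
  · simp [hD, h4, pairWeight]
  · refine Core.shrink (hT.arrive (Or.inl (Or.inl rfl)) (Or.inl (Or.inr rfl)) h2 (by simp [hD]))
      (fun q hq => Or.inr (hq.resolve_left id)) ?_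
    rintro q (hq | hq) hq'
    · rcases hq with rfl | rfl
      · exact ⟨hmp, hmp', hkp⟩
      · rw [G.rev_rev]; exact ⟨hmp', hmp, hkp'⟩
    · exact absurd (Or.inr hq) hq'
  · intro q hq hqm
    by_cases h8 : G.Same p q
    · rcases h8 with rfl | rfl
      · exact h3
      · exact (hCv p).2 h3
    · rw [arrive_mark_of_ne fun h9 => h8 (Or.inr h9)] at hqm
      exact h.cov q (fun h9 => h9.elim h8 fun h9 => hq (Or.inr h9)) hqm

theorem Roles.arrive_known (h : Roles G c Cv i (.out p) j kj) (hij : i ≠ j)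
    (hk : Known c (G.node (G.rev p))) (hp : Cv p) :
    effort G (c.arrive G exploration i p .blank).mark ≤ effort G c.mark ∧
      Roles G (c.arrive G exploration i p .blank) Cv i (.turn p) j kj := by
  obtain ⟨h1, h2, h3, h4⟩ := h.left
  have hB : arrivalMark G exploration c i .blank (G.rev p) = .B :=
    exploration_arrivalMark_of_known (by simp [h4]) hk
  obtain ⟨T, hT⟩ := h.core
  refine ⟨effort_arrive ?_, ⟨known_arrive.2 (Or.inr h1), known_arrive.2 (Or.inl rfl), hp,
    ⟨_, arrive_loc_self⟩, ?_, ?_⟩, h.right.arrive hij (h.disj p (Or.inl rfl)), h.disj, ⟨T, ?_⟩, ?_⟩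
  · simp [hB, h3, h4, pairWeight]
  · rw [arrive_mark_of_ne (G.rev_ne p).symm, h3]
  · rw [arrive_mark_rev, hB]
  · exact hT.arrive (Or.inl (Or.inl rfl)) (Or.inl (Or.inr rfl)) hk (by simp [hB])
  · intro q hq hqm
    rw [arrive_mark_of_ne fun h9 => hq (Or.inl (Or.inr h9))] at hqm
    exact h.cov q hq hqm

theorem Roles.arrive_unknown (h : Roles G c Cv i (.out p) j kj) (hij : i ≠ j)
    (hk : ¬ Known c (G.node (G.rev p))) (hp : Cv p) (hCv : ∀ p, Cv (G.rev p) ↔ Cv p) :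
    effort G (c.arrive G exploration i p .blank).mark ≤ effort G c.mark ∧
      Roles G (c.arrive G exploration i p .blank) Cv i (.idle (G.node (G.rev p))) j kj := by
  obtain ⟨h1, h2, h3, h4⟩ := h.left
  have hF : arrivalMark G exploration c i .blank (G.rev p) = .F :=
    exploration_arrivalMark_of_not_known (by simp [h4]) hk
  obtain ⟨T, hT⟩ := h.core
  refine ⟨effort_arrive ?_, ⟨known_arrive.2 (Or.inl rfl), _, arrive_loc_self⟩,
    h.right.arrive hij (h.disj p (Or.inl rfl)), fun _ h => h.elim,
    ⟨fun q => T q ∨ G.Same p q, ?_⟩, ?_⟩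
  · simp [hF, h3, h4, pairWeight]
  · refine Core.graft hT (Or.inl (Or.inl rfl)) (Or.inl (Or.inr rfl)) hk h1
      (fun v => known_arrive) (fun q hq => arrive_mark_of_ne hq) h3 (by rw [arrive_mark_rev, hF])
      (fun q => ?_) fun q hq h5 => ?_
    · simp [Kind.Edge, or_comm]
    · exact h.disj q h5 (hq.resolve_left id)
  · intro q hq hqm
    by_cases h8 : G.Same p q
    · rcases h8 with rfl | rfl
      · exact hp
      · exact (hCv p).2 hp
    · rw [arrive_mark_of_ne fun h9 => h8 (Or.inr h9)] at hqm
      exact h.cov q (fun h9 => h9.elim h8 fun h9 => hq (Or.inr h9)) hqm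

theorem Roles.edge_of_loc (h : Roles G c Cv i ki j kj) (hi : c.loc i = .edge p 0 m) :
    (ki = .out p ∧ m = .blank) ∨ ki = .fin p := by
  have h1 := h.left
  cases ki
  · obtain ⟨-, q, h2⟩ := h1
    rw [hi] at h2; cases h2
  · obtain ⟨-, -, -, ⟨q, h2⟩, -⟩ := h1
    rw [hi] at h2; cases h2
  · obtain ⟨-, h2, -⟩ := h1
    rw [hi] at h2; cases h2
    exact Or.inl ⟨rfl, rfl⟩
  · obtain ⟨-, -, -, -, m', h2, -⟩ := h1
    rw [hi] at h2; cases h2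
    exact Or.inr rfl

theorem Roles.arrive (h : Roles G c Cv i ki j kj) (hij : i ≠ j) (hi : c.loc i = .edge p 0 m)
    (hp : Cv p) (hCv : ∀ p, Cv (G.rev p) ↔ Cv p) :
    effort G (c.arrive G exploration i p m).mark ≤ effort G c.mark ∧
      ∃ ki', Roles G (c.arrive G exploration i p m) Cv i ki' j kj := by
  rcases h.edge_of_loc hi with ⟨rfl, rfl⟩ | rfl
  · by_cases hk : Known c (G.node (G.rev p))
    · exact (h.arrive_known hij hk hp).imp_right fun h1 => ⟨_, h1⟩
    · exact (h.arrive_unknown hij hk hp hCv).imp_right fun h1 => ⟨_, h1⟩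
  · exact (h.arrive_fin hij hi hCv).imp_right fun h1 => ⟨_, h1⟩

theorem Crossing.symm (h : Crossing G c Cv i j p) : Crossing G c Cv j i (G.rev p) where
  left := h.right
  right := by rw [G.rev_rev]; exact h.left
  markL := h.markR
  markR := by rw [G.rev_rev]; exact h.markL
  knownL := h.knownR
  knownR := by rw [G.rev_rev]; exact h.knownL
  core := by
    obtain ⟨T, hT⟩ := h.core
    rw [G.rev_rev, show G.Same (G.rev p) = G.Same p from
      funext fun q => propext WeightedGraph.rev_same]
    exact ⟨T, hT.symm⟩
  cov q hq := h.cov q fun h1 => hq (WeightedGraph.rev_same.2 h1)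

/-- The agent that arrives reads the $E$ of the other one and writes $D$; the other is then on a
last traversal of an explored edge, at whose end it finds $E$ and does likewise. -/
theorem Crossing.arrive (h : Crossing G c Cv i j p) (hij : i ≠ j) (hp : Cv p)
    (hCv : ∀ p, Cv (G.rev p) ↔ Cv p) :
    effort G (c.arrive G exploration i p .blank).mark ≤ effort G c.mark ∧
      Roles G (c.arrive G exploration i p .blank) Cv i (.idle (G.node (G.rev p))) j
        (.fin (G.rev p)) := by
  have hD : arrivalMark G exploration c i .blank (G.rev p) = .D :=
    exploration_arrivalMark (by simp) fun _ => h.markR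
  obtain ⟨T, hT⟩ := h.core
  refine ⟨effort_arrive ?_, ⟨known_arrive.2 (Or.inl rfl), _, arrive_loc_self⟩,
    ⟨known_arrive.2 (Or.inl rfl), ?_, (hCv p).2 hp, ?_, .blank, ?_, by simp, Or.inl ?_⟩,
    fun _ h => h.elim, ⟨T, ?_⟩, ?_⟩
  · simp [hD, h.markL, h.markR, pairWeight]
  · rw [G.rev_rev]; exact known_arrive.2 (Or.inr h.knownL)
  · rw [arrive_mark_rev, hD]
  · rw [arrive_loc_other hij, h.right]
  · rw [G.rev_rev, arrive_mark_of_ne (G.rev_ne p).symm, h.markL]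
  · have hX : (fun q => (Kind.idle (G.node (G.rev p))).Edge G q ∨
        (Kind.fin (G.rev p)).Edge G q) = G.Same p :=
      funext fun q => propext (by simp [Kind.Edge, WeightedGraph.rev_same])
    rw [hX]
    have := hT.symm.arrive (i := i) (m := .blank) (Or.inl rfl) (Or.inr rfl) h.knownR (by simp [hD])
    simpa only [Kind.base, G.rev_rev] using this
  · intro q hq hqm
    have h8 : ¬ G.Same p q := fun h9 => hq (Or.inr (WeightedGraph.rev_same.2 h9))
    rw [arrive_mark_of_ne fun h9 => h8 (Or.inr h9)] at hqm
    exact h.cov q h8 hqm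

/-- The explorer goes on from the new node, while its follower traverses the edge for the last time
and will overwrite the $F$. Both ends of the empty path thereby move to the new node. -/
theorem Convoy.arrive (h : Convoy G c Cv i j p) (hij : i ≠ j) (hp : Cv p) :
    effort G (c.arrive G exploration i p .blank).mark ≤ effort G c.mark ∧
      Roles G (c.arrive G exploration i p .blank) Cv i (.idle (G.node (G.rev p))) j (.fin p) := by
  have hF : arrivalMark G exploration c i .blank (G.rev p) = .F :=
    exploration_arrivalMark_of_not_known (by simp [h.markR]) h.knownR
  obtain ⟨T, hT⟩ := h.core
  have hTe := hT.tree_empty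
  refine ⟨effort_arrive ?_, ⟨known_arrive.2 (Or.inl rfl), _, arrive_loc_self⟩,
    ⟨known_arrive.2 (Or.inr h.knownL), known_arrive.2 (Or.inl rfl), hp, ?_, .E, ?_, by simp,
      Or.inr ⟨?_, by simp⟩⟩,
    fun _ h => h.elim, ⟨T, ?_⟩, ?_⟩
  · simp [hF, h.markL, pairWeight]
  · rw [arrive_mark_of_ne (G.rev_ne p).symm, h.markL]
  · rw [arrive_loc_other hij, h.right]
  · rw [arrive_mark_rev, hF]
  · have hX : (fun q => (Kind.idle (G.node (G.rev p))).Edge G q ∨ (Kind.fin p).Edge G q) =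
        G.Same p := funext fun q => propext (by simp [Kind.Edge])
    rw [hX]
    have hm : ∀ q, ¬ G.Same p q → (c.arrive G exploration i p .blank).mark q = c.mark q :=
      fun q hq => arrive_mark_of_ne fun h9 => hq (Or.inr h9)
    constructor
    · intro q hq
      rw [hm q hq, hm _ (by rwa [WeightedGraph.same_rev])]
      exact hT.cls q hq
    · exact fun q hq => absurd hq (hTe q)
    · intro v
      rw [hT.parity, add_self_zmod_two, Kind.base, Kind.base, add_self_zmod_two]
    · exact ⟨fun _ => 0, fun q hq => absurd hq (hTe q)⟩
    · exact fun q _ hq => absurd hq (hTe q)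
    · intro q hq hqm
      rw [hm q hq] at hqm
      exact known_arrive.2 (Or.inr (hT.known q hq hqm))
    · intro q hq hk
      rcases known_arrive.1 hk with h1 | h1
      · exact Or.inl h1
      · have h2 : q ≠ G.rev p := by
          rintro rfl
          rw [arrive_mark_rev, hF] at hq; cases hq
        rw [arrive_mark_of_ne h2] at hq
        rcases hT.blank q hq h1 with h3 | h3 | ⟨r, h3, -⟩
        · exact absurd hq (h.full q h3)
        · exact absurd hq (h.full q h3)
        · exact absurd h3 (hTe r)
  · intro q hq hqm
    have h8 : ¬ G.Same p q := fun h9 => hq (Or.inr h9)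
    rw [arrive_mark_of_ne fun h9 => h8 (Or.inr h9)] at hqm
    exact h.cov q h8 hqm

theorem Stage.arrive (h : Stage G c Cv) (hi : c.loc i = .edge p 0 m)
    (hfirst : ∀ s, c.loc i.other = .edge p s .blank → m = .blank) (hp : Cv p)
    (hCv : ∀ p, Cv (G.rev p) ↔ Cv p) :
    effort G (c.arrive G exploration i p m).mark ≤ effort G c.mark ∧
      Stage G (c.arrive G exploration i p m) Cv := by
  rcases h with ⟨k, l, kk, kl, hkl, h⟩ | ⟨k, l, r, hkl, h⟩ | ⟨k, l, r, hkl, h⟩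
  · have : ∃ l ki kl, i ≠ l ∧ Roles G c Cv i ki l kl := by
      rcases Agent.eq_or_eq hkl i with rfl | rfl
      · exact ⟨_, _, _, hkl, h⟩
      · exact ⟨_, _, _, hkl.symm, h.symm⟩
    obtain ⟨l, ki, kl, hkl, h⟩ := this
    obtain ⟨h1, ki', h2⟩ := h.arrive hkl hi hp hCv
    exact ⟨h1, Or.inl ⟨_, _, _, _, hkl, h2⟩⟩
  · have : ∃ l r, i ≠ l ∧ Crossing G c Cv i l r := by
      rcases Agent.eq_or_eq hkl i with rfl | rfl
      · exact ⟨_, _, hkl, h⟩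
      · exact ⟨_, _, hkl.symm, h.symm⟩
    obtain ⟨l, r, hkl, h⟩ := this
    have h1 := h.left
    rw [hi] at h1; cases h1
    exact (h.arrive hkl hp hCv).imp_right fun h2 => Or.inl ⟨_, _, _, _, hkl, h2⟩
  · rcases Agent.eq_or_eq hkl i with rfl | rfl
    · have h1 := h.left
      rw [hi] at h1; cases h1
      exact (h.arrive hkl hp).imp_right fun h2 => Or.inl ⟨_, _, _, _, hkl, h2⟩
    · have h1 := h.right
      rw [hi] at h1; cases h1
      -- A follower that attains the node before the explorer has overtaken it; this is the event
      -- `overtake`, not a plain arrival.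
      rw [Agent.other_eq hkl.symm] at hfirst
      exact absurd (hfirst 0 h.left) (by simp)

/-- In a stage, two agents in one edge with the same direction form a convoy. Exchanging their lines
yields the same convoy with the agents interchanged, so the order of arrival does not matter. -/
theorem Stage.exchange (h : Stage G c Cv) (hij : i ≠ j) (hi : c.loc i = .edge p 0 m)
    (hj : c.loc j = .edge p 0 .blank) (hm : m ≠ .blank) :
    Stage G (c.exchange i j p 0 0 m) Cv := by
  rcases h with ⟨k, l, kk, kl, hkl, h⟩ | ⟨k, l, r, hkl, h⟩ | ⟨k, l, r, hkl, h⟩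
  · have : ∃ ki kj, Roles G c Cv i ki j kj := by
      rcases Agent.eq_or_eq hij k with rfl | rfl <;> rcases Agent.eq_or_eq hij l with rfl | rfl
      · exact absurd rfl hkl
      · exact ⟨_, _, h⟩
      · exact ⟨_, _, h.symm⟩
      · exact absurd rfl hkl
    obtain ⟨ki, kj, h⟩ := this
    refine absurd ?_ (h.disj p ?_)
    · rcases h.symm.edge_of_loc hj with ⟨rfl, -⟩ | rfl <;> exact Or.inl rfl
    · rcases h.edge_of_loc hi with ⟨rfl, -⟩ | rfl <;> exact Or.inl rfl
  · have h1 := h.left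
    have h2 := h.right
    rcases Agent.eq_or_eq hij k with rfl | rfl <;> rcases Agent.eq_or_eq hij l with rfl | rfl
    · exact absurd rfl hkl
    · rw [hi] at h1; cases h1; exact absurd rfl hm
    · rw [hi] at h2; cases h2; exact absurd rfl hm
    · exact absurd rfl hkl
  · have h1 := h.left
    have h2 := h.right
    rcases Agent.eq_or_eq hij k with rfl | rfl <;> rcases Agent.eq_or_eq hij l with rfl | rfl
    · exact absurd rfl hkl
    · rw [hi] at h1; cases h1; exact absurd rfl hm
    · rw [hi] at h2; cases h2
      rw [hj] at h1; cases h1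
      obtain ⟨T, hT⟩ := h.core
      refine Or.inr (Or.inr ⟨l, k, p, hij, ?_⟩)
      refine ⟨?_, ?_, h.markL, h.markR, h.knownL, h.knownR, h.full, ⟨T, ?_⟩, h.cov⟩
      · exact Function.update_self ..
      · exact (Function.update_of_ne hij.symm _ _).trans (Function.update_self ..)
      · exact hT.frame (fun _ => Iff.rfl) (fun _ _ => ⟨rfl, rfl⟩) fun _ => id
    · exact absurd rfl hkl

end

section

variable {V P : Type*} {G : WeightedGraph V P} {c c' : Config V P EMark} {i j : Agent}
  {p : P} {X T Cv Cv' : P → Prop} {a b : V} {m : EMark} {k ki kj : Kind V P}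

/-! ### The end of the exploration -/

theorem Kind.Fits.mono (hC : ∀ p, Cv p → Cv' p) (h : k.Fits G c Cv i) : k.Fits G c Cv' i := by
  cases k
  · exact h
  · exact ⟨h.1, h.2.1, hC _ h.2.2.1, h.2.2.2⟩
  · exact h
  · exact ⟨h.1, h.2.1, hC _ h.2.2.1, h.2.2.2⟩

variable [Fintype P]

theorem Stage.mono (hC : ∀ p, Cv p → Cv' p) (h : Stage G c Cv) : Stage G c Cv' := by
  rcases h with ⟨k, l, kk, kl, hkl, h⟩ | ⟨k, l, r, hkl, h⟩ | ⟨k, l, r, hkl, h⟩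
  · exact Or.inl ⟨_, _, _, _, hkl, { h with
      left := h.left.mono hC
      right := h.right.mono hC
      cov := fun p h1 h2 => hC p (h.cov p h1 h2) }⟩
  · exact Or.inr (Or.inl ⟨_, _, _, hkl, { h with
      cov := fun p h1 h2 => hC p (h.cov p h1 h2) }⟩)
  · exact Or.inr (Or.inr ⟨_, _, _, hkl, { h with
      cov := fun p h1 h2 => hC p (h.cov p h1 h2) }⟩)

/-- The roles in a stage in which an agent is at a node. -/
theorem Stage.roles {u : V} {q : Option P} (h : Stage G c Cv) (hi : c.loc i = .node u q) :
    ∃ j ki kj, i ≠ j ∧ Roles G c Cv i ki j kj := by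
  rcases h with ⟨k, l, kk, kl, hkl, h⟩ | ⟨k, l, r, hkl, h⟩ | ⟨k, l, r, hkl, h⟩
  · rcases Agent.eq_or_eq hkl i with rfl | rfl
    · exact ⟨_, _, _, hkl, h⟩
    · exact ⟨_, _, _, hkl.symm, h.symm⟩
  all_goals
    rcases Agent.eq_or_eq hkl i with rfl | rfl
    · exact absurd (hi.symm.trans h.left) (by simp)
    · exact absurd (hi.symm.trans h.right) (by simp)

/-- If no line applies at the node of an agent, then the graph is explored. -/
theorem Stage.cov_of_stuck {u : V} {q : Option P} (h : Stage G c Cv) (hi : c.loc i = .node u q)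
    (hD : ∀ p, G.node p = u → c.mark p = .D) (p : P) : Cv p := by
  obtain ⟨j, ki, kj, hij, h⟩ := h.roles hi
  have hB : ¬ Present G c u .B := by
    rintro ⟨r, h1, h2⟩
    rw [hD r h1] at h2; cases h2
  obtain rfl := h.left.eq_idle hi hB
  obtain ⟨T, hT⟩ := h.core
  -- No tree passage is at `u`, so the parity there is 0, whereas `u` is an end of the path. Hence
  -- it is the other end as well.
  have hu : kj.base G = u := by
    have h1 : parity G T u = indicator u u + indicator (kj.base G) u := hT.parity u
    have h2 : parity G T u = 0 := by
      refine Finset.sum_eq_zero fun r _ => if_neg ?_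
      rintro ⟨h3, h4⟩
      have := (hT.tree r h3).2.2
      simp [hD r h4] at this
    by_contra h3
    rw [h2] at h1
    simp [indicator, h3] at h1
  have hr := h.right
  cases kj
  · refine (h.rest_discarded hu (fun r h1 h2 => ?_) (fun _ h => h.elim) p id).2.2
    rw [hD r h1] at h2; cases h2
  · have h1 := hr.2.2.2.2.1
    rw [hD _ hu] at h1; cases h1
  · have h1 := hr.2.2.1
    rw [hD _ hu] at h1; cases h1
  · obtain ⟨-, -, -, -, m, -, -, h1⟩ := hr
    rw [hD _ hu] at h1
    simp at h1

theorem pairWeight_eq_zero (h : effort G c.mark ≤ 0) (p : P) :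
    pairWeight (c.mark p) (c.mark (G.rev p)) = 0 := by
  have h1 := (Finset.sum_eq_zero_iff_of_nonneg fun p _ =>
    mul_nonneg (div_nonneg (pairWeight_nonneg (c.mark p) (c.mark (G.rev p))) (by norm_num))
      (G.len_pos p).le).1 (le_antisymm h (effort_nonneg _)) p (Finset.mem_univ p)
  have := (G.len_pos p).ne'
  simpa [this] using h1

theorem Core.ne_blank (h : Core G c X T a b) (he : effort G c.mark ≤ 0) (hp : ¬ X p) :
    c.mark p ≠ .blank := by
  intro h1
  have h2 := pairWeight_eq_zero he p
  rcases h.cls p hp with h3 | h3 | h3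
  · have := (h.tree p h3).2.2
    simp [h1] at this
  · rw [h3.1, h3.2] at h2; simp [pairWeight] at h2
  · rw [h1] at h3; cases h3.1

theorem Kind.Fits.cov (h : k.Fits G c Cv i) (he : effort G c.mark ≤ 0)
    (hCv : ∀ p, Cv (G.rev p) ↔ Cv p) (hp : k.Edge G p) : Cv p := by
  have h3 : ∀ r, Cv r → G.Same r p → Cv p := by
    rintro r h1 (rfl | rfl)
    · exact h1
    · exact (hCv r).2 h1
  cases k
  · exact hp.elim
  · exact h3 _ h.2.2.1 hp
  · have h2 := pairWeight_eq_zero he (by assumption)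
    rw [h.2.2.1, h.2.2.2] at h2
    simp [pairWeight] at h2
  · exact h3 _ h.2.2.1 hp

/-- When no edge has to be entered any more, and the agents attain the ends of their edges, the
graph is explored. -/
theorem Stage.cov_of_effort (h : Stage G c Cv) (he : effort G c.mark ≤ 0)
    (hCv : ∀ p, Cv (G.rev p) ↔ Cv p) (hend : ∀ i p s m, c.loc i = .edge p s m → Cv p) (p : P) :
    Cv p := by
  rcases h with ⟨k, l, kk, kl, hkl, h⟩ | ⟨k, l, r, hkl, h⟩ | ⟨k, l, r, hkl, h⟩
  · by_cases h1 : kk.Edge G p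
    · exact h.left.cov he hCv h1
    by_cases h2 : kl.Edge G p
    · exact h.right.cov he hCv h2
    have h3 : ¬ (kk.Edge G p ∨ kl.Edge G p) := fun h => h.elim h1 h2
    obtain ⟨T, hT⟩ := h.core
    exact h.cov p h3 (hT.ne_blank he h3)
  all_goals
    by_cases h1 : G.Same r p
    · have h2 := hend _ _ _ _ h.left
      rcases h1 with rfl | rfl
      · exact h2
      · exact (hCv _).2 h2
    · obtain ⟨T, hT⟩ := h.core
      exact h.cov p h1 (hT.ne_blank he h1)

/-- The agents are not in the same edge when its passages are discarded. -/
theorem Stage.not_discarded (h : Stage G c Cv) (hij : i ≠ j) {q r : P} {m m' : EMark}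
    (hi : c.loc i = .edge q 0 m) (hj : c.loc j = .edge r 0 m') (hqr : G.Same q r)
    (hD : c.mark q = .D) (hD' : c.mark (G.rev q) = .D) : False := by
  rcases h with ⟨k, l, kk, kl, hkl, h⟩ | ⟨k, l, r', hkl, h⟩ | ⟨k, l, r', hkl, h⟩
  · have key : ∀ {i j q r ki kj} {m m' : EMark}, Roles G c Cv i ki j kj →
        c.loc i = .edge q 0 m → c.loc j = .edge r 0 m' → ¬ G.Same q r := by
      intro i j q r ki kj m m' h hi hj hqr
      have h1 : ki.Edge G q := by
        rcases h.edge_of_loc hi with ⟨rfl, -⟩ | rfl <;> exact Or.inl rfl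
      have h2 : kj.Edge G r := by
        rcases h.symm.edge_of_loc hj with ⟨rfl, -⟩ | rfl <;> exact Or.inl rfl
      refine h.disj q h1 ?_
      rcases hqr with rfl | rfl
      · exact h2
      · exact (Kind.edge_rev q).1 h2
    rcases Agent.eq_or_eq hij k with rfl | rfl <;> rcases Agent.eq_or_eq hij l with rfl | rfl
    · exact hkl rfl
    · exact key h hi hj hqr
    · exact key h.symm hi hj hqr
    · exact hkl rfl
  · have h1 := h.markL
    have h2 := h.markR
    rcases Agent.eq_or_eq hij k with rfl | rfl
    · have h3 := h.left
      rw [hi] at h3; cases h3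
      rw [hD] at h1; cases h1
    · obtain rfl := (Agent.eq_or_eq hij l).resolve_right hkl.symm
      have h3 := h.right
      rw [hi] at h3; cases h3
      rw [hD] at h2; cases h2
  · have h1 := h.markR
    have h3 : c.loc i = .edge r' 0 m := by
      rcases Agent.eq_or_eq hij k with rfl | rfl
      · have h3 := h.left
        rw [hi] at h3; cases h3; exact hi
      · obtain rfl := (Agent.eq_or_eq hij l).resolve_right hkl.symm
        have h3 := h.right
        rw [hi] at h3; cases h3; exact hi
    rw [hi] at h3; cases h3
    rw [hD'] at h1; cases h1

theorem stage_initial (origin : V) :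
    Stage G (initial exploration fun _ => origin) Cv := by
  refine Or.inl ⟨.ariadne, .theseus, .idle origin, .idle origin, by simp,
    ⟨⟨.ariadne, rfl⟩, none, rfl⟩, ⟨⟨.theseus, rfl⟩, none, rfl⟩, fun _ h => h.elim,
    ⟨fun _ => False, ?_⟩, fun p _ h => absurd rfl h⟩
  constructor
  · exact fun p _ => Or.inr (Or.inl ⟨rfl, rfl⟩)
  · exact fun p hp => hp.elim
  · intro v
    simp [parity, add_self_zmod_two, Kind.base]
  · exact ⟨fun _ => 0, fun p hp => hp.elim⟩
  · exact fun p q hp => hp.elim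
  · exact fun p _ h => absurd rfl h
  · rintro p - ⟨k, hk⟩
    exact Or.inl hk

theorem effort_initial (start : Agent → V) :
    effort G (initial exploration start).mark = 2 * G.totalLength := by
  simp [effort, initial, exploration, pairWeight, WeightedGraph.totalLength, mul_div_cancel₀]

end

/-! ### The points that have been visited -/

section

variable {V P : Type*} {M : Type} {G : WeightedGraph V P} {A : Algorithm M} {e : Agent → ℝ → ℝ}
  {start : Agent → V} {T t t' : ℝ} {c : Config V P M} {i j : Agent} {p : P} {s : ℝ} {m : M}

theorem occupies_rev {y : Loc V P M} (h : Occupies G y (G.rev p) (G.len p - s)) :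
    Occupies G y p s := by
  rcases h with h | ⟨h1, h2⟩ | ⟨h1, h2⟩
  · left
    rcases y with ⟨v, q⟩ | ⟨q, r, m⟩
    · exact h
    · rcases h with ⟨rfl, rfl⟩ | ⟨rfl, h2⟩
      · exact Or.inr ⟨rfl, rfl⟩
      · left
        rw [G.rev_rev, G.len_rev] at *
        exact ⟨rfl, by linarith⟩
  · exact Or.inr (Or.inr ⟨by linarith, h2⟩)
  · rw [G.rev_rev] at h2
    rw [G.len_rev] at h1
    exact Or.inr (Or.inl ⟨by linarith, h2⟩)

theorem Config.occupies (h : c.loc i = .edge p s m) : Occupies G (c.loc i) p s := by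
  rw [h]; exact Or.inl (Or.inl ⟨rfl, rfl⟩)

/-- The point of the edge of `p` at distance `s` has been visited before time `t`. -/
def Run.Seen (x : Run G A e start T) (t : ℝ) (p : P) (s : ℝ) : Prop :=
  ∃ r ∈ Set.Icc 0 t, ∃ c, x.IsAt r c ∧ ∃ i, Occupies G (c.loc i) p s

/-- The edge of `p` has been explored before time `t`. -/
def Run.Covered (x : Run G A e start T) (t : ℝ) (p : P) : Prop :=
  ∀ s ∈ Set.Icc 0 (G.len p), x.Seen t p s

variable {x : Run G A e start T}

theorem Run.Seen.mono (htt : t ≤ t') (h : x.Seen t p s) : x.Seen t' p s := by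
  obtain ⟨r, hr, h⟩ := h
  exact ⟨r, ⟨hr.1, hr.2.trans htt⟩, h⟩

theorem Run.Covered.mono (htt : t ≤ t') (h : x.Covered t p) : x.Covered t' p :=
  fun s hs => (h s hs).mono htt

theorem Run.ExploredBy.mono (htt : t ≤ t') (h : x.ExploredBy t) : x.ExploredBy t' :=
  fun p => Run.Covered.mono htt (h p)

theorem Run.covered_rev (p : P) : x.Covered t (G.rev p) ↔ x.Covered t p := by
  have key : ∀ p, x.Covered t (G.rev p) → x.Covered t p := by
    intro p h s hs
    obtain ⟨r, hr, c, hc, i, hi⟩ := h (G.len p - s)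
      ⟨by linarith [hs.2], by rw [G.len_rev]; linarith [hs.1]⟩
    exact ⟨r, hr, c, hc, i, occupies_rev hi⟩
  exact ⟨key p, fun h => key _ (by rwa [G.rev_rev])⟩

theorem Run.IsAt.seen (h : x.IsAt t c) (ht : 0 ≤ t) (hi : c.loc i = .edge p s m) : x.Seen t p s :=
  ⟨t, ⟨ht, le_rfl⟩, c, h, i, Config.occupies hi⟩

/-- The agents have visited the parts of the edges that are behind them. -/
def Run.Track (x : Run G A e start T) (t : ℝ) (c : Config V P M) : Prop :=
  ∀ i p s m, c.loc i = .edge p s m → 0 ≤ s ∧ s ≤ G.len p ∧ ∀ r ∈ Set.Icc 0 s, x.Seen t p r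

theorem Run.Track.advance (he : IsAdversary e) {k : ℕ} (hk : k ≤ x.n) (h1 : x.time k ≤ t)
    (h2 : t ≤ x.time (k + 1)) (hadv : CanAdvance G A e (x.config k) (x.time k) t)
    (h : x.Track (x.time k) (x.config k)) :
    x.Track t ((x.config k).advance e (x.time k) t) := by
  intro i p s m hi
  rw [Config.advance_loc_edge] at hi
  obtain ⟨h3, h4, h5⟩ := h _ _ _ _ hi
  have h6 := he.monotone i h1
  have h7 := hadv.le_len hi
  refine ⟨by linarith, by linarith, fun r hr => ?_⟩
  by_cases h8 : r ≤ s - (e i t - e i (x.time k))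
  · exact (h5 r ⟨hr.1, h8⟩).mono h1
  · push Not at h8
    -- A point passed since the last event was occupied at the instant when the energy received
    -- equalled the distance to it.
    obtain ⟨τ, hτ, h9⟩ := intermediate_value_Icc h1 (he.continuous i).continuousOn
      (show e i (x.time k) + (r - (s - (e i t - e i (x.time k)))) ∈
        Set.Icc (e i (x.time k)) (e i t) from ⟨by linarith, by linarith [hr.2]⟩)
    have h10 : ((x.config k).advance e (x.time k) τ).loc i = .edge p r m := by
      rw [Config.advance_loc_edge, hi, h9]
      congr 1; ring
    exact ((x.isAt hk hτ.1 (hτ.2.trans h2)).seen ((x.time_nonneg (by omega)).trans hτ.1) h10).mono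
      hτ.2

theorem Run.Track.depart (h : x.Track t c) (ht : 0 ≤ t) {l : Line M}
    (hat : x.IsAt t (c.depart i p l)) : x.Track t (c.depart i p l) := by
  intro j q s m hj
  by_cases hij : i = j
  · subst hij
    have h1 := hj
    rw [depart_loc_self] at h1; cases h1
    refine ⟨le_rfl, (G.len_pos p).le, fun r hr => ?_⟩
    rw [le_antisymm hr.2 hr.1]
    exact hat.seen ht hj
  · rw [depart_loc_other hij] at hj
    exact h _ _ _ _ hj

theorem Run.Track.arrive (h : x.Track t c) : x.Track t (c.arrive G A i p m) := by
  intro j q s m' hj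
  by_cases hij : i = j
  · subst hij
    rw [arrive_loc_self] at hj; cases hj
  · rw [arrive_loc_other hij] at hj
    exact h _ _ _ _ hj

theorem Run.Track.covered (h : x.Track t c) (hi : c.loc i = .edge p (G.len p) m) :
    x.Covered t p :=
  (h _ _ _ _ hi).2.2

theorem Run.Track.transit_nonneg (h : x.Track t c) (i : Agent) : 0 ≤ (c.loc i).transit G := by
  rcases hi : c.loc i with ⟨v, q⟩ | ⟨p, s, m⟩
  · exact le_rfl
  · exact sub_nonneg.2 (h _ _ _ _ hi).2.1

theorem Run.Track.transits_nonneg (h : x.Track t c) : 0 ≤ transits G c :=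
  Finset.sum_nonneg fun i _ => h.transit_nonneg i

end

/-! ### The invariant of the exploration algorithm -/

section

variable {V P : Type*} {G : WeightedGraph V P} {e : Agent → ℝ → ℝ} {start : Agent → V}
  {T t t' κ B : ℝ} {c c' : Config V P EMark} {i j : Agent} {p : P} {s s' : ℝ} {m m' : EMark}
  {x : Run G exploration e start T} {u : V} {q : Option P}

/-- The algorithm has stopped, and the graph is explored. -/
def Run.Finished (x : Run G exploration e start T) (t : ℝ) : Prop :=
  ∃ r ∈ Set.Icc 0 t, x.StopsAt r ∧ x.ExploredBy r

theorem Run.Finished.mono (htt : t ≤ t') (h : x.Finished t) : x.Finished t' := by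
  obtain ⟨r, hr, h⟩ := h
  exact ⟨r, ⟨hr.1, hr.2.trans htt⟩, h⟩

theorem Run.IsAt.stopsAt (h : x.IsAt t c) (hij : i ≠ j) (hi : c.loc i = .edge p s m)
    (hj : c.loc j = .edge (G.rev p) s' m') (hs : s + s' = G.len p) (hD : c.mark p = .D)
    (hD' : c.mark (G.rev p) = .D) : x.StopsAt t := by
  have h1 : OnEdge G (c.loc i) p s := by rw [hi]; exact Or.inl ⟨rfl, rfl⟩
  have h2 : OnEdge G (c.loc j) p s := by rw [hj]; exact Or.inr ⟨rfl, by linarith⟩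
  refine ⟨c, h, Or.inr ⟨p, s, ?_, ?_, hD, hD'⟩⟩
  · rcases Agent.eq_or_eq hij .ariadne with h3 | h3 <;> rw [h3] <;> assumption
  · rcases Agent.eq_or_eq hij .theseus with h3 | h3 <;> rw [h3] <;> assumption

/-- The agents move towards each other in an edge with discarded passages. -/
def Approaching (G : WeightedGraph V P) (c : Config V P EMark) (κ B : ℝ) : Prop :=
  ∃ i j p s m s' m', i ≠ j ∧ c.loc i = .edge p s m ∧ c.loc j = .edge (G.rev p) s' m' ∧
    c.mark p = .D ∧ c.mark (G.rev p) = .D ∧ s + s' < G.len p ∧ κ + (G.len p - s - s') ≤ B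

theorem transits_advance {a b : ℝ} (h : CanAdvance G exploration e c a b)
    (hn : ∀ i u q, c.loc i = .node u q → chosenLine G exploration c i u ≠ none) :
    cost e b + transits G (c.advance e a b) = cost e a + transits G c := by
  have h1 : ∀ i, ((c.advance e a b).loc i).transit G = (c.loc i).transit G - (e i b - e i a) :=
    fun i => transit_advance h (hn i)
  simp only [transits, h1, cost_eq_sum, Finset.sum_sub_distrib]
  ring

variable [Fintype P]

/-- As long as the algorithm does not stop, the cost is at most `B`. -/
structure Run.Progress (x : Run G exploration e start T) (B t : ℝ) (c : Config V P EMark) :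
    Prop where
  track : x.Track t c
  phase : (Stage G c.flat (x.Covered t) ∧ cost e t + effort G c.mark + transits G c ≤ B) ∨
    (x.ExploredBy t ∧ Approaching G c (cost e t) B) ∨
    ((∃ i j p, i ≠ j ∧ Returning G c.flat (x.Covered t) i j p) ∧ cost e t + transits G c ≤ B)

theorem Run.Progress.cost_le (h : x.Progress B t c) : cost e t ≤ B := by
  have h1 := h.track.transits_nonneg
  rcases h.phase with ⟨-, h2⟩ | ⟨-, i, j, p, s, m, s', m', -, -, -, -, -, h2, h3⟩ | ⟨-, h2⟩
  · have := effort_nonneg (G := G) c.mark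
    linarith
  · linarith
  · linarith

theorem Run.Progress.explored_of_stuck (h : x.Progress B t c) (hi : c.loc i = .node u q)
    (hn : chosenLine G exploration c i u = none) : x.ExploredBy t := by
  rcases h.phase with ⟨h1, -⟩ | ⟨h1, -⟩ | ⟨⟨k, l, p, -, h1⟩, -⟩
  · exact h1.cov_of_stuck (Config.flat_loc_node.2 hi) (exploration_not_chosen hn)
  · exact h1
  · exact h1.cov

theorem Run.Progress.explored_of_stopped (h : x.Progress B t c)
    (hs : (∃ i u q, c.loc i = .node u q ∧ chosenLine G exploration c i u = none) ∨
      ∃ p s, OnEdge G (c.loc .ariadne) p s ∧ OnEdge G (c.loc .theseus) p s ∧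
        c.mark p = .D ∧ c.mark (G.rev p) = .D) : x.ExploredBy t := by
  rcases hs with ⟨i, u, q, h1, h2⟩ | ⟨p, s, h1, h2, h3, h4⟩
  · exact h.explored_of_stuck h1 h2
  · have key : ∀ i, OnEdge G (c.loc i) p s → ∃ q m, G.Same p q ∧ c.flat.loc i = .edge q 0 m := by
      intro i hi
      rcases hl : c.loc i with ⟨v, q⟩ | ⟨q, r, m⟩
      · rw [hl] at hi; exact hi.elim
      · refine ⟨q, m, ?_, Config.flat_loc_edge hl⟩
        rw [hl] at hi
        exact hi.imp And.left And.left
    obtain ⟨q, m, hq, h5⟩ := key _ h1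
    obtain ⟨r, m', hr, h6⟩ := key _ h2
    rcases h.phase with ⟨h7, -⟩ | ⟨h7, -⟩ | ⟨⟨k, l, p, -, h7⟩, -⟩
    · refine (h7.not_discarded (by simp) h5 h6 ?_ ?_ ?_).elim
      · rcases hq with rfl | rfl
        · exact hr
        · exact WeightedGraph.rev_same.2 hr
      · rcases hq with rfl | rfl <;> assumption
      · rcases hq with rfl | rfl
        · assumption
        · rw [G.rev_rev]; assumption
    · exact h7
    · exact h7.cov

/-- With the budget used up, effort and transit both vanish: no entry is outstanding, and an agent
inside an edge is at its end, so that its track covers the edge. -/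
theorem Run.Progress.explored_of_cost (h : x.Progress B t c) (hB : cost e t = B) :
    x.ExploredBy t := by
  rcases h.phase with ⟨h1, h2⟩ | ⟨h1, -⟩ | ⟨⟨k, l, p, -, h1⟩, -⟩
  · have h3 := effort_nonneg (G := G) c.mark
    have h4 := h.track.transits_nonneg
    refine h1.cov_of_effort (show effort G c.mark ≤ 0 by linarith) Run.covered_rev ?_
    intro i p s m hi
    obtain ⟨s', hi⟩ := Config.exists_of_flat_loc_edge hi
    have h5 := (Finset.sum_eq_zero_iff_of_nonneg fun i _ => h.track.transit_nonneg i).1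
      (show transits G c = 0 by linarith) i (Finset.mem_univ i)
    rw [hi] at h5
    obtain rfl : s' = G.len p := by simp only [Loc.transit] at h5; linarith
    exact h.track.covered hi
  · exact h1
  · exact h1.cov

/-- The agents need together only the rest of the way of `i` before they meet, so the entry of `j`
costs nothing extra. If `i` is already at the end of the edge, they meet at once and the algorithm
stops. -/
theorem Run.Progress.of_closing (ht : 0 ≤ t) (hat : x.IsAt t c) (hij : i ≠ j)
    (h : Closing G c.flat (x.Covered t) i j p) (hT : x.Track t c)
    (hj : c.loc j = .edge (G.rev p) 0 m) (hB : cost e t + (c.loc i).transit G ≤ B) :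
    x.Finished t ∨ x.Progress B t c := by
  obtain ⟨m', h1⟩ := h.left
  obtain ⟨s, h1⟩ := Config.exists_of_flat_loc_edge h1
  rcases (hT _ _ _ _ h1).2.1.eq_or_lt with h2 | h2
  · exact Or.inl ⟨t, ⟨ht, le_rfl⟩, hat.stopsAt hij h1 hj (by linarith) h.markL h.markR, h.cov⟩
  · refine Or.inr ⟨hT, Or.inr (Or.inl ⟨h.cov, i, j, p, s, m', 0, m, hij, h1, hj, h.markL, h.markR,
      by linarith, ?_⟩)⟩
    rw [h1] at hB
    simp only [Loc.transit] at hB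
    linarith

end

/-! ### Preservation of the exploration invariant, and the bound of twice the total length -/

section

variable {V P : Type*} {G : WeightedGraph V P} {e : Agent → ℝ → ℝ} {start : Agent → V}
  {T t B : ℝ} {c c' : Config V P EMark} {i j : Agent} {p : P} {s s' : ℝ} {m : EMark}
  {x : Run G exploration e start T}

theorem Config.flat_exchange :
    (c.exchange i j p s s' m).flat = c.flat.exchange i j p 0 0 m := by
  simp only [Config.exchange, Config.flat, Config.mk.injEq, true_and]
  funext k
  by_cases h : k = i
  · subst h; simp [Loc.flat]
  · by_cases h' : k = j
    · subst h'; simp [h, Loc.flat]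
    · simp [h, h']

theorem exchange_arrive [d : DecidableEq Agent] :
    (c.exchange i j p s s' m).arrive G exploration i p .blank =
      Config.arrive G exploration { c with loc := Function.update c.loc j (.edge p s' m) } i p
        .blank := by
  simp only [Config.arrive, Config.exchange, Config.mk.injEq]
  refine ⟨rfl, trivial, ?_⟩
  funext k
  by_cases h : k = i
  · subst h; simp
  · by_cases h' : k = j
    · subst h'; simp [h]
    · simp [h, h']

theorem exchange_loc_self : (c.exchange i j p s s' m).loc i = .edge p s .blank :=
  Function.update_self ..

theorem exchange_loc_other (hij : i ≠ j) : (c.exchange i j p s s' m).loc j = .edge p s' m :=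
  (Function.update_of_ne hij.symm _ _).trans (Function.update_self ..)

theorem Run.Track.not_approaching (h : x.Track t c) (hi : c.loc i = .edge p (G.len p) m) :
    ¬ Approaching G c (cost e t) B := by
  rintro ⟨k, j, r, s, m, s', m', hkj, hk, hj, -, -, h1, -⟩
  have h3 := (h _ _ _ _ hk).1
  have h4 := (h _ _ _ _ hj).1
  rcases Agent.eq_or_eq hkj i with rfl | rfl
  · rw [hi] at hk; cases hk
    linarith
  · rw [hi] at hj; cases hj
    rw [G.len_rev] at h1
    linarith

variable [Fintype P]

theorem Run.Progress.advance (he : IsAdversary e) {k : ℕ} (hk : k ≤ x.n) (h1 : x.time k ≤ t)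
    (h2 : t ≤ x.time (k + 1)) (hadv : CanAdvance G exploration e (x.config k) (x.time k) t)
    (h : x.Progress B (x.time k) (x.config k)) :
    x.Finished t ∨ x.Progress B t ((x.config k).advance e (x.time k) t) := by
  have h0 : 0 ≤ x.time k := x.time_nonneg (by omega)
  -- Energy is lost only at a node where no line applies; there the algorithm has stopped, and the
  -- graph is explored.
  by_cases hn : ∃ i u q, (x.config k).loc i = .node u q ∧
      chosenLine G exploration (x.config k) i u = none
  · have h3 : x.StopsAt (x.time k) := ⟨_, x.isAt_config hk, Or.inl hn⟩
    obtain ⟨i, u, q, h4, h5⟩ := hn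
    exact Or.inl ⟨_, ⟨h0, h1⟩, h3, h.explored_of_stuck h4 h5⟩
  push Not at hn
  have hC : ∀ p, x.Covered (x.time k) p → x.Covered t p := fun _ => Run.Covered.mono h1
  have htr := transits_advance hadv hn
  have hT := h.track.advance he hk h1 h2 hadv
  rcases h.phase with ⟨h3, h4⟩ | ⟨h3, i, j, p, s, m, s', m', hij, hi, hj, hm, hm', h4, h5⟩ |
      ⟨⟨i, j, p, hij, h3⟩, h4⟩
  · refine Or.inr ⟨hT, Or.inl ⟨?_, ?_⟩⟩
    · rw [Config.flat_advance]
      exact h3.mono hC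
    · change _ + effort G (x.config k).mark + _ ≤ _
      linarith
  · have hi' : ∀ τ, ((x.config k).advance e (x.time k) τ).loc i =
        .edge p (s + (e i τ - e i (x.time k))) m := fun τ => by
      rw [Config.advance_loc_edge, hi]; simp
    have hj' : ∀ τ, ((x.config k).advance e (x.time k) τ).loc j =
        .edge (G.rev p) (s' + (e j τ - e j (x.time k))) m' := fun τ => by
      rw [Config.advance_loc_edge, hj]; simp
    -- A zero of this sum is a meeting between two discarded passages, hence a stop. Without one,
    -- the agents still approach, by continuity.
    by_cases hmeet : ∃ τ ∈ Set.Icc (x.time k) t,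
        s + (e i τ - e i (x.time k)) + (s' + (e j τ - e j (x.time k))) - G.len p = 0
    · obtain ⟨τ, hτ, h6⟩ := hmeet
      refine Or.inl ⟨τ, ⟨h0.trans hτ.1, hτ.2⟩, ?_, Run.ExploredBy.mono hτ.1 h3⟩
      exact (x.isAt hk hτ.1 (hτ.2.trans h2)).stopsAt hij (hi' τ) (hj' τ) (by linarith) hm hm'
    · have h6 := neg_of_forall_ne_zero
        (f := fun τ => s + (e i τ - e i (x.time k)) + (s' + (e j τ - e j (x.time k))) - G.len p)
        (by have := he.continuous i; have := he.continuous j; fun_prop) h1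
        (by simp only [sub_self]; linarith) fun τ hτ h0 => hmeet ⟨τ, hτ, h0⟩
      refine Or.inr ⟨hT, Or.inr (Or.inl ⟨Run.ExploredBy.mono h1 h3, i, j, p, _, m, _, m', hij,
        hi' t, hj' t, hm, hm', by linarith, ?_⟩)⟩
      simp only [cost_eq_sum, Agent.sum_eq hij] at h5 ⊢
      linarith
  · refine Or.inr ⟨hT, Or.inr (Or.inr ⟨⟨i, j, p, hij, ?_⟩, by linarith⟩)⟩
    rw [Config.flat_advance]
    exact { h3 with cov := fun q => hC q (h3.cov q) }

theorem Run.Progress.depart (h : x.Progress B t c) (ht : 0 ≤ t) {u : V} {q : Option P}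
    {l : Line EMark} (hi : c.loc i = .node u q) (hl : chosenLine G exploration c i u = some l)
    (hu : G.node p = u) (hp : c.mark p = l.out) (hat : x.IsAt t (c.depart i p l)) :
    x.Finished t ∨ x.Progress B t (c.depart i p l) := by
  have hT := h.track.depart ht hat
  have hif := Config.flat_loc_node.2 hi
  have hend : ∀ {j r}, i ≠ j → p = G.rev r →
      Closing G (c.flat.depart i p l) (x.Covered t) j i r → cost e t + transits G c ≤ B →
      x.Finished t ∨ x.Progress B t (c.depart i p l) := by
    rintro j r hij rfl h1 hB
    rw [← Config.flat_depart] at h1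
    refine Run.Progress.of_closing ht hat hij.symm h1 hT depart_loc_self ?_
    rw [depart_loc_other hij]
    rw [transits_eq hij, hi] at hB
    simpa only [Loc.transit, zero_add] using hB
  rcases h.phase with ⟨h1, h2⟩ | ⟨-, k, j, r, s, m, s', m', hkj, hk, hj, -⟩ |
      ⟨⟨k, j, r, hkj, h1⟩, h2⟩
  · obtain ⟨j, ki, kj, hij, h1⟩ := h1.roles hif
    rcases h1.depart hij Run.covered_rev hif hl hu hp with ⟨h3, h4⟩ | ⟨r, h3, h4⟩
    · have h3 : effort G (c.depart i p l).mark + G.len p ≤ effort G c.mark := h3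
      have h5 := transits_depart (G := G) (p := p) hij hi (l := l)
      rw [← Config.flat_depart] at h4
      refine Or.inr ⟨hT, ?_⟩
      rcases h4 with h4 | h4
      · exact Or.inl ⟨h4, by linarith⟩
      · have := effort_nonneg (G := G) (c.depart i p l).mark
        exact Or.inr (Or.inr ⟨⟨_, _, _, hij.symm, h4⟩, by linarith⟩)
    · have := effort_nonneg (G := G) c.mark
      exact hend hij h3 h4 (by linarith)
  · rcases Agent.eq_or_eq hkj i with rfl | rfl
    · rw [hi] at hk; cases hk
    · rw [hi] at hj; cases hj
  · rcases Agent.eq_or_eq hkj i with rfl | rfl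
    · obtain ⟨h3, h4⟩ := h1.depart hkj hif hl hp
      exact hend hkj h3 h4 h2
    · exact absurd (hif.symm.trans h1.right) (by simp)

theorem Run.Track.progress_arrive (h : x.Track t c) (h1 : Stage G c.flat (x.Covered t))
    (h2 : cost e t + effort G c.mark + transits G c ≤ B)
    (hi : c.loc i = .edge p (G.len p) m)
    (hfirst : ∀ s, c.loc i.other = .edge p s .blank → m = .blank) :
    x.Progress B t (c.arrive G exploration i p m) := by
  refine ⟨h.arrive, Or.inl ?_⟩
  obtain ⟨h3, h4⟩ := h1.arrive (Config.flat_loc_edge hi) (fun s hs => by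
    obtain ⟨s', hs⟩ := Config.exists_of_flat_loc_edge hs
    exact hfirst s' hs) (h.covered hi) Run.covered_rev
  have h3 : effort G (c.arrive G exploration i p m).mark ≤ effort G c.mark := by
    rwa [← Config.flat_arrive] at h3
  rw [transits_arrive i.other_ne hi, Config.flat_arrive]
  exact ⟨h4, by linarith⟩

theorem Run.Progress.event (h : x.Progress B t c) (ht : 0 ≤ t)
    (hev : Event G exploration e t i c c') (hat : x.IsAt t c') :
    x.Finished t ∨ x.Progress B t c' := by
  cases hev with
  | depart u q l p hi hmove hl hp htie => exact h.depart ht hi hl hp.1 hp.2 hat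
  | arrive p m hi hfirst =>
    rcases h.phase with ⟨h1, h2⟩ | ⟨-, h1⟩ | ⟨⟨k, j, r, hkj, h1⟩, h2⟩
    · exact Or.inr (h.track.progress_arrive h1 h2 hi hfirst)
    · exact (h.track.not_approaching hi h1).elim
    · have hif := Config.flat_loc_edge hi
      obtain ⟨q, h3⟩ := h1.left
      rcases Agent.eq_or_eq hkj i with rfl | rfl
      · rw [hif] at h3; cases h3
      · have h4 := h1.right
        rw [hif] at h4; cases h4
        -- The agent that arrives replaces the $B$ by which `k` was to return. Now all passages of
        -- the graph are discarded, so `k` has no line and the algorithm stops.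
        refine Or.inl ⟨t, ⟨ht, le_rfl⟩, ⟨_, hat, Or.inl ⟨k, G.node (G.rev p), q, ?_,
          exploration_not_chosen_iff fun q _ => h1.arrive q⟩⟩, h1.cov⟩
        rw [arrive_loc_other hkj.symm]
        exact Config.flat_loc_node.1 h3
  | overtake p m s hi hj hm =>
    rcases h.phase with ⟨h1, h2⟩ | ⟨-, h1⟩ | ⟨⟨k, j, r, hkj, h1⟩, h2⟩
    · right
      -- The event uses the classical decision of equality of agents; `exchange_arrive` holds for
      -- any instance and identifies the event with an exchange followed by an arrival.
      have key : x.Progress B t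
          ((c.exchange i i.other p (G.len p) s m).arrive G exploration i p .blank) → _ :=
        fun h => exchange_arrive (d := fun a b => Classical.propDecidable (a = b)) ▸ h
      refine key (Run.Track.progress_arrive ?_ ?_ ?_ exchange_loc_self fun _ _ => rfl)
      · intro k r s' m' hk
        rcases Agent.eq_or_eq i.other_ne k with rfl | rfl
        · rw [exchange_loc_self] at hk; cases hk
          exact h.track _ _ _ _ hi
        · rw [exchange_loc_other i.other_ne] at hk; cases hk
          exact h.track _ _ _ _ hj
      · rw [Config.flat_exchange]
        exact h1.exchange i.other_ne (Config.flat_loc_edge hi) (Config.flat_loc_edge hj) hm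
      · rw [transits_eq i.other_ne, hi, hj] at h2
        rw [transits_eq i.other_ne, exchange_loc_self, exchange_loc_other i.other_ne]
        exact h2
    · exact (h.track.not_approaching hi h1).elim
    · obtain ⟨q, h3⟩ := h1.left
      have h3 := Config.flat_loc_node.1 h3
      rcases Agent.eq_or_eq i.other_ne k with rfl | rfl
      · rw [hi] at h3; cases h3
      · rw [hj] at h3; cases h3

/-- The invariant holds until the algorithm stops. -/
theorem Run.finished_or_progress {origin : V} {x : Run G exploration e (fun _ => origin) T}
    (he : IsAdversary e) {k : ℕ} (hk : k ≤ x.n) (h1 : x.time k ≤ t) (h2 : t ≤ x.time (k + 1)) :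
    x.Finished t ∨
      x.Progress (2 * G.totalLength) t ((x.config k).advance e (x.time k) t) := by
  refine x.sweep he (x.Progress (2 * G.totalLength)) x.Finished
    (fun t t' htt h => h.mono htt) (Or.inr ⟨?_, Or.inl ⟨stage_initial origin, ?_⟩⟩)
    (fun k hk t h1 h2 hadv h => h.advance he hk h1 h2 hadv)
    (fun k hk i hev h => h.event (x.time_nonneg (by omega)) hev (x.isAt_config (by omega)))
    hk h1 h2
  · intro i p s m h; cases h
  · rw [effort_initial, cost, he.zero, he.zero]
    simp [transits, initial, Loc.transit]

theorem exploration_cost_le (he : IsAdversary e) (origin : V)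
    (x : Run G exploration e (fun _ => origin) T) (hT : 2 * G.totalLength ≤ cost e T) :
    ∃ t ∈ Set.Icc 0 T, x.ExploredBy t ∧ cost e t ≤ 2 * G.totalLength := by
  obtain ⟨t, ht, hc⟩ := exists_cost_eq he x.nonneg
    (mul_nonneg (by norm_num) G.totalLength_nonneg) hT
  obtain ⟨k, hk, h1, h2⟩ := x.exists_index ht
  rcases x.finished_or_progress he hk h1 h2 with ⟨r, hr, -, h⟩ | h
  · exact ⟨t, ht, Run.ExploredBy.mono hr.2 h, hc.le⟩
  · exact ⟨t, ht, h.explored_of_cost hc, hc.le⟩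

theorem exploration_stop (he : IsAdversary e) (origin : V)
    (x : Run G exploration e (fun _ => origin) T) (h : x.StopsAt t) : x.ExploredBy t := by
  obtain ⟨c, ⟨k, hk, h1, h2, rfl⟩, h⟩ := h
  rcases x.finished_or_progress he hk h1 h2 with ⟨r, hr, -, h⟩ | h'
  · exact Run.ExploredBy.mono hr.2 h
  · exact h'.explored_of_stopped h

theorem exploration_cost_of_not_stop (he : IsAdversary e) (origin : V)
    (x : Run G exploration e (fun _ => origin) T) (h : ∀ t ∈ Set.Icc 0 T, ¬ x.StopsAt t) :
    cost e T ≤ 2 * G.totalLength := by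
  obtain ⟨k, hk, h1, h2⟩ := x.exists_index ⟨x.nonneg, le_rfl⟩
  rcases x.finished_or_progress he hk h1 h2 with ⟨r, hr, h', -⟩ | h'
  · exact absurd h' (h r hr)
  · exact h'.cost_le

end

end MobileAgents

theorem mainTheorem8 {V P : Type*} [Fintype P] (G : MobileAgents.WeightedGraph V P)
    (e : MobileAgents.Agent → ℝ → ℝ) (he : MobileAgents.IsAdversary e) (T : ℝ) :
    (∀ (origin : V) (x : MobileAgents.Run G MobileAgents.exploration e (fun _ => origin) T),
      (2 * G.totalLength ≤ MobileAgents.cost e T →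
        ∃ t ∈ Set.Icc 0 T, x.ExploredBy t ∧ MobileAgents.cost e t ≤ 2 * G.totalLength) ∧
      (∀ t ∈ Set.Icc 0 T, x.StopsAt t → x.ExploredBy t) ∧
      ((∀ t ∈ Set.Icc 0 T, ¬ x.StopsAt t) → MobileAgents.cost e T ≤ 2 * G.totalLength)) ∧
    (∀ (start : MobileAgents.Agent → V)
        (x : MobileAgents.Run G MobileAgents.rendezvous e start T),
      3 * G.totalLength ≤ MobileAgents.cost e T →
        ∃ t ∈ Set.Icc 0 T, x.MeetAt t ∧ MobileAgents.cost e t ≤ 3 * G.totalLength) := by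
  refine ⟨fun origin x => ⟨?_, ?_, ?_⟩, fun start x => MobileAgents.rendezvous_meetAt he x⟩
  · exact MobileAgents.exploration_cost_le he origin x
  · exact fun t _ => MobileAgents.exploration_stop he origin x
  · exact MobileAgents.exploration_cost_of_not_stop he origin x
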